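/- For each $n\in\mathbb N$ let $\mathbf d_n=((d_1^-,d_1^+),\dots,(d_n^-,d_n^+))$ be a bi-degree sequence of non-negative integers with $m=m_n:=\sum_{v\in[n]}d_v^+=\sum_{v\in[n]}d_v^-$, and let $\Delta^-=\Delta^-_n:=\max_{v\in[n]}d_v^-$. Assume that there are constants $\eta,C_0>0$ and $K\ge 2$ such that for all $n$: (i) $d_v^+\ge 2$ for all $v\in[n]$; (ii) $d_v^+\le K$ for all $v\in[n]$; (iii) $\sum_{v\in[n]}(d_v^-)^{2+\eta}\le C_0 n$. Let $G=G_n$ be the directed configuration model: each vertex $v$ carries $d_v^-$ heads and $d_v^+$ tails, the $m$ tails are matched to the $m$ heads by a uniformly random bijection, and a directed edge $(u,v)$ is added for every tail of $u$ matched to a head of $v$. Let $P(y,x)=m(y,x)/d_y^+$, where $m(y,x)$ is the multiplicity of the edge $(y,x)$ in $G$, be the transition matrix of the simple random walk on $G$. With high probability (whp), that is, with probability tending to $1$ as $n\to\infty$, this walk has a unique stationary distribution $\pi$ (a probability vector with $\pi(x)=\sum_{y}\pi(y)P(y,x)$ for all $x\in[n]$); let $\pi_{\max}=\max_{v\in[n]}\pi(v)$.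 Then: (i) There is an absolute constant $C>0$ (not depending on the sequence $(\mathbf d_n)$ or on $\eta,C_0,K$) such that, whp, $\pi$ is unique and $$\pi_{\max}\le C\log(n)\,\frac{\Delta^-}{m}.$$ (ii) If moreover $\Delta^-\to\infty$ as $n\to\infty$, then for every $\varepsilon>0$, whp, $\pi$ is unique and $$\pi_{\max}\ge (1-\varepsilon)\,\frac{\Delta^-}{m}.$$ -/

import Mathlib

open Filter Topology MeasureTheory

noncomputable section

/-- A bi-degree sequence on the vertex set `Fin n`: in-degrees and out-degrees with equal sums. -/
structure BiDegree (n : ℕ) where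
  inDeg : Fin n → ℕ
  outDeg : Fin n → ℕ
  sum_eq : ∑ v, outDeg v = ∑ v, inDeg v

namespace BiDegree

variable {n : ℕ} (d : BiDegree n)

/-- The number `m` of edges. -/
def numEdges : ℕ := ∑ v, d.outDeg v

/-- The maximum in-degree `Δ⁻`. -/
def maxInDeg : ℕ := Finset.univ.sup d.inDeg

/-- Tails: `d⁺_v` of them are attached to each vertex `v`. -/
abbrev Tail : Type := Σ v : Fin n, Fin (d.outDeg v)

/-- Heads: `d⁻_v` of them are attached to each vertex `v`. -/
abbrev Head : Type := Σ v : Fin n, Fin (d.inDeg v)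

/-- The sample space of the directed configuration model: bijections from tails to heads. -/
abbrev Matching : Type := d.Tail ≃ d.Head

instance instNonemptyMatching : Nonempty d.Matching := by
  refine ⟨Fintype.equivOfCardEq ?_⟩
  simpa using d.sum_eq

instance instMeasurableSpaceMatching : MeasurableSpace d.Matching := ⊤

/-- The law of the directed configuration model: the uniform probability measure on matchings. -/
def dcm : Measure d.Matching := (PMF.uniformOfFintype d.Matching).toMeasure

variable {d}

/-- The multiplicity `m(y, x)` of the directed edge `(y, x)` in the multigraph given by `ω`:
the number of tails of `y` matched to a head of `x`. -/
def edgeMult (ω : d.Matching) (y x : Fin n) : ℕ :=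
  Fintype.card {e : d.Tail // e.1 = y ∧ (ω e).1 = x}

/-- The transition matrix `P(y, x) = m(y, x) / d⁺_y` of the simple random walk. -/
def transition (ω : d.Matching) : Matrix (Fin n) (Fin n) ℝ :=
  Matrix.of fun y x => (edgeMult ω y x : ℝ) / (d.outDeg y : ℝ)

/-- `π` is a stationary distribution of the simple random walk: a probability vector such that
`π(x) = ∑ y, π(y) P(y, x)` for all `x`. -/
def IsStationary (ω : d.Matching) (π : Fin n → ℝ) : Prop :=
  π ∈ stdSimplex ℝ (Fin n) ∧ ∀ x, π x = ∑ y, π y * transition ω y x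

/-- The simple random walk has a unique stationary distribution `π`, and the maximum
`π_max = max_v π(v)` satisfies `p`. -/
def PiMaxSatisfies (ω : d.Matching) (p : ℝ → Prop) : Prop :=
  ∃ π : Fin n → ℝ, IsStationary ω π ∧ (∀ π', IsStationary ω π' → π' = π) ∧ p (⨆ v, π v)

end BiDegree

/-- The standing assumption on a sequence of bi-degree sequences: minimum out-degree at least 2,
bounded out-degrees, and bounded `(2 + η)`-moment of the in-degrees, uniformly in `n`. -/
def DegreeCondition (d : (n : ℕ) → BiDegree n) : Prop :=
  ∃ (η C : ℝ) (K : ℕ), 0 < η ∧ 0 < C ∧ 2 ≤ K ∧ ∀ n,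
    (∀ v, 2 ≤ (d n).outDeg v) ∧
    (∀ v, (d n).outDeg v ≤ K) ∧
    ∑ v, ((d n).inDeg v : ℝ) ^ (2 + η) ≤ C * (n : ℝ)

/-- The events `E n` on the `n`-th configuration model occur with high probability. -/
def Whp (d : (n : ℕ) → BiDegree n) (E : (n : ℕ) → Set (d n).Matching) : Prop :=
  Tendsto (fun n => (d n).dcm (E n)) atTop (𝓝 1)

end

/-! The proof studies `startP ω t`, the law after `t` steps of the walk started from the in-degree
distribution `d⁻/m`. It shows that `π` is very close to `startP` after polylogarithmically many
steps, and then estimates `startP` itself.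

Every probability is computed by revealing the matching one tail at a time: given a partial
matching, an unmatched tail is matched to a uniform free head (`cavg_reveal`). A walk follows a list
of choices that does not depend on the matching, so averages over walks and over matchings can be
exchanged. An exploration of `N` edges from `y` given vertices has `j` or more excess edges with
probability at most `collRate d y N ^ j` (`Explore.prob_excess_le`). Here `collRate` is a
polylogarithm times `Δ⁻/n`, and the moment condition makes every polylogarithm times `(Δ⁻)²/n` tend
to zero.

Mixing. The meeting probability `meetAvg t f f'` of two walks leaving through `f` and `f'` is almost
the same for all pairs `f = f'`, and for all pairs `f ≠ f'`: relabelling tails preserves the law of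
the matching, and it affects two distinct meeting walks only if a relabelled tail is used, which
forces two excess edges (`excess_of_meet`, `meetAvg_le`). The meeting matrix is thus close to `(a -
b) I + b J`, with `J` the all-ones matrix, which acts as a scalar on vectors of sum zero. Averaging
over the at least two tails of a vertex halves the mean square distance to the mean law, up to small
errors (`avg_sq_walkP_sub_le`, `spread_le`). After `2 log₂ n` steps, up to rounding, the sum of all
square distances is small, hence the transition matrix contracts mean-zero vectors. This gives
uniqueness of `π` and exponential convergence (`exists_unique_isStationary_of_close`).

Upper bound. Near a target `x` one shortest path to `x` is selected from every vertex. `startP ω r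
x` splits into `coreStart`, carried by walks whose steps are all selected, and a sum over the tail
`g` of the last non-selected step (`startP_eq_core_add`). Such a `g` is a fork. If all earlier laws
are bounded by `M`, one fork contributes at most `M / 2`, because out-degrees are at least two.
Contributions of pairs of distinct forks are negligible with high probability for all `x`
simultaneously (`avg_forkPairs_le`). Contributions of single forks are not negligible uniformly in
`x`, which is why they are absorbed in the recursion `M ≤ a + M / 2 + b`
(`startP_le_of_core_of_forkPairs`). Finally the `k`-th moment of `coreStart` is at most `(3 (k + 1)
Δ⁻ / (m - k r)) ^ k` (`avg_coreStart_pow_le`); Markov's inequality with `k` of order `log n` and a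
union bound produce the factor `log n`.

Lower bound. At a vertex `x` of maximal in-degree, the expectation of `startP` is at least about
`Δ⁻/m` (`le_avg_startP`), and for a single `x` the expected contribution of all forks is negligible
(`avg_sum_forkTerm_le`). The second moment of `coreStart` exceeds `(Δ⁻/m)²` only by a vanishing
factor, whose degree-dependent part is of order `∑ (d⁻)² / (m Δ⁻) = O(1 / Δ⁻)`
(`avg_coreStart_sq_le`). Chebyshev's inequality concludes. -/

noncomputable section

namespace BiDegree

/-! ### Averages over matchings, conditioned on a partial matching -/

section Averages

variable {n : ℕ} {d : BiDegree n}

lemma card_tail : Fintype.card d.Tail = d.numEdges := by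
  simp [numEdges]

lemma card_head : Fintype.card d.Head = d.numEdges := by
  simp [numEdges, d.sum_eq]

lemma card_matching : Fintype.card d.Matching = d.numEdges.factorial := by
  rw [Fintype.card_equiv (Classical.arbitrary d.Matching), card_tail]

/-- The average of `F` over all matchings. -/
def avg (F : d.Matching → ℝ) : ℝ := (∑ ω, F ω) / (Fintype.card d.Matching : ℝ)

/-- The average of `F` over the matchings that agree with `ω₀` on `S`. -/
def cavg (S : Finset d.Tail) (ω₀ : d.Matching) (F : d.Matching → ℝ) : ℝ :=
  (∑ ω : d.Matching, if ∀ f ∈ S, ω f = ω₀ f then F ω else 0) /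
    ((d.numEdges - S.card).factorial : ℝ)

lemma cavg_empty (ω₀ : d.Matching) (F : d.Matching → ℝ) : cavg ∅ ω₀ F = avg F := by
  simp [cavg, avg, card_matching]

/-- The matching obtained from `ω₀` by redirecting the tail `f` to the head `e`. -/
def redirect (ω₀ : d.Matching) (f : d.Tail) (e : d.Head) : d.Matching :=
  ω₀.trans (Equiv.swap (ω₀ f) e)

@[simp] lemma redirect_self (ω₀ : d.Matching) (f : d.Tail) (e : d.Head) :
    redirect ω₀ f e f = e := by
  simp [redirect]

lemma redirect_of_mem {S : Finset d.Tail} {ω₀ : d.Matching} {f : d.Tail} {e : d.Head}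
    (hf : f ∉ S) (he : e ∉ S.image ω₀) {g : d.Tail} (hg : g ∈ S) :
    redirect ω₀ f e g = ω₀ g := by
  have h1 : ω₀ g ≠ ω₀ f := fun h => hf (by rwa [← ω₀.injective h])
  have h2 : ω₀ g ≠ e := fun h => he (h ▸ Finset.mem_image_of_mem _ hg)
  simp [redirect, Equiv.swap_apply_of_ne_of_ne h1 h2]

lemma card_le_numEdges (S : Finset d.Tail) : S.card ≤ d.numEdges := by
  rw [← card_tail (d := d)]; exact Finset.card_le_univ S

lemma card_lt_numEdges {S : Finset d.Tail} {f : d.Tail} (hf : f ∉ S) :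
    S.card < d.numEdges := by
  have := card_le_numEdges (insert f S)
  rw [Finset.card_insert_of_notMem hf] at this
  omega

/-- The tower property: an unmatched tail is uniform over the free heads. The matching `redirect ω₀
f e` only serves as a witness of the enlarged partial matching. -/
lemma cavg_reveal {S : Finset d.Tail} {f : d.Tail} (hf : f ∉ S) (ω₀ : d.Matching)
    (F : d.Matching → ℝ) :
    cavg S ω₀ F = (∑ e ∈ (S.image ω₀)ᶜ, cavg (insert f S) (redirect ω₀ f e) F) /
      ((d.numEdges : ℝ) - S.card) := by
  have hlt := card_lt_numEdges hf
  have hfac : ((d.numEdges - S.card).factorial : ℝ) =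
      ((d.numEdges : ℝ) - S.card) * ((d.numEdges - (insert f S).card).factorial : ℝ) := by
    rw [Finset.card_insert_of_notMem hf]
    obtain ⟨r, hr⟩ : ∃ r, d.numEdges - S.card = r + 1 := ⟨d.numEdges - S.card - 1, by omega⟩
    have h2 : d.numEdges - (S.card + 1) = r := by omega
    have h3 : ((d.numEdges : ℝ) - S.card) = r + 1 := by
      rw [← Nat.cast_sub hlt.le, hr]; push_cast; ring
    rw [h2, hr, h3, Nat.factorial_succ]; push_cast; ring
  have key : (∑ ω : d.Matching, if ∀ f ∈ S, ω f = ω₀ f then F ω else 0) =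
      ∑ e ∈ (S.image ω₀)ᶜ, ∑ ω : d.Matching,
        if ∀ g ∈ insert f S, ω g = redirect ω₀ f e g then F ω else 0 := by
    rw [Finset.sum_comm]
    refine Finset.sum_congr rfl fun ω _ => ?_
    split_ifs with h
    · have hmem : ω f ∈ (S.image ω₀)ᶜ := by
        rw [Finset.mem_compl, Finset.mem_image]
        rintro ⟨g, hg, hgf⟩
        rw [← h g hg] at hgf
        exact hf (ω.injective hgf ▸ hg)
      rw [Finset.sum_eq_single_of_mem _ hmem]
      · rw [if_pos]
        intro g hg
        rcases Finset.mem_insert.1 hg with rfl | hg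
        · simp
        · rw [redirect_of_mem hf (Finset.mem_compl.1 hmem) hg, h g hg]
      · intro e he hne
        rw [if_neg]
        intro h'
        have := h' f (Finset.mem_insert_self _ _)
        rw [redirect_self] at this
        exact hne this.symm
    · refine (Finset.sum_eq_zero fun e he => if_neg fun h' => h fun g hg => ?_).symm
      rw [h' g (Finset.mem_insert_of_mem hg), redirect_of_mem hf (Finset.mem_compl.1 he) hg]
  unfold cavg
  rw [key, ← Finset.sum_div, hfac, div_div, mul_comm]

lemma cavg_mono {S : Finset d.Tail} {ω₀ : d.Matching} {F G : d.Matching → ℝ}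
    (h : ∀ ω : d.Matching, (∀ f ∈ S, ω f = ω₀ f) → F ω ≤ G ω) :
    cavg S ω₀ F ≤ cavg S ω₀ G := by
  unfold cavg
  gcongr with ω
  split_ifs with h'
  · exact h ω h'
  · exact le_rfl

lemma cavg_congr {S : Finset d.Tail} {ω₀ : d.Matching} {F G : d.Matching → ℝ}
    (h : ∀ ω : d.Matching, (∀ f ∈ S, ω f = ω₀ f) → F ω = G ω) :
    cavg S ω₀ F = cavg S ω₀ G :=
  le_antisymm (cavg_mono fun ω hω => (h ω hω).le) (cavg_mono fun ω hω => (h ω hω).ge)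

lemma cavg_sum {ι : Type*} (s : Finset ι) (S : Finset d.Tail) (ω₀ : d.Matching)
    (F : ι → d.Matching → ℝ) :
    cavg S ω₀ (fun ω => ∑ i ∈ s, F i ω) = ∑ i ∈ s, cavg S ω₀ (F i) := by
  unfold cavg
  rw [← Finset.sum_div, Finset.sum_comm]
  congr 1
  refine Finset.sum_congr rfl fun ω _ => ?_
  split_ifs <;> simp

lemma cavg_const_mul (c : ℝ) (S : Finset d.Tail) (ω₀ : d.Matching) (F : d.Matching → ℝ) :
    cavg S ω₀ (fun ω => c * F ω) = c * cavg S ω₀ F := by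
  unfold cavg
  rw [← mul_div_assoc, Finset.mul_sum]
  congr 1
  refine Finset.sum_congr rfl fun ω _ => ?_
  split_ifs <;> simp

lemma cavg_nonneg {S : Finset d.Tail} {ω₀ : d.Matching} {F : d.Matching → ℝ}
    (h : ∀ ω, 0 ≤ F ω) : 0 ≤ cavg S ω₀ F := by
  unfold cavg
  refine div_nonneg (Finset.sum_nonneg fun ω _ => ?_) (Nat.cast_nonneg _)
  split_ifs
  · exact h ω
  · exact le_rfl

lemma card_image_compl (S : Finset d.Tail) (ω₀ : d.Matching) :
    (((S.image ω₀)ᶜ).card : ℝ) = (d.numEdges : ℝ) - S.card := by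
  rw [Finset.card_compl, Finset.card_image_of_injective _ ω₀.injective, card_head,
    Nat.cast_sub (card_le_numEdges S)]

/-- This justifies the factorial in `cavg` as a normalisation; it follows by revealing the remaining
tails one by one. -/
lemma cavg_one (S : Finset d.Tail) (ω₀ : d.Matching) : cavg S ω₀ (fun _ => 1) = 1 := by
  induction hr : d.numEdges - S.card generalizing S ω₀ with
  | zero =>
    have huniv : S = Finset.univ := by
      rw [← Finset.card_eq_iff_eq_univ, card_tail]
      have := card_le_numEdges S
      omega
    have : ∀ ω : d.Matching, (∀ f ∈ S, ω f = ω₀ f) ↔ ω = ω₀ := by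
      intro ω
      subst huniv
      exact ⟨fun h => Equiv.ext fun f => h f (Finset.mem_univ f), fun h => by simp [h]⟩
    simp [cavg, this, hr]
  | succ r ih =>
    obtain ⟨f, hf⟩ : ∃ f, f ∉ S := by
      by_contra! h
      have : S = Finset.univ := Finset.eq_univ_iff_forall.2 h
      rw [this, Finset.card_univ, card_tail] at hr
      omega
    have hlt := card_lt_numEdges hf
    rw [cavg_reveal hf, Finset.sum_congr rfl fun e _ =>
      ih (insert f S) (redirect ω₀ f e) (by rw [Finset.card_insert_of_notMem hf]; omega)]
    rw [Finset.sum_const, nsmul_eq_mul, mul_one, card_image_compl, div_self]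
    have : (S.card : ℝ) < d.numEdges := by exact_mod_cast hlt
    linarith

lemma cavg_const (c : ℝ) (S : Finset d.Tail) (ω₀ : d.Matching) : cavg S ω₀ (fun _ => c) = c := by
  have := cavg_const_mul c S ω₀ (fun _ => 1)
  simpa [cavg_one] using this

/-- Revealing one unmatched tail when the bound splits into a uniform part and a part depending on
the head. -/
lemma cavg_reveal_le_add {S : Finset d.Tail} {f : d.Tail} (hf : f ∉ S) (ω₀ : d.Matching)
    {F : d.Matching → ℝ} {b : d.Head → ℝ} {c : ℝ} (hb : ∀ e, 0 ≤ b e)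
    (h : ∀ e, e ∉ S.image ω₀ → cavg (insert f S) (redirect ω₀ f e) F ≤ b e + c) :
    cavg S ω₀ F ≤ (∑ e, b e) / ((d.numEdges : ℝ) - S.card) + c := by
  have hlt : (S.card : ℝ) < d.numEdges := by exact_mod_cast card_lt_numEdges hf
  have hpos : 0 < (d.numEdges : ℝ) - S.card := by linarith
  rw [cavg_reveal hf, div_add' _ _ _ hpos.ne']
  refine div_le_div_of_nonneg_right ?_ hpos.le
  refine (Finset.sum_le_sum fun e he => h e (Finset.mem_compl.1 he)).trans ?_
  rw [Finset.sum_add_distrib, Finset.sum_const, nsmul_eq_mul, card_image_compl, mul_comm c]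
  refine add_le_add_left ?_ _
  exact Finset.sum_le_sum_of_subset_of_nonneg (Finset.subset_univ _) fun e _ _ => hb e

lemma sum_head (g : Fin n → ℝ) : ∑ e : d.Head, g e.1 = ∑ v, (d.inDeg v : ℝ) * g v := by
  rw [Fintype.sum_sigma]
  simp

lemma inDeg_le_maxInDeg (v : Fin n) : d.inDeg v ≤ d.maxInDeg :=
  Finset.le_sup (f := d.inDeg) (Finset.mem_univ v)

lemma sum_inDeg : ∑ v, (d.inDeg v : ℝ) = d.numEdges := by
  rw [numEdges, d.sum_eq]; push_cast; rfl

/-- The number of heads attached to a set of vertices is at most `Δ⁻` times its size. -/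
lemma sum_head_mem_le (W : Finset (Fin n)) :
    ∑ e : d.Head, (if e.1 ∈ W then (1 : ℝ) else 0) ≤ W.card * d.maxInDeg := by
  rw [sum_head (fun v => if v ∈ W then (1 : ℝ) else 0)]
  simp only [mul_ite, mul_one, mul_zero, Finset.sum_ite_mem, Finset.univ_inter]
  refine (Finset.sum_le_card_nsmul _ _ (d.maxInDeg : ℝ) fun v _ => ?_).trans_eq (by simp)
  exact_mod_cast inDeg_le_maxInDeg v

/-! Basic properties of the plain average. -/

lemma avg_eq_cavg (ω₀ : d.Matching) (F : d.Matching → ℝ) : avg F = cavg ∅ ω₀ F :=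
  (cavg_empty ω₀ F).symm

lemma avg_mono {F G : d.Matching → ℝ} (h : ∀ ω, F ω ≤ G ω) : avg F ≤ avg G := by
  unfold avg
  gcongr with ω
  exact h ω

lemma avg_nonneg {F : d.Matching → ℝ} (h : ∀ ω, 0 ≤ F ω) : 0 ≤ avg F :=
  div_nonneg (Finset.sum_nonneg fun ω _ => h ω) (Nat.cast_nonneg _)

lemma avg_sum {ι : Type*} (s : Finset ι) (F : ι → d.Matching → ℝ) :
    avg (fun ω => ∑ i ∈ s, F i ω) = ∑ i ∈ s, avg (F i) := by
  unfold avg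
  rw [← Finset.sum_div, Finset.sum_comm]

lemma avg_add (F G : d.Matching → ℝ) : avg (fun ω => F ω + G ω) = avg F + avg G := by
  unfold avg
  rw [← add_div, ← Finset.sum_add_distrib]

lemma avg_const_mul (c : ℝ) (F : d.Matching → ℝ) : avg (fun ω => c * F ω) = c * avg F := by
  unfold avg
  rw [← mul_div_assoc, Finset.mul_sum]

lemma avg_const (c : ℝ) : avg (fun _ : d.Matching => c) = c := by
  rw [avg_eq_cavg (Classical.arbitrary _), cavg_const]

/-- Averages are invariant under relabelling the tails. -/
lemma avg_comp_tail (τ : Equiv.Perm d.Tail) (F : d.Matching → ℝ) :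
    avg (fun ω => F (τ.trans ω)) = avg F := by
  unfold avg
  congr 1
  exact Fintype.sum_equiv ⟨fun ω => τ.trans ω, fun ω => τ.symm.trans ω,
    fun ω => Equiv.ext fun f => by simp, fun ω => Equiv.ext fun f => by simp⟩ _ _ fun ω => rfl

open Classical in
/-- The probability of an event under the uniform matching. -/
def prob (A : d.Matching → Prop) : ℝ := avg fun ω => if A ω then 1 else 0

lemma prob_nonneg (A : d.Matching → Prop) : 0 ≤ prob A :=
  avg_nonneg fun ω => by split_ifs <;> norm_num

lemma prob_mono {A B : d.Matching → Prop} (h : ∀ ω, A ω → B ω) : prob A ≤ prob B := by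
  refine avg_mono fun ω => ?_
  by_cases hA : A ω
  · simp [hA, h ω hA]
  · simp only [hA, if_false]; split_ifs <;> norm_num

lemma prob_markov {F : d.Matching → ℝ} (hF : ∀ ω, 0 ≤ F ω) {c : ℝ} (hc : 0 < c) :
    prob (fun ω => c ≤ F ω) ≤ avg F / c := by
  rw [le_div_iff₀ hc, mul_comm, prob, ← avg_const_mul]
  refine avg_mono fun ω => ?_
  split_ifs with h
  · simpa using h
  · simpa using hF ω

lemma prob_or_le (A B : d.Matching → Prop) : prob (fun ω => A ω ∨ B ω) ≤ prob A + prob B := by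
  rw [prob, prob, prob, ← avg_add]
  refine avg_mono fun ω => ?_
  by_cases hA : A ω <;> by_cases hB : B ω <;> simp [hA, hB]

lemma prob_exists_le {ι : Type*} (s : Finset ι) (A : ι → d.Matching → Prop) :
    prob (fun ω => ∃ i ∈ s, A i ω) ≤ ∑ i ∈ s, prob (A i) := by
  simp only [prob]
  rw [← avg_sum]
  refine avg_mono fun ω => ?_
  split_ifs with h
  · obtain ⟨i, hi, hA⟩ := h
    refine le_trans ?_ (Finset.single_le_sum (fun j _ => ?_) hi)
    · simp [hA]
    · split_ifs <;> norm_num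
  · exact Finset.sum_nonneg fun j _ => by split_ifs <;> norm_num

end Averages

end BiDegree

namespace BiDegree

/-! ### Adaptive explorations of the matching and their collisions -/

section Explorations

variable {n : ℕ} {d : BiDegree n}

/-- An adaptive exploration: it queries the heads matched to tails, one after the other. -/
inductive Explore (d : BiDegree n) : Type
  | done : Explore d
  | query : d.Tail → (d.Head → Explore d) → Explore d

namespace Explore

/-- The exploration makes at most `N` queries. -/
def Within : ℕ → Explore d → Prop
  | _, done => True
  | 0, query _ _ => False
  | N + 1, query _ next => ∀ e, Within N (next e)

/-- The set of tails queried by the exploration in the matching `ω`. -/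
def tails (ω : d.Matching) : Explore d → Finset d.Tail
  | done => ∅
  | query f next => insert f (tails ω (next (ω f)))

/-- The number of newly revealed edges that land in a vertex already visited, if the tails in `R`
are already revealed and the vertices in `W` are already visited. -/
def coll (ω : d.Matching) : Explore d → Finset d.Tail → Finset (Fin n) → ℕ
  | done, _, _ => 0
  | query f next, R, W =>
    if f ∈ R then coll ω (next (ω f)) R W
    else (if (ω f).1 ∈ W then 1 else 0) + coll ω (next (ω f)) (insert f R) (insert (ω f).1 W)

lemma Within.succ {N : ℕ} {T : Explore d} (h : T.Within N) : T.Within (N + 1) := by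
  induction T generalizing N with
  | done => trivial
  | query f next ih =>
    cases N with
    | zero => exact absurd h id
    | succ N => exact fun e => ih e (h e)

lemma Within.mono {N M : ℕ} {T : Explore d} (h : T.Within N) (hNM : N ≤ M) : T.Within M := by
  induction hNM with
  | refl => exact h
  | step _ ih => exact ih.succ

/-- Every newly revealed edge either reaches a new vertex or is a collision, so collisions are the
difference between new edges and new vertices. This turns excess, a static count, into something
that can be estimated step by step. -/
lemma coll_add_card (ω : d.Matching) (T : Explore d) (R : Finset d.Tail) (W : Finset (Fin n))
    (hRW : ∀ f ∈ R, (ω f).1 ∈ W) :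
    T.coll ω R W + (W ∪ (T.tails ω).image fun f => (ω f).1).card + R.card =
      W.card + (R ∪ T.tails ω).card := by
  induction T generalizing R W with
  | done => simp [coll, tails]
  | query f next ih =>
    simp only [coll, tails]
    split_ifs with hf hW
    · rw [Finset.image_insert, Finset.union_insert, Finset.union_insert,
        Finset.insert_eq_of_mem (Finset.mem_union_left _ (hRW f hf)),
        Finset.insert_eq_of_mem (Finset.mem_union_left _ hf)]
      exact ih _ R W hRW
    · have := ih (ω f) (insert f R) (insert (ω f).1 W) (by
        intro g hg
        rcases Finset.mem_insert.1 hg with rfl | hg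
        · exact Finset.mem_insert_self _ _
        · exact Finset.mem_insert_of_mem (hRW g hg))
      rw [Finset.card_insert_of_notMem hf, Finset.insert_eq_of_mem hW, Finset.insert_union] at this
      rw [Finset.image_insert, Finset.union_insert, Finset.union_insert,
        Finset.insert_eq_of_mem (Finset.mem_union_left _ hW), Finset.insert_eq_of_mem hW]
      omega
    · have := ih (ω f) (insert f R) (insert (ω f).1 W) (by
        intro g hg
        rcases Finset.mem_insert.1 hg with rfl | hg
        · exact Finset.mem_insert_self _ _
        · exact Finset.mem_insert_of_mem (hRW g hg))
      rw [Finset.card_insert_of_notMem hf, Finset.insert_union, Finset.insert_union,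
        Finset.card_insert_of_notMem hW] at this
      rw [Finset.image_insert, Finset.union_insert, Finset.union_insert]
      omega

/-- With `a` bounding the chance that one new edge hits a visited vertex, a query either collides,
leaving `j` collisions for the rest, or leaves all `j + 1` for it. The induction closes because `a
(N a)^j + (N a)^(j+1) ≤ ((N+1) a)^(j+1)`. -/
lemma cavg_coll_le {w r : ℕ} (hr : r < d.numEdges) (T : Explore d) (N j : ℕ) (hT : T.Within N)
    (R : Finset d.Tail) (W : Finset (Fin n)) (ω₀ : d.Matching)
    (hW : W.card + N ≤ w) (hR : R.card + N ≤ r) :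
    cavg R ω₀ (fun ω => if j ≤ T.coll ω R W then 1 else 0) ≤
      (N * (w * d.maxInDeg / (d.numEdges - r) : ℝ)) ^ j := by
  set a : ℝ := w * d.maxInDeg / (d.numEdges - r) with ha
  have hm : (0 : ℝ) < d.numEdges - r := sub_pos.2 (by exact_mod_cast hr)
  have ha0 : 0 ≤ a := by positivity
  induction T generalizing N j R W ω₀ with
  | done =>
    rcases Nat.eq_zero_or_pos j with rfl | hj
    · simp [cavg_one]
    · have : ¬ j ≤ 0 := by omega
      simp only [coll, this, if_false, cavg_const]
      positivity
  | query f next ih =>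
    obtain _ | N := N
    · exact absurd hT id
    obtain _ | j := j
    · simp [cavg_one]
    have hNa : 0 ≤ (N : ℝ) * a := by positivity
    have hle : ((N : ℝ) * a) ^ (j + 1) ≤ (((N + 1 : ℕ) : ℝ) * a) ^ (j + 1) := by
      gcongr; simp
    by_cases hf : f ∈ R
    · rw [cavg_congr (G := fun ω => if j + 1 ≤ (next (ω₀ f)).coll ω R W then 1 else 0)
        fun ω hω => by simp only [coll, if_pos hf, hω f hf]]
      exact (ih (ω₀ f) N (j + 1) (hT _) R W ω₀ (by omega) (by omega)).trans hle
    · have hRr : (R.card : ℝ) ≤ r := by exact_mod_cast (show R.card ≤ r by omega)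
      have hWw : (W.card : ℝ) ≤ w := by exact_mod_cast (show W.card ≤ w by omega)
      refine (cavg_reveal_le_add hf ω₀
        (b := fun e => (if e.1 ∈ W then (1 : ℝ) else 0) * (N * a) ^ j)
        (c := (N * a) ^ (j + 1)) (fun e => by positivity) fun e he => ?_).trans ?_
      · have hco : ∀ ω : d.Matching, (∀ g ∈ insert f R, ω g = redirect ω₀ f e g) → ω f = e :=
          fun ω hω => by rw [hω f (Finset.mem_insert_self _ _), redirect_self]
        have hcR : (insert f R).card + N ≤ r := by
          rw [Finset.card_insert_of_notMem hf]; omega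
        by_cases hW' : e.1 ∈ W
        · rw [cavg_congr (G := fun ω => if j ≤ (next e).coll ω (insert f R) (insert e.1 W)
            then 1 else 0) fun ω hω => by
              simp only [coll, if_neg hf, hco ω hω, if_pos hW']; congr 1; simp; omega]
          refine (ih e N j (hT e) _ _ _ (by rw [Finset.insert_eq_of_mem hW']; omega) hcR).trans ?_
          simp only [if_pos hW', one_mul]
          have : 0 ≤ ((N : ℝ) * a) ^ (j + 1) := by positivity
          linarith
        · rw [cavg_congr (G := fun ω => if j + 1 ≤ (next e).coll ω (insert f R) (insert e.1 W)
            then 1 else 0) fun ω hω => by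
              simp only [coll, if_neg hf, hco ω hω, if_neg hW', zero_add]]
          refine (ih e N (j + 1) (hT e) _ _ _ (by
            rw [Finset.card_insert_of_notMem hW']; omega) hcR).trans ?_
          simp [hW']
      · rw [← Finset.sum_mul]
        have h1 : (∑ e : d.Head, if e.1 ∈ W then (1 : ℝ) else 0) / (d.numEdges - R.card) ≤ a := by
          rw [ha]
          have := sum_head_mem_le (d := d) W
          gcongr
          exact this.trans (by gcongr)
        calc _ = ((∑ e : d.Head, if e.1 ∈ W then (1 : ℝ) else 0) / (d.numEdges - R.card)) *
              (N * a) ^ j + (N * a) ^ (j + 1) := by ring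
          _ ≤ a * (N * a) ^ j + (N * a) ^ (j + 1) := by gcongr
          _ = (((N + 1 : ℕ) : ℝ) * a) * (N * a) ^ j := by push_cast; ring
          _ ≤ (((N + 1 : ℕ) : ℝ) * a) * (((N + 1 : ℕ) : ℝ) * a) ^ j := by
            gcongr; simp
          _ = _ := by ring

/-- An exploration rarely has many excess edges. -/
theorem prob_excess_le (T : Explore d) {N : ℕ} (hT : T.Within N) (hN : N < d.numEdges) (Y : Finset (Fin n)) (j : ℕ) :
    prob (fun ω => (Y ∪ (T.tails ω).image fun f => (ω f).1).card + j ≤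
      Y.card + (T.tails ω).card) ≤
      (N * ((Y.card + N : ℕ) * d.maxInDeg / (d.numEdges - N) : ℝ)) ^ j := by
  have ω₀ : d.Matching := Classical.arbitrary _
  refine le_trans ?_ (cavg_coll_le hN T N j hT ∅ Y ω₀ le_rfl (by simp))
  rw [cavg_empty]
  -- Nothing is revealed at the start and exactly `Y` is visited, so the counting identity reads
  -- excess as collisions.
  refine avg_mono fun ω => ?_
  have := coll_add_card ω T ∅ Y (by simp)
  simp only [Finset.card_empty, add_zero, Finset.empty_union] at this
  beta_reduce
  split_ifs with h1 h2
  · exact le_rfl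
  · exact absurd (by omega) h2
  · exact zero_le_one
  · exact le_rfl

end Explore

/-- A rule choosing one tail at every vertex. -/
abbrev Choice (d : BiDegree n) : Type := ∀ v, Fin (d.outDeg v)

/-- The position of the walk started at `v` that follows the choices in the list. -/
def walkPos (ω : d.Matching) : Fin n → List (Choice d) → Fin n
  | v, [] => v
  | v, c :: l => walkPos ω (ω ⟨v, c v⟩).1 l

/-- The tails used by the walk started at `v` that follows the choices in the list. -/
def walkTails (ω : d.Matching) : Fin n → List (Choice d) → List d.Tail
  | _, [] => []
  | v, c :: l => ⟨v, c v⟩ :: walkTails ω (ω ⟨v, c v⟩).1 l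

/-- The exploration that walks from `v` along the choices and then continues. -/
def Explore.walk : Fin n → List (Choice d) → (Fin n → Explore d) → Explore d
  | v, [], k => k v
  | v, c :: l, k => .query ⟨v, c v⟩ fun e => Explore.walk e.1 l k

lemma Explore.within_walk {N : ℕ} (v : Fin n) (l : List (Choice d)) (k : Fin n → Explore d)
    (hk : ∀ u, (k u).Within N) : (Explore.walk v l k).Within (l.length + N) := by
  induction l generalizing v with
  | nil => simpa [Explore.walk] using hk v
  | cons c l ih =>
    rw [List.length_cons, show l.length + 1 + N = l.length + N + 1 by ring]
    exact fun e => ih e.1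

lemma Explore.tails_walk (ω : d.Matching) (v : Fin n) (l : List (Choice d))
    (k : Fin n → Explore d) : (Explore.walk v l k).tails ω =
      (walkTails ω v l).toFinset ∪ (k (walkPos ω v l)).tails ω := by
  induction l generalizing v with
  | nil => simp [Explore.walk, walkTails, walkPos]
  | cons c l ih => simp [Explore.walk, walkTails, walkPos, Explore.tails, ih]

end Explorations

end BiDegree

namespace BiDegree

/-! ### The random walk on a matching -/

section Walks

variable {n : ℕ} {d : BiDegree n}

/-- The average of a function over the choice of one tail at every vertex. -/
def choiceAvg (g : Choice d → ℝ) : ℝ := (∑ c, g c) / (Fintype.card (Choice d) : ℝ)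

/-- The average of a function of `t` independent uniform choices. -/
def avgW : ℕ → (List (Choice d) → ℝ) → ℝ
  | 0, F => F []
  | t + 1, F => choiceAvg fun c => avgW t fun l => F (c :: l)

lemma choiceAvg_mono {g h : Choice d → ℝ} (H : ∀ c, g c ≤ h c) : choiceAvg g ≤ choiceAvg h := by
  unfold choiceAvg
  gcongr with c
  exact H c

lemma choiceAvg_apply (h2 : ∀ v, 2 ≤ d.outDeg v) (v : Fin n) (g : Fin (d.outDeg v) → ℝ) :
    choiceAvg (fun c => g (c v)) = (∑ i, g i) / d.outDeg v := by
  have h1 : ∑ c : Choice d, g (c v) = (∑ i, g i) *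
      (Fintype.card (∀ u : {u // u ≠ v}, Fin (d.outDeg u)) : ℝ) := by
    rw [Fintype.sum_equiv (Equiv.piSplitAt v (fun u => Fin (d.outDeg u)))
      (fun c => g (c v)) (fun p => g p.1) fun c => rfl, Fintype.sum_prod_type]
    simp [Finset.sum_mul, mul_comm]
  have h3 : (Fintype.card (Choice d) : ℝ) = d.outDeg v *
      (Fintype.card (∀ u : {u // u ≠ v}, Fin (d.outDeg u)) : ℝ) := by
    rw [Fintype.card_congr (Equiv.piSplitAt v (fun u => Fin (d.outDeg u))), Fintype.card_prod,
      Fintype.card_fin]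
    push_cast; rfl
  have h4 : (Fintype.card (∀ u : {u // u ≠ v}, Fin (d.outDeg u)) : ℝ) ≠ 0 := by
    have : ∀ u : {u // u ≠ v}, Nonempty (Fin (d.outDeg u)) := fun u =>
      ⟨⟨0, by have := h2 u; omega⟩⟩
    exact_mod_cast Fintype.card_ne_zero
  rw [choiceAvg, h1, h3, mul_div_mul_right _ _ h4]

lemma choiceAvg_const (h2 : ∀ v, 2 ≤ d.outDeg v) (a : ℝ) :
    choiceAvg (fun _ : Choice d => a) = a := by
  have : ∀ v, Nonempty (Fin (d.outDeg v)) := fun v => ⟨⟨0, by have := h2 v; omega⟩⟩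
  have h0 : (Fintype.card (Choice d) : ℝ) ≠ 0 := by exact_mod_cast Fintype.card_ne_zero
  rw [choiceAvg, Finset.sum_const, Finset.card_univ, nsmul_eq_mul, mul_div_cancel_left₀ _ h0]

lemma choiceAvg_mul (a : ℝ) (g : Choice d → ℝ) :
    choiceAvg (fun c => a * g c) = a * choiceAvg g := by
  simp only [choiceAvg]
  rw [← Finset.mul_sum, mul_div_assoc]

lemma choiceAvg_sum {ι : Type*} (s : Finset ι) (g : ι → Choice d → ℝ) :
    choiceAvg (fun c => ∑ i ∈ s, g i c) = ∑ i ∈ s, choiceAvg (g i) := by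
  simp only [choiceAvg]
  rw [Finset.sum_comm, Finset.sum_div]

lemma avgW_mono {t : ℕ} {F G : List (Choice d) → ℝ} (h : ∀ l, l.length = t → F l ≤ G l) :
    avgW t F ≤ avgW t G := by
  induction t generalizing F G with
  | zero => exact h [] rfl
  | succ t ih => exact choiceAvg_mono fun c => ih fun l hl => h _ (by simp [hl])

lemma avgW_congr {t : ℕ} {F G : List (Choice d) → ℝ} (h : ∀ l, l.length = t → F l = G l) :
    avgW t F = avgW t G :=
  le_antisymm (avgW_mono fun l hl => (h l hl).le) (avgW_mono fun l hl => (h l hl).ge)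

lemma avgW_const (h2 : ∀ v, 2 ≤ d.outDeg v) (t : ℕ) (a : ℝ) :
    avgW t (fun _ : List (Choice d) => a) = a := by
  induction t with
  | zero => rfl
  | succ t ih => simp only [avgW, ih]; exact choiceAvg_const h2 a

lemma avgW_mul (t : ℕ) (a : ℝ) (F : List (Choice d) → ℝ) :
    avgW t (fun l => a * F l) = a * avgW t F := by
  induction t generalizing F with
  | zero => rfl
  | succ t ih => simp only [avgW, ih]; exact choiceAvg_mul a _

lemma avgW_sum {ι : Type*} (s : Finset ι) (t : ℕ) (F : ι → List (Choice d) → ℝ) :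
    avgW t (fun l => ∑ i ∈ s, F i l) = ∑ i ∈ s, avgW t (F i) := by
  induction t generalizing F with
  | zero => rfl
  | succ t ih => simp only [avgW, ih]; exact choiceAvg_sum s _

lemma avgW_add (t : ℕ) (F G : List (Choice d) → ℝ) :
    avgW t (fun l => F l + G l) = avgW t F + avgW t G := by
  simpa using avgW_sum (Finset.univ : Finset Bool) t (fun b => cond b F G)

lemma avgW_nonneg {t : ℕ} {F : List (Choice d) → ℝ} (h : ∀ l, 0 ≤ F l) : 0 ≤ avgW t F := by
  induction t generalizing F with
  | zero => exact h []
  | succ t ih =>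
    exact div_nonneg (Finset.sum_nonneg fun c _ => ih fun l => h _) (Nat.cast_nonneg _)

/-- The reason for modelling walks by choices: the lists do not depend on the matching, so a fixed
list gives an adaptive exploration and the two averages commute. -/
lemma avg_avgW (t : ℕ) (F : d.Matching → List (Choice d) → ℝ) :
    avg (fun ω => avgW t (F ω)) = avgW t (fun l => avg fun ω => F ω l) := by
  unfold avg
  simp only [div_eq_inv_mul]
  rw [avgW_mul, avgW_sum]

/-- The expectation of `g` at the position of the simple random walk after `t` steps from `v`. -/
def walkE (ω : d.Matching) : ℕ → (Fin n → ℝ) → Fin n → ℝ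
  | 0, g, v => g v
  | t + 1, g, v => (∑ c, walkE ω t g (ω ⟨v, c⟩).1) / d.outDeg v

/-- The `t`-step transition probabilities of the simple random walk. -/
def walkP (ω : d.Matching) (t : ℕ) (v x : Fin n) : ℝ :=
  walkE ω t (fun u => if u = x then 1 else 0) v

lemma walkP_zero (ω : d.Matching) (v x : Fin n) : walkP ω 0 v x = if v = x then 1 else 0 := rfl

lemma walkP_succ (ω : d.Matching) (t : ℕ) (v x : Fin n) :
    walkP ω (t + 1) v x = (∑ c, walkP ω t (ω ⟨v, c⟩).1 x) / d.outDeg v := rfl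

lemma walkE_add (ω : d.Matching) (s t : ℕ) (g : Fin n → ℝ) (v : Fin n) :
    walkE ω (s + t) g v = walkE ω s (walkE ω t g) v := by
  induction s generalizing v with
  | zero => simp [walkE]
  | succ s ih => rw [Nat.succ_add]; simp only [walkE, ih]

lemma walkE_const (h2 : ∀ v, 2 ≤ d.outDeg v) (ω : d.Matching) (t : ℕ) (a : ℝ) (v : Fin n) :
    walkE ω t (fun _ => a) v = a := by
  induction t generalizing v with
  | zero => rfl
  | succ t ih =>
    simp only [walkE, ih]
    have : (d.outDeg v : ℝ) ≠ 0 := by have := h2 v; positivity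
    simp [this]

lemma walkE_sum {ι : Type*} (s : Finset ι) (ω : d.Matching) (t : ℕ) (g : ι → Fin n → ℝ)
    (v : Fin n) : walkE ω t (fun u => ∑ i ∈ s, g i u) v = ∑ i ∈ s, walkE ω t (g i) v := by
  induction t generalizing v with
  | zero => rfl
  | succ t ih =>
    simp only [walkE, ih]
    rw [Finset.sum_comm, Finset.sum_div]

lemma walkE_mul (ω : d.Matching) (t : ℕ) (a : ℝ) (g : Fin n → ℝ) (v : Fin n) :
    walkE ω t (fun u => a * g u) v = a * walkE ω t g v := by
  induction t generalizing v with
  | zero => rfl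
  | succ t ih => simp only [walkE, ih]; rw [← Finset.mul_sum, mul_div_assoc]

lemma walkE_eq_sum (ω : d.Matching) (t : ℕ) (g : Fin n → ℝ) (v : Fin n) :
    walkE ω t g v = ∑ x, walkP ω t v x * g x := by
  have : g = fun u => ∑ x, g x * (if u = x then (1 : ℝ) else 0) := by
    ext u; simp
  conv_lhs => rw [this]
  rw [walkE_sum]
  refine Finset.sum_congr rfl fun x _ => ?_
  rw [walkE_mul, mul_comm]; rfl

lemma walkP_nonneg (ω : d.Matching) (t : ℕ) (v x : Fin n) : 0 ≤ walkP ω t v x := by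
  induction t generalizing v with
  | zero => rw [walkP_zero]; split_ifs <;> norm_num
  | succ t ih => rw [walkP_succ]; exact div_nonneg (Finset.sum_nonneg fun c _ => ih _) (Nat.cast_nonneg _)

lemma walkP_sum (h2 : ∀ v, 2 ≤ d.outDeg v) (ω : d.Matching) (t : ℕ) (v : Fin n) :
    ∑ x, walkP ω t v x = 1 := by
  have := walkE_eq_sum ω t (fun _ => 1) v
  rw [walkE_const h2] at this
  simpa using this.symm

/-- A fresh choice is drawn for every step and only its value at the current vertex is read, so
revisiting a vertex creates no dependence and the walk is the simple random walk. -/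
lemma avgW_walkPos (h2 : ∀ v, 2 ≤ d.outDeg v) (ω : d.Matching) (t : ℕ) (g : Fin n → ℝ)
    (v : Fin n) : avgW t (fun l => g (walkPos ω v l)) = walkE ω t g v := by
  induction t generalizing v with
  | zero => rfl
  | succ t ih =>
    simp only [avgW, walkPos, ih, walkE]
    exact choiceAvg_apply h2 v fun c => walkE ω t g (ω ⟨v, c⟩).1

lemma sum_walkP_mul (h2 : ∀ v, 2 ≤ d.outDeg v) (ω : d.Matching) (t : ℕ) (v v' : Fin n) :
    ∑ x, walkP ω t v x * walkP ω t v' x = avgW t fun l => avgW t fun l' =>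
      if walkPos ω v l = walkPos ω v' l' then 1 else 0 := by
  rw [← walkE_eq_sum, ← avgW_walkPos h2]
  refine avgW_congr fun l _ => ?_
  rw [walkP, ← avgW_walkPos h2]
  refine avgW_congr fun l' _ => ?_
  simp only [eq_comm]

/-- A prescribed tail is chosen with probability at most one half at every step. This bounds the
chance that two walks coincide, a case that produces no excess. -/
lemma avgW_walkTails_eq_le (h2 : ∀ v, 2 ≤ d.outDeg v) (ω : d.Matching) (t : ℕ) (v : Fin n)
    (L : List d.Tail) : avgW t (fun l => if walkTails ω v l = L then 1 else 0) ≤ (1 / 2 : ℝ) ^ t := by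
  induction t generalizing v L with
  | zero => simp only [avgW]; split_ifs <;> norm_num
  | succ t ih =>
    simp only [avgW, walkTails]
    rcases L with _ | ⟨g, L⟩
    · simp only [reduceCtorEq, if_false, avgW_const h2, choiceAvg_const h2]
      positivity
    refine (choiceAvg_mono (h := fun c => (fun i : Fin (d.outDeg v) =>
      if (⟨v, i⟩ : d.Tail) = g then (1 / 2 : ℝ) ^ t else 0) (c v)) fun c => ?_).trans ?_
    · beta_reduce
      split_ifs with h
      · refine le_trans (avgW_mono fun l _ => ?_) (ih (ω ⟨v, c v⟩).1 L)
        simp [h]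
      · simp [h, avgW_const h2]
    · rw [choiceAvg_apply h2 v fun i => if (⟨v, i⟩ : d.Tail) = g then (1 / 2 : ℝ) ^ t else 0]
      have h0 : (2 : ℝ) ≤ d.outDeg v := by exact_mod_cast h2 v
      have h1 : ∑ i : Fin (d.outDeg v), (if (⟨v, i⟩ : d.Tail) = g then (1 / 2 : ℝ) ^ t else 0) ≤
          (1 / 2 : ℝ) ^ t := by
        by_cases hg : v = g.1
        · subst hg
          have : ∀ i : Fin (d.outDeg g.1), (⟨g.1, i⟩ : d.Tail) = g ↔ i = g.2 := by
            intro i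
            constructor
            · intro h; rw [Sigma.ext_iff] at h; exact eq_of_heq h.2
            · rintro rfl; rfl
          simp [this]
        · have : ∀ i : Fin (d.outDeg v), (⟨v, i⟩ : d.Tail) ≠ g := by
            rintro i rfl; exact hg rfl
          simp [this]
      rw [pow_succ]
      calc _ ≤ (1 / 2 : ℝ) ^ t / 2 := by gcongr
        _ = _ := by ring

end Walks

/-! ### Collisions of two walks that meet -/

section Meetings

variable {n : ℕ} {d : BiDegree n}

/-- The sequence of tails used by the walk that leaves through `f` and then follows `l`. -/
def pathFn (ω : d.Matching) : d.Tail → List (Choice d) → ℕ → d.Tail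
  | f, _, 0 => f
  | f, [], _ + 1 => f
  | f, c :: l, i + 1 => pathFn ω ⟨(ω f).1, c (ω f).1⟩ l i

@[simp] lemma pathFn_zero (ω : d.Matching) (f : d.Tail) (l : List (Choice d)) :
    pathFn ω f l 0 = f := by cases l <;> rfl

lemma pathFn_succ_fst (ω : d.Matching) (f : d.Tail) (l : List (Choice d)) {i : ℕ}
    (hi : i < l.length) : (pathFn ω f l (i + 1)).1 = (ω (pathFn ω f l i)).1 := by
  induction l generalizing f i with
  | nil => simp at hi
  | cons c l ih =>
    cases i with
    | zero => simp [pathFn]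
    | succ i => exact ih _ (by simpa using hi)

lemma pathFn_length (ω : d.Matching) (f : d.Tail) (l : List (Choice d)) :
    (ω (pathFn ω f l l.length)).1 = walkPos ω (ω f).1 l := by
  induction l generalizing f with
  | nil => rfl
  | cons c l ih => exact ih _

lemma mem_walkTails_iff (ω : d.Matching) (f g : d.Tail) (l : List (Choice d)) :
    g ∈ walkTails ω (ω f).1 l ↔ ∃ i < l.length, pathFn ω f l (i + 1) = g := by
  induction l generalizing f with
  | nil => simp [walkTails]
  | cons c l ih =>
    simp only [walkTails, List.mem_cons, List.length_cons, pathFn]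
    constructor
    · rintro (rfl | h)
      · exact ⟨0, by omega, by simp⟩
      · obtain ⟨i, hi, rfl⟩ := (ih ⟨(ω f).1, c (ω f).1⟩).1 h
        exact ⟨i + 1, by omega, rfl⟩
    · rintro ⟨i, hi, rfl⟩
      cases i with
      | zero => left; simp
      | succ i => right; exact (ih ⟨(ω f).1, c (ω f).1⟩).2 ⟨i, by omega, rfl⟩

lemma walkTails_ext (ω : d.Matching) (f f' : d.Tail) (l l' : List (Choice d))
    (hl : l.length = l'.length) (h : ∀ i ≤ l.length, pathFn ω f l i = pathFn ω f' l' i) :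
    walkTails ω (ω f).1 l = walkTails ω (ω f').1 l' := by
  induction l generalizing f f' l' with
  | nil =>
    rw [List.eq_nil_of_length_eq_zero hl.symm]; rfl
  | cons c l ih =>
    obtain _ | ⟨c', l'⟩ := l'
    · simp at hl
    have h1 := h 1 (by simp)
    simp only [pathFn, pathFn_zero] at h1
    simp only [walkTails, List.cons.injEq]
    refine ⟨h1, ih ⟨(ω f).1, c (ω f).1⟩ ⟨(ω f').1, c' (ω f').1⟩ l' (by simpa using hl)
      fun i hi => ?_⟩
    exact h (i + 1) (by simpa using hi)

/-- Two walks ending in a common sink, along which only one vertex has two tails in use: this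
vertex is visited only at one time, and equal tails are used at equal times. -/
lemma sync_of_sink (ω : d.Matching) (p : Bool → ℕ → d.Tail) (L j₀ : ℕ) (z w : Fin n)
    (hj : j₀ ≤ L)
    (hstep : ∀ b, ∀ i < L, (p b (i + 1)).1 = (ω (p b i)).1)
    (hend : ∀ b, (ω (p b L)).1 = w)
    (hsink : ∀ b, ∀ i ≤ L, (p b i).1 ≠ w)
    (huniq : ∀ b b', ∀ i ≤ L, ∀ i' ≤ L, (p b i).1 = (p b' i').1 → (p b i).1 ≠ z →
      p b i = p b' i')
    (hz : ∀ b, ∀ i ≤ L, (p b i).1 = z → ∃ b', p b i = p b' j₀) :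
    (∀ b, ∀ i ≤ L, (p b i).1 = z → i = j₀) ∧
      ∀ b b', ∀ i ≤ L, ∀ i' ≤ L, p b i = p b' i' → i = i' := by
  -- Induction on the time left: equal tails lead to equal vertices and, away from `z`, to equal
  -- next tails. Since `w` is never a source, both walks must reach it at time `L`, so the two times
  -- agree. At `z` the next tails may differ, hence the extra assumption on later visits.
  have sync : ∀ b b' (r i i' : ℕ), L - i = r → i ≤ L → i' ≤ L → p b i = p b' i' →
      (∀ k k', i < k → k ≤ L → k' ≤ L → (p b k).1 = z → (p b' k').1 = z → k = k') → i = i' := by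
    intro b b' r
    induction r with
    | zero =>
      intro i i' hr hi hi' he _
      obtain rfl : i = L := by omega
      by_contra hne
      have hlt : i' < i := by omega
      refine hsink b' (i' + 1) hlt ?_
      rw [hstep b' i' hlt, ← he, hend]
    | succ r ih =>
      intro i i' hr hi hi' he H
      have hiL : i < L := by omega
      have hiL' : i' < L := by
        by_contra hne
        obtain rfl : i' = L := by omega
        refine hsink b (i + 1) hiL ?_
        rw [hstep b i hiL, he, hend]
      have hsrc : (p b (i + 1)).1 = (p b' (i' + 1)).1 := by
        rw [hstep b i hiL, hstep b' i' hiL', he]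
      by_cases hzz : (p b (i + 1)).1 = z
      · have := H (i + 1) (i' + 1) (by omega) hiL hiL' hzz (hsrc ▸ hzz)
        omega
      · have := ih (i + 1) (i' + 1) (by omega) hiL hiL' (huniq b b' _ hiL _ hiL' hsrc hzz)
          fun k k' hk => H k k' (by omega)
        omega
  -- At the last visit of `z` the extra assumption of `sync` is vacuous, so that visit takes place
  -- at time `j₀`.
  have hlast : ∀ b, ∀ i ≤ L, (p b i).1 = z → i ≤ j₀ := by
    intro b
    by_contra! hcon
    obtain ⟨i₁, hi₁, hz₁, hlt₁⟩ := hcon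
    let Q : ℕ → Prop := fun i => i ≤ L ∧ (p b i).1 = z
    have hQ : Q (Nat.findGreatest Q L) := Nat.findGreatest_spec (P := Q) hi₁ ⟨hi₁, hz₁⟩
    obtain ⟨b', hb'⟩ := hz b _ hQ.1 hQ.2
    have h1 := sync b b' _ _ _ rfl hQ.1 hj hb' fun k k' hk hkL _ hkz _ =>
      absurd (Nat.le_findGreatest (P := Q) hkL ⟨hkL, hkz⟩) (by omega)
    have h2 : i₁ ≤ Nat.findGreatest Q L := Nat.le_findGreatest (P := Q) hi₁ ⟨hi₁, hz₁⟩
    omega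
  -- The tail used at any visit is also used at time `j₀` by some walk `b'`, which has no later
  -- visit; synchronising from `b'` gives the equality.
  have hvis : ∀ b, ∀ i ≤ L, (p b i).1 = z → i = j₀ := by
    intro b i hi hiz
    obtain ⟨b', hb'⟩ := hz b i hi hiz
    refine (sync b' b _ _ _ rfl hj hi hb'.symm fun k k' hk hkL _ hkz _ => ?_).symm
    have := hlast b' k hkL hkz
    omega
  exact ⟨hvis, fun b b' i hi i' hi' he => sync b b' _ _ _ rfl hi hi' he
    fun k k' _ hk hk' hkz hkz' => (hvis b k hk hkz).trans (hvis b' k' hk' hkz').symm⟩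

end Meetings

end BiDegree

/-! ### Excess of two meeting walks and comparison of meeting probabilities -/

namespace BiDegree

section Meetings

variable {n : ℕ} {d : BiDegree n}

/-- The tails used by the walk that leaves through `f` and then follows `l`. -/
def pathTails (ω : d.Matching) (f : d.Tail) (l : List (Choice d)) : Finset d.Tail :=
  insert f (walkTails ω (ω f).1 l).toFinset

lemma mem_pathTails (ω : d.Matching) (f g : d.Tail) (l : List (Choice d)) :
    g ∈ pathTails ω f l ↔ ∃ i ≤ l.length, pathFn ω f l i = g := by
  rw [pathTails, Finset.mem_insert, List.mem_toFinset, mem_walkTails_iff]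
  constructor
  · rintro (rfl | ⟨i, hi, rfl⟩)
    · exact ⟨0, by omega, by simp⟩
    · exact ⟨i + 1, hi, rfl⟩
  · rintro ⟨i, hi, rfl⟩
    cases i with
    | zero => left; simp
    | succ i => exact Or.inr ⟨i, hi, rfl⟩

/-- If two different walks end at the same vertex and one of them returns to a tail in `D`, then
the edges they use have excess at least two relative to the sources of the tails in `D`. -/
theorem excess_of_meet (ω : d.Matching) {f f' : d.Tail} {l l' : List (Choice d)}
    (hl : l.length = l'.length) (D : Finset d.Tail) (hf : f ∈ D) (hf' : f' ∈ D)
    (hmeet : walkPos ω (ω f).1 l = walkPos ω (ω f').1 l')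
    (hbad : ∃ g ∈ D, g ∈ walkTails ω (ω f).1 l ∨ g ∈ walkTails ω (ω f').1 l')
    (hne : f = f' → walkTails ω (ω f).1 l ≠ walkTails ω (ω f').1 l') :
    (D.image Sigma.fst ∪ (pathTails ω f l ∪ pathTails ω f' l').image fun g => (ω g).1).card + 2 ≤
      (D.image Sigma.fst).card + (pathTails ω f l ∪ pathTails ω f' l').card := by
  classical
  set Y := D.image Sigma.fst with hY
  set E := pathTails ω f l ∪ pathTails ω f' l' with hE
  set t := l.length with ht
  set w := walkPos ω (ω f).1 l with hw
  let p : Bool → ℕ → d.Tail := fun b => cond b (pathFn ω f l) (pathFn ω f' l')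
  have hmemE : ∀ g, g ∈ E ↔ ∃ b, ∃ i ≤ t, p b i = g := by
    intro g
    rw [hE, Finset.mem_union, mem_pathTails, mem_pathTails, ← hl]
    simp [p, ← ht, or_comm]
  have hpE : ∀ b, ∀ i ≤ t, p b i ∈ E := fun b i hi => (hmemE _).2 ⟨b, i, hi, rfl⟩
  have hstep : ∀ b, ∀ i < t, (p b (i + 1)).1 = (ω (p b i)).1 := by
    rintro (_ | _) i hi
    · exact pathFn_succ_fst ω f' l' (by omega)
    · exact pathFn_succ_fst ω f l hi
  have hend : ∀ b, (ω (p b t)).1 = w := by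
    rintro (_ | _)
    · rw [hmeet, ← pathFn_length ω f' l', ← hl]; rfl
    · rw [hw, ← pathFn_length ω f l]; rfl
  have hp0 : p true 0 = f := by simp [p]
  have hp0' : p false 0 = f' := by simp [p]
  have hp0D : ∀ b, p b 0 ∈ D := by
    rintro (_ | _)
    · rwa [hp0']
    · rwa [hp0]
  have hbad' : ∃ b, ∃ i < t, p b (i + 1) ∈ D := by
    obtain ⟨g, hg, h | h⟩ := hbad
    · obtain ⟨i, hi, rfl⟩ := (mem_walkTails_iff ω f g l).1 h
      exact ⟨true, i, hi, hg⟩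
    · obtain ⟨i, hi, rfl⟩ := (mem_walkTails_iff ω f' g l').1 h
      exact ⟨false, i, by omega, hg⟩
  have hdiff : f = f' → ∃ j, j ≤ t ∧ p true j ≠ p false j := by
    intro h
    by_contra! hcon
    exact hne h (walkTails_ext ω f f' l l' hl fun i hi => hcon i hi)
  have hDY : ∀ g ∈ D, g.1 ∈ Y := fun g hg => Finset.mem_image_of_mem _ hg
  -- Assume excess at most one. `EY` and `EN` are the used tails with source inside and outside `Y`.
  -- Every new vertex other than the common endpoint `w` is a source of a tail in `EN`, so only very
  -- few tails can share a source, which makes the walks nearly deterministic.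
  by_contra hlt
  set W := Y ∪ E.image fun g => (ω g).1 with hW
  set EY := E.filter (fun g => g.1 ∈ Y) with hEY
  set EN := E.filter (fun g => g.1 ∉ Y) with hEN
  have hcE : EY.card + EN.card = E.card := Finset.card_filter_add_card_filter_not _
  have hcW : W.card = Y.card + (W \ Y).card := by
    have hYW : Y ⊆ W := Finset.subset_union_left
    have := Finset.card_le_card hYW
    rw [Finset.card_sdiff_of_subset hYW]
    omega
  have hmemEY : ∀ g, g ∈ EY ↔ g ∈ E ∧ g.1 ∈ Y := fun g => Finset.mem_filter
  have hmemEN : ∀ g, g ∈ EN ↔ g ∈ E ∧ g.1 ∉ Y := fun g => Finset.mem_filter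
  set im := EN.image Sigma.fst with him
  have himsub : im ⊆ W \ Y := by
    intro v hv
    obtain ⟨g, hg, rfl⟩ := Finset.mem_image.1 hv
    obtain ⟨hgE, hgY⟩ := (hmemEN g).1 hg
    refine Finset.mem_sdiff.2 ⟨Finset.mem_union_right _ ?_, hgY⟩
    obtain ⟨b, i, hi, rfl⟩ := (hmemE g).1 hgE
    cases i with
    | zero => exact absurd (hDY _ (hp0D b)) hgY
    | succ i =>
      rw [hstep b i hi]
      exact Finset.mem_image_of_mem (fun g => (ω g).1) (hpE b i (by omega))
  have hWsub : W \ Y ⊆ insert w im := by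
    intro v hv
    obtain ⟨hvW, hvY⟩ := Finset.mem_sdiff.1 hv
    obtain ⟨g, hg, rfl⟩ := Finset.mem_image.1 ((Finset.mem_union.1 hvW).resolve_left hvY)
    obtain ⟨b, i, hi, rfl⟩ := (hmemE g).1 hg
    rcases hi.lt_or_eq with hi | rfl
    · refine Finset.mem_insert_of_mem (Finset.mem_image.2 ⟨p b (i + 1), ?_, hstep b i hi⟩)
      exact (hmemEN _).2 ⟨hpE b _ hi, by rw [hstep b i hi]; exact hvY⟩
    · rw [hend b]; exact Finset.mem_insert_self _ _
  have hfEY : f ∈ EY := (hmemEY f).2 ⟨(hmemE f).2 ⟨true, 0, by omega, hp0⟩, hDY f hf⟩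
  have hfEY' : f' ∈ EY := (hmemEY f').2 ⟨(hmemE f').2 ⟨false, 0, by omega, hp0'⟩, hDY f' hf'⟩
  have himEN : im.card ≤ EN.card := Finset.card_image_le
  have hEYpos : 1 ≤ EY.card := Finset.card_pos.2 ⟨f, hfEY⟩
  have hbound : EY.card + EN.card ≤ (W \ Y).card + 1 := by omega
  have hinj : EN.card ≤ im.card → ∀ g ∈ EN, ∀ g' ∈ EN, g.1 = g'.1 → g = g' := by
    intro h g hg g' hg' he
    exact Finset.card_image_iff.1 (le_antisymm himEN h) hg hg' he
  -- If no new vertex is a dead end, the count leaves a single tail with source in `Y` and one tail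
  -- per other source. Then both walks start with the same tail and never separate.
  by_cases hcase : W \ Y ⊆ im
  · have hc := Finset.card_le_card hcase
    obtain ⟨a, ha⟩ := Finset.card_eq_one.1 (show EY.card = 1 by omega)
    have hall : ∀ g ∈ EY, g = f := by
      rw [ha] at hfEY ⊢
      intro g hg
      rw [Finset.mem_singleton.1 hg, Finset.mem_singleton.1 hfEY]
    have hff := hall f' hfEY'
    obtain ⟨j, hj, hjne⟩ := hdiff hff.symm
    have : ∀ i ≤ t, p true i = p false i := by
      intro i
      induction i with
      | zero => intro _; rw [hp0, hp0', hff]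
      | succ i ih =>
        intro hi
        have hs : (p true (i + 1)).1 = (p false (i + 1)).1 := by
          rw [hstep _ i hi, hstep _ i hi, ih (by omega)]
        by_cases hm : (p true (i + 1)).1 ∈ Y
        · rw [hall _ ((hmemEY _).2 ⟨hpE _ _ hi, hm⟩),
            hall _ ((hmemEY _).2 ⟨hpE _ _ hi, hs ▸ hm⟩)]
        · exact hinj (by omega) _ ((hmemEN _).2 ⟨hpE _ _ hi, hm⟩) _
            ((hmemEN _).2 ⟨hpE _ _ hi, hs ▸ hm⟩) hs
    exact hjne (this j hj)
  -- Otherwise `w` is a new vertex that is never left. There is exactly one spare tail, and its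
  -- position distinguishes the remaining cases, all settled by `sync_of_sink`.
  · have hwim : w ∉ im := by
      intro h
      rw [Finset.insert_eq_of_mem h] at hWsub
      exact hcase hWsub
    have hwY : w ∉ Y := by
      intro h
      refine hcase fun v hv => (Finset.mem_insert.1 (hWsub hv)).resolve_left ?_
      rintro rfl
      exact (Finset.mem_sdiff.1 hv).2 h
    have hsink : ∀ b, ∀ i ≤ t, (p b i).1 ≠ w := by
      intro b i hi h
      refine hwim (Finset.mem_image.2 ⟨p b i, (hmemEN _).2 ⟨hpE b i hi, ?_⟩, h⟩)
      rwa [h]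
    have hWc : (W \ Y).card ≤ im.card + 1 :=
      (Finset.card_le_card hWsub).trans (Finset.card_insert_le _ _)
    obtain ⟨b₁, i₁, hi₁, hD₁⟩ := hbad'
    have hEY₁ : p b₁ (i₁ + 1) ∈ EY := (hmemEY _).2 ⟨hpE _ _ hi₁, hDY _ hD₁⟩
    by_cases hff : f = f'
    · have hex := hdiff hff
      obtain ⟨hj, hjne⟩ := Nat.find_spec hex
      set j₀ := Nat.find hex with hj₀
      have hj0 : j₀ ≠ 0 := by
        intro h
        rw [h, hp0, hp0'] at hjne
        exact hjne hff
      obtain ⟨j, hjj⟩ := Nat.exists_eq_succ_of_ne_zero hj0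
      have heq : p true j = p false j := by
        by_contra h
        have := Nat.find_min hex (m := j) (by omega)
        exact this ⟨by omega, h⟩
      have hsrc : (p true j₀).1 = (p false j₀).1 := by
        rw [hjj, Nat.succ_eq_add_one, hstep _ j (by omega), hstep _ j (by omega), heq]
      have hb' : ∀ g, g = p true j₀ ∨ g = p false j₀ → ∃ b', g = p b' j₀ := by
        rintro g (h | h)
        exacts [⟨_, h⟩, ⟨_, h⟩]
      -- The walks share their first tail and separate at time `j₀`, where the spare tail sits. If
      -- the separation vertex is in `Y`, then `f` is one of the two tails used there, which forces
      -- `j₀ = 0`. If not, `f` is the only tail with source in `Y`, so the return to `D` repeats `f`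
      -- at a positive time.
      by_cases hzY : (p true j₀).1 ∈ Y
      · have hA : p true j₀ ∈ EY := (hmemEY _).2 ⟨hpE _ _ hj, hzY⟩
        have hB : p false j₀ ∈ EY := (hmemEY _).2 ⟨hpE _ _ hj, hsrc ▸ hzY⟩
        have hsub : ({p true j₀, p false j₀} : Finset d.Tail) ⊆ EY := by
          simp [Finset.insert_subset_iff, hA, hB]
        have hc2 : ({p true j₀, p false j₀} : Finset d.Tail).card = 2 := Finset.card_pair hjne
        have hc3 := Finset.card_le_card hsub
        have hEYeq := Finset.eq_of_subset_of_card_le hsub (by omega)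
        have hall : ∀ g ∈ EY, g = p true j₀ ∨ g = p false j₀ := by
          intro g hg
          simpa [← hEYeq] using hg
        have hS := sync_of_sink ω p t j₀ (p true j₀).1 w hj hstep hend hsink
          (fun b b' i hi i' hi' he hnz => ?_) (fun b i hi hiz => ?_)
        · obtain ⟨b', hb''⟩ := hb' _ (hall f hfEY)
          have := hS.2 true b' 0 (by omega) j₀ hj (hp0.trans hb'')
          omega
        · by_cases hm : (p b i).1 ∈ Y
          · exfalso
            rcases hall _ ((hmemEY _).2 ⟨hpE _ _ hi, hm⟩) with h | h
            · exact hnz (by rw [h])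
            · exact hnz (by rw [h, hsrc])
          · exact hinj (by omega) _ ((hmemEN _).2 ⟨hpE _ _ hi, hm⟩) _
              ((hmemEN _).2 ⟨hpE _ _ hi', he ▸ hm⟩) he
        · exact hb' _ (hall _ ((hmemEY _).2 ⟨hpE _ _ hi, hiz ▸ hzY⟩))
      · have hA : p true j₀ ∈ EN := (hmemEN _).2 ⟨hpE _ _ hj, hzY⟩
        have hB : p false j₀ ∈ EN := (hmemEN _).2 ⟨hpE _ _ hj, hsrc ▸ hzY⟩
        have himsub' : im ⊆ (EN.erase (p false j₀)).image Sigma.fst := by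
          intro v hv
          obtain ⟨g, hg, rfl⟩ := Finset.mem_image.1 hv
          by_cases hgB : g = p false j₀
          · exact Finset.mem_image.2 ⟨p true j₀, Finset.mem_erase.2 ⟨hjne, hA⟩, by rw [hgB, hsrc]⟩
          · exact Finset.mem_image_of_mem _ (Finset.mem_erase.2 ⟨hgB, hg⟩)
        have hce := Finset.card_erase_of_mem hB
        have hENpos : 1 ≤ EN.card := Finset.card_pos.2 ⟨_, hB⟩
        have hci := Finset.card_le_card himsub'
        have hci2 : ((EN.erase (p false j₀)).image Sigma.fst).card ≤
          (EN.erase (p false j₀)).card := Finset.card_image_le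
        have hinj' : ∀ g ∈ EN.erase (p false j₀), ∀ g' ∈ EN.erase (p false j₀),
            g.1 = g'.1 → g = g' := by
          intro g hg g' hg' he
          exact Finset.card_image_iff.1 (le_antisymm hci2 (by omega)) hg hg' he
        obtain ⟨a, ha⟩ := Finset.card_eq_one.1 (show EY.card = 1 by omega)
        have hall : ∀ g ∈ EY, g = f := by
          rw [ha] at hfEY ⊢
          intro g hg
          rw [Finset.mem_singleton.1 hg, Finset.mem_singleton.1 hfEY]
        have hS := sync_of_sink ω p t j₀ (p true j₀).1 w hj hstep hend hsink
          (fun b b' i hi i' hi' he hnz => ?_) (fun b i hi hiz => ?_)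
        · have := hS.2 b₁ true (i₁ + 1) hi₁ 0 (by omega) ((hall _ hEY₁).trans hp0.symm)
          omega
        · by_cases hm : (p b i).1 ∈ Y
          · rw [hall _ ((hmemEY _).2 ⟨hpE _ _ hi, hm⟩),
              hall _ ((hmemEY _).2 ⟨hpE _ _ hi', he ▸ hm⟩)]
          · refine hinj' _ (Finset.mem_erase.2 ⟨fun h => hnz (by rw [h, hsrc]),
              (hmemEN _).2 ⟨hpE _ _ hi, hm⟩⟩) _ (Finset.mem_erase.2
              ⟨fun h => hnz (by rw [he, h, hsrc]), (hmemEN _).2 ⟨hpE _ _ hi', he ▸ hm⟩⟩) he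
        · by_cases hgB : p b i = p false j₀
          · exact ⟨false, hgB⟩
          · exact ⟨true, hinj' _ (Finset.mem_erase.2 ⟨hgB,
              (hmemEN _).2 ⟨hpE _ _ hi, hiz ▸ hzY⟩⟩) _ (Finset.mem_erase.2 ⟨hjne, hA⟩) hiz⟩
    -- The two starting tails are the only ones with source in `Y`, so the return to `D` repeats one
    -- of them at a positive time, against synchronisation.
    · have hsub : ({f, f'} : Finset d.Tail) ⊆ EY := by
        simp [Finset.insert_subset_iff, hfEY, hfEY']
      have hc2 : ({f, f'} : Finset d.Tail).card = 2 := Finset.card_pair hff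
      have hc3 := Finset.card_le_card hsub
      have hEYeq := Finset.eq_of_subset_of_card_le hsub (by omega)
      have hall : ∀ g ∈ EY, g = f ∨ g = f' := by
        intro g hg
        simpa [← hEYeq] using hg
      have hb' : ∀ g ∈ EY, ∃ b', g = p b' 0 := by
        intro g hg
        rcases hall g hg with h | h
        exacts [⟨true, h.trans hp0.symm⟩, ⟨false, h.trans hp0'.symm⟩]
      have hS := sync_of_sink ω p t 0 f.1 w (by omega) hstep hend hsink
        (fun b b' i hi i' hi' he hnz => ?_) (fun b i hi hiz => ?_)
      · obtain ⟨b', hb''⟩ := hb' _ hEY₁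
        have := hS.2 b₁ b' (i₁ + 1) hi₁ 0 (by omega) hb''
        omega
      · by_cases hm : (p b i).1 ∈ Y
        · have h1 := (hall _ ((hmemEY _).2 ⟨hpE _ _ hi, hm⟩)).resolve_left
            fun h => hnz (by rw [h])
          have h2 := (hall _ ((hmemEY _).2 ⟨hpE _ _ hi', he ▸ hm⟩)).resolve_left
            fun h => hnz (by rw [he, h])
          rw [h1, h2]
        · exact hinj (by omega) _ ((hmemEN _).2 ⟨hpE _ _ hi, hm⟩) _
            ((hmemEN _).2 ⟨hpE _ _ hi', he ▸ hm⟩) he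
      · exact hb' _ ((hmemEY _).2 ⟨hpE _ _ hi, hiz ▸ hDY f hf⟩)

/-- The bound on the expected number of collisions of an exploration with `N` queries and `y` initial
vertices. -/
def collRate (d : BiDegree n) (y N : ℕ) : ℝ :=
  N * ((y + N : ℕ) * d.maxInDeg / (d.numEdges - N) : ℝ)

/-- The average probability that two walks leaving through `f` and `f'` meet after `t` further
steps. -/
def meetAvg (t : ℕ) (f f' : d.Tail) : ℝ :=
  avg fun ω => ∑ x, walkP ω t (ω f).1 x * walkP ω t (ω f').1 x

lemma walkPos_comp_of_fixed (ω : d.Matching) (τ : Equiv.Perm d.Tail) (v : Fin n)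
    (l : List (Choice d)) (h : ∀ g ∈ walkTails ω v l, τ g = g) :
    walkPos (τ.trans ω) v l = walkPos ω v l := by
  induction l generalizing v with
  | nil => rfl
  | cons c l ih =>
    simp only [walkTails, List.mem_cons, forall_eq_or_imp] at h
    simp only [walkPos, Equiv.trans_apply, h.1]
    exact ih _ h.2

/-- By invariance under `τ`, the right-hand meeting probability is that of walks from the same heads
run in `τ.trans ω`. These agree with the walks in `ω` unless a tail of `D` is used; then meeting
walks are either identical, at cost `2^(-t)`, or have excess at least two, at cost `collRate ^ 2`.
-/
lemma meetAvg_le (h2 : ∀ v, 2 ≤ d.outDeg v) {t N : ℕ} (hN : 2 * t + 2 ≤ N)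
    (hNm : N < d.numEdges) (τ : Equiv.Perm d.Tail) (D : Finset d.Tail) (hD : D.card ≤ 4)
    (hτ : ∀ g, g ∉ D → τ g = g) {f f' : d.Tail} (hf : τ f ∈ D) (hf' : τ f' ∈ D) :
    meetAvg t (τ f) (τ f') ≤
      meetAvg t f f' + (if τ f = τ f' then (1 / 2) ^ t else 0) + collRate d 4 N ^ 2 := by
  classical
  have hmN : (0 : ℝ) < d.numEdges - N := sub_pos.2 (by exact_mod_cast hNm)
  have hperm : meetAvg t f f' = avg fun ω : d.Matching => ∑ x,
      walkP (τ.trans ω) t (ω (τ f)).1 x * walkP (τ.trans ω) t (ω (τ f')).1 x := by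
    rw [meetAvg, ← avg_comp_tail τ]; rfl
  let ex : d.Matching → List (Choice d) → List (Choice d) → ℝ := fun ω l l' =>
    if (D.image Sigma.fst ∪ (pathTails ω (τ f) l ∪ pathTails ω (τ f') l').image
        fun g => (ω g).1).card + 2 ≤
      (D.image Sigma.fst).card + (pathTails ω (τ f) l ∪ pathTails ω (τ f') l').card then 1 else 0
  have hpt : ∀ ω : d.Matching, ∑ x, walkP ω t (ω (τ f)).1 x * walkP ω t (ω (τ f')).1 x ≤
      (∑ x, walkP (τ.trans ω) t (ω (τ f)).1 x * walkP (τ.trans ω) t (ω (τ f')).1 x) +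
      (if τ f = τ f' then (1 / 2) ^ t else 0) + avgW t fun l => avgW t fun l' => ex ω l l' := by
    intro ω
    rw [sum_walkP_mul h2, sum_walkP_mul h2]
    refine (avgW_mono (G := fun l => avgW t fun l' =>
      ((if walkPos (τ.trans ω) (ω (τ f)).1 l = walkPos (τ.trans ω) (ω (τ f')).1 l' then (1 : ℝ)
        else 0) + if τ f = τ f' then
          (if walkTails ω (ω (τ f')).1 l' = walkTails ω (ω (τ f)).1 l then (1 : ℝ) else 0) else 0) +
        ex ω l l') fun l hl => avgW_mono fun l' hl' => ?_).trans ?_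
    · by_cases hm : walkPos ω (ω (τ f)).1 l = walkPos ω (ω (τ f')).1 l'
      · rw [if_pos hm]
        by_cases hbad : ∃ g ∈ D, g ∈ walkTails ω (ω (τ f)).1 l ∨ g ∈ walkTails ω (ω (τ f')).1 l'
        · by_cases hsame : τ f = τ f' ∧ walkTails ω (ω (τ f)).1 l = walkTails ω (ω (τ f')).1 l'
          · rw [if_pos hsame.1, if_pos hsame.2.symm]
            have : 0 ≤ ex ω l l' := by simp only [ex]; split_ifs <;> norm_num
            split_ifs <;> linarith
          · have : ex ω l l' = 1 := if_pos (excess_of_meet ω (hl.trans hl'.symm) D hf hf' hm hbad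
              fun h h' => hsame ⟨h, h'⟩)
            rw [this]
            split_ifs <;> norm_num
        · push Not at hbad
          rw [if_pos]
          · have : 0 ≤ ex ω l l' := by simp only [ex]; split_ifs <;> norm_num
            split_ifs <;> linarith
          · rw [walkPos_comp_of_fixed, walkPos_comp_of_fixed, hm]
            · exact fun g hg => hτ g fun hgD => (hbad g hgD).2 hg
            · exact fun g hg => hτ g fun hgD => (hbad g hgD).1 hg
      · rw [if_neg hm]
        have : 0 ≤ ex ω l l' := by simp only [ex]; split_ifs <;> norm_num
        split_ifs <;> linarith
    · simp only [avgW_add]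
      gcongr
      split_ifs with h
      · refine (avgW_mono fun l _ => avgW_walkTails_eq_le h2 ω t _ _).trans_eq (avgW_const h2 _ _)
      · simp [avgW_const h2]
  rw [hperm]
  refine (avg_mono hpt).trans ?_
  rw [avg_add, avg_add, avg_const]
  gcongr
  rw [avg_avgW]
  simp only [avg_avgW]
  refine (avgW_mono fun l hl => avgW_mono fun l' hl' => ?_).trans_eq
    ((congrArg _ (funext fun l => avgW_const h2 t _)).trans (avgW_const h2 t _))
  -- For fixed choices the two paths form one exploration with `2 t + 2` queries, so the excess
  -- bound applies with the at most four sources of `D`.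
  let T : Explore d := .query (τ f) fun e => .walk e.1 l fun _ =>
    .query (τ f') fun e' => .walk e'.1 l' fun _ => .done
  have hT : T.Within N := by
    refine Explore.Within.mono (N := (l.length + ((l'.length + 0) + 1)) + 1) ?_ (by omega)
    intro e
    refine Explore.within_walk _ _ _ fun u => ?_
    intro e'
    exact Explore.within_walk (N := 0) _ _ _ fun u => by simp [Explore.Within]
  have hTt : ∀ ω, T.tails ω = pathTails ω (τ f) l ∪ pathTails ω (τ f') l' := by
    intro ω
    simp only [T, Explore.tails, Explore.tails_walk, pathTails, Finset.union_empty,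
      Finset.insert_union]
  have hY : (D.image Sigma.fst).card ≤ 4 := Finset.card_image_le.trans hD
  have key := Explore.prob_excess_le T hT hNm (D.image Sigma.fst) 2
  simp only [hTt] at key
  refine le_trans (le_of_eq ?_) (key.trans ?_)
  · unfold prob
    congr 1
    ext ω
    simp only [ex]
    congr
  · unfold collRate
    gcongr

end Meetings

end BiDegree

namespace BiDegree

/-! ### Mixing of the walk -/

section Mixing

variable {n : ℕ} {d : BiDegree n}

/-- The permutation moves at most four points even when the pairs overlap, which is what bounds `D`
in `meetAvg_le`. -/
lemma exists_perm_pair {α : Type*} [DecidableEq α] {a b a' b' : α} (hab : a ≠ b) (hab' : a' ≠ b') :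
    ∃ τ : Equiv.Perm α, τ a = a' ∧ τ b = b' ∧ ∀ c, c ∉ ({a, b, a', b'} : Finset α) → τ c = c := by
  refine ⟨(Equiv.swap a a').trans (Equiv.swap (Equiv.swap a a' b) b'), ?_, ?_, ?_⟩
  · rw [Equiv.trans_apply, Equiv.swap_apply_left]
    refine Equiv.swap_apply_of_ne_of_ne (fun h => hab ?_) hab'
    have : Equiv.swap a a' a = Equiv.swap a a' b := by rw [Equiv.swap_apply_left]; exact h
    exact (Equiv.swap a a').injective this
  · simp
  · intro c hc
    simp only [Finset.mem_insert, Finset.mem_singleton, not_or] at hc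
    obtain ⟨h1, h2, h3, h4⟩ := hc
    rw [Equiv.trans_apply, Equiv.swap_apply_of_ne_of_ne h1 h3]
    refine Equiv.swap_apply_of_ne_of_ne ?_ h4
    rw [Equiv.swap_apply_def]
    split_ifs <;> assumption

lemma meetAvg_diag_le (h2 : ∀ v, 2 ≤ d.outDeg v) {t N : ℕ} (hN : 2 * t + 2 ≤ N)
    (hNm : N < d.numEdges) (f g : d.Tail) :
    meetAvg t f f ≤ meetAvg t g g + ((1 / 2) ^ t + collRate d 4 N ^ 2) := by
  have := meetAvg_le h2 hN hNm (Equiv.swap g f) {g, f}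
    ((Finset.card_insert_le _ _).trans (by simp)) (fun c hc => by
      simp only [Finset.mem_insert, Finset.mem_singleton, not_or] at hc
      exact Equiv.swap_apply_of_ne_of_ne hc.1 hc.2) (f := g) (f' := g) (by simp) (by simp)
  simp only [Equiv.swap_apply_left, if_true] at this
  linarith

lemma meetAvg_offdiag_le (h2 : ∀ v, 2 ≤ d.outDeg v) {t N : ℕ} (hN : 2 * t + 2 ≤ N)
    (hNm : N < d.numEdges) {f f' g g' : d.Tail} (hf : f ≠ f') (hg : g ≠ g') :
    meetAvg t f f' ≤ meetAvg t g g' + ((1 / 2) ^ t + collRate d 4 N ^ 2) := by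
  obtain ⟨τ, hτ, hτ', hc⟩ := exists_perm_pair hg hf
  have := meetAvg_le h2 hN hNm τ {g, g', f, f'} Finset.card_le_four hc (f := g) (f' := g')
    (by simp [hτ]) (by simp [hτ'])
  rw [hτ, hτ', if_neg hf] at this
  have h0 : (0 : ℝ) ≤ (1 / 2) ^ t := by positivity
  linarith

/-- The law after `t` steps of the walk started from the in-degree distribution. -/
def startP (ω : d.Matching) (t : ℕ) (x : Fin n) : ℝ :=
  (∑ v, (d.inDeg v : ℝ) * walkP ω t v x) / d.numEdges

lemma sum_inDeg_eq_sum_tail (ω : d.Matching) (g : Fin n → ℝ) :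
    ∑ v, (d.inDeg v : ℝ) * g v = ∑ f, g (ω f).1 := by
  rw [← sum_head]
  exact (Equiv.sum_comp ω fun e => g e.1).symm

lemma startP_eq (ω : d.Matching) (t : ℕ) (x : Fin n) :
    startP ω t x = (∑ f, walkP ω t (ω f).1 x) / d.numEdges := by
  rw [startP, sum_inDeg_eq_sum_tail]

lemma sum_sq_sub_mean_le {ι : Type*} [Fintype ι] (w y : ι → ℝ) {m : ℝ} (hm : ∑ i, w i = m)
    (hm0 : 0 < m) (c : ℝ) :
    ∑ i, w i * (y i - (∑ j, w j * y j) / m) ^ 2 ≤ ∑ i, w i * (y i - c) ^ 2 := by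
  have key : ∀ c : ℝ, ∑ i, w i * (y i - c) ^ 2 =
      ∑ i, w i * y i ^ 2 - 2 * c * (∑ j, w j * y j) + m * c ^ 2 := by
    intro c
    rw [← hm, Finset.mul_sum, Finset.sum_mul, ← Finset.sum_sub_distrib, ← Finset.sum_add_distrib]
    exact Finset.sum_congr rfl fun i _ => by ring
  rw [key, key]
  have h1 : 0 ≤ m * (c - (∑ j, w j * y j) / m) ^ 2 := by positivity
  have h3 : m * (c - (∑ j, w j * y j) / m) ^ 2 = m * c ^ 2 - 2 * c * (∑ j, w j * y j) +
      2 * ((∑ j, w j * y j) / m) * (∑ j, w j * y j) - m * ((∑ j, w j * y j) / m) ^ 2 := by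
    field_simp; ring
  linarith

/-- The expected square norm of a combination of the laws of the walks through the different
tails. -/
lemma avg_sq_combination (t : ℕ) (γ : d.Tail → ℝ) :
    avg (fun ω : d.Matching => ∑ x, (∑ f, γ f * walkP ω t (ω f).1 x) ^ 2) =
      ∑ f, ∑ f', γ f * γ f' * meetAvg t f f' := by
  have : (fun ω : d.Matching => ∑ x, (∑ f, γ f * walkP ω t (ω f).1 x) ^ 2) = fun ω =>
      ∑ f, ∑ f', γ f * γ f' * ∑ x, walkP ω t (ω f).1 x * walkP ω t (ω f').1 x := by
    ext ω
    simp only [sq, Finset.sum_mul_sum]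
    simp only [Finset.mul_sum]
    rw [Finset.sum_comm]
    refine Finset.sum_congr rfl fun f _ => ?_
    rw [Finset.sum_comm]
    refine Finset.sum_congr rfl fun f' _ => Finset.sum_congr rfl fun x _ => by ring
  rw [this, avg_sum]
  refine Finset.sum_congr rfl fun f _ => ?_
  rw [avg_sum]
  refine Finset.sum_congr rfl fun f' _ => ?_
  rw [avg_const_mul]; rfl

/-- A matrix with diagonal `a` and off-diagonal entries `b` is `(a - b) I + b J`, where `J` has all
entries one, and the quadratic form of `J` vanishes at `γ` because `∑ γ = 0`. -/
lemma abs_sum_sub_le {ι : Type*} [Fintype ι] [DecidableEq ι] (γ : ι → ℝ) (M : ι → ι → ℝ)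
    (a b δ : ℝ) (hγ : ∑ i, γ i = 0) (hd : ∀ i, |M i i - a| ≤ δ)
    (ho : ∀ i j, i ≠ j → |M i j - b| ≤ δ) :
    |∑ i, ∑ j, γ i * γ j * M i j - (a - b) * ∑ i, γ i ^ 2| ≤ δ * (∑ i, |γ i|) ^ 2 := by
  have e1 : ∑ i, ∑ j, γ i * γ j * M i j - (a - b) * ∑ i, γ i ^ 2 =
      ∑ i, ∑ j, γ i * γ j * (M i j - if i = j then a else b) := by
    have h1 : ∑ i, ∑ j, γ i * γ j * (if i = j then a else b) =
        (a - b) * ∑ i, γ i ^ 2 := by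
      have h2 : ∀ i j, γ i * γ j * (if i = j then a else b) =
          γ i * γ j * b + if i = j then (a - b) * γ i ^ 2 else 0 := by
        intro i j
        split_ifs with h
        · subst h; ring
        · ring
      simp only [h2, Finset.sum_add_distrib, Finset.sum_ite_eq, Finset.mem_univ, if_true]
      rw [← Finset.mul_sum]
      simp only [← Finset.sum_mul, ← Finset.mul_sum, hγ]
      simp
    rw [← h1, ← Finset.sum_sub_distrib]
    refine Finset.sum_congr rfl fun i _ => ?_
    rw [← Finset.sum_sub_distrib]
    exact Finset.sum_congr rfl fun j _ => by ring
  rw [e1, sq, Finset.sum_mul_sum, Finset.mul_sum]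
  refine (Finset.abs_sum_le_sum_abs _ _).trans (Finset.sum_le_sum fun i _ => ?_)
  rw [Finset.mul_sum]
  refine (Finset.abs_sum_le_sum_abs _ _).trans (Finset.sum_le_sum fun j _ => ?_)
  rw [abs_mul, abs_mul, mul_comm]
  gcongr
  split_ifs with h
  · subst h; exact hd i
  · exact ho i j h

lemma sum_indicator_sub {ι : Type*} [Fintype ι] [DecidableEq ι] {S : Finset ι} (hS : S.Nonempty) :
    (∑ i, ((if i ∈ S then (1 / S.card : ℝ) else 0) - (1 / Fintype.card ι : ℝ)) = 0) ∧
    (∑ i, ((if i ∈ S then (1 / S.card : ℝ) else 0) - (1 / Fintype.card ι : ℝ)) ^ 2 =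
      (1 / S.card - 1 / Fintype.card ι : ℝ)) ∧
    ∑ i, |(if i ∈ S then (1 / S.card : ℝ) else 0) - (1 / Fintype.card ι : ℝ)| ≤ 2 := by
  have hk : (0 : ℝ) < S.card := by exact_mod_cast hS.card_pos
  have hm : (0 : ℝ) < Fintype.card ι := lt_of_lt_of_le hk (by exact_mod_cast Finset.card_le_univ S)
  have h1 : ∑ i, (if i ∈ S then (1 / S.card : ℝ) else 0) = 1 := by
    rw [Finset.sum_ite_mem, Finset.univ_inter, Finset.sum_const, nsmul_eq_mul]
    field_simp
  have h1' : ∑ i, (if i ∈ S then (1 / S.card : ℝ) else 0) ^ 2 =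
      (1 / S.card : ℝ) := by
    simp only [ite_pow, ne_eq, OfNat.ofNat_ne_zero, not_false_eq_true, zero_pow]
    rw [Finset.sum_ite_mem, Finset.univ_inter, Finset.sum_const, nsmul_eq_mul]
    field_simp
  have h3 : ∑ _i : ι, (1 / Fintype.card ι : ℝ) = 1 := by
    rw [Finset.sum_const, nsmul_eq_mul, Finset.card_univ]; field_simp
  refine ⟨by rw [Finset.sum_sub_distrib, h1, h3, sub_self], ?_, ?_⟩
  · have : ∀ i, ((if i ∈ S then (1 / S.card : ℝ) else 0) - (1 / Fintype.card ι : ℝ)) ^ 2 =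
        (if i ∈ S then (1 / S.card : ℝ) else 0) ^ 2 -
        2 * (1 / Fintype.card ι) * (if i ∈ S then (1 / S.card : ℝ) else 0) +
        (1 / Fintype.card ι) * (1 / Fintype.card ι) := fun i => by ring
    simp only [this, Finset.sum_add_distrib, Finset.sum_sub_distrib]
    rw [h1', ← Finset.mul_sum, ← Finset.mul_sum, h1, h3]
    ring
  · calc _ ≤ ∑ i, ((if i ∈ S then (1 / S.card : ℝ) else 0) + 1 / Fintype.card ι) := by
          refine Finset.sum_le_sum fun i _ => (abs_sub _ _).trans (le_of_eq ?_)
          rw [abs_of_nonneg, abs_of_nonneg]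
          · positivity
          · split_ifs <;> positivity
      _ = 2 := by rw [Finset.sum_add_distrib, h1, h3]; norm_num

/-- The mean square distance between the law of a walk started from the in-degree distribution and
the average of these laws. -/
def spread (d : BiDegree n) (t : ℕ) : ℝ := avg fun ω : d.Matching =>
  (∑ v, (d.inDeg v : ℝ) * ∑ x, (walkP ω t v x - startP ω t x) ^ 2) / d.numEdges

lemma numEdges_pos_of_vertex (h2 : ∀ v, 2 ≤ d.outDeg v) (v : Fin n) : 2 ≤ d.numEdges :=
  (h2 v).trans (Finset.single_le_sum (f := d.outDeg) (fun _ _ => Nat.zero_le _) (Finset.mem_univ v))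

lemma spread_zero_le (hm : 0 < d.numEdges) : spread d 0 ≤ 1 := by
  have hm' : (0 : ℝ) < d.numEdges := by exact_mod_cast hm
  refine (avg_mono fun ω => ?_).trans_eq (avg_const 1)
  rw [div_le_one hm']
  simp only [Finset.mul_sum]
  rw [Finset.sum_comm]
  refine (Finset.sum_le_sum fun x _ => sum_sq_sub_mean_le (fun v => (d.inDeg v : ℝ))
    (fun v => walkP ω 0 v x) sum_inDeg hm' 0).trans_eq ?_
  rw [Finset.sum_comm]
  simp [walkP_zero, ← sum_inDeg]

/-- Both sides are expected square norms of combinations of walks through tails, with coefficients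
uniform on a set `S` minus uniform on all tails: `S` is a singleton for `spread` and the set of
tails of `v` on the left. They are therefore close to `(a - b) (1 / |S| - 1 / m)`, and `|S| ≥ 2`
gains the factor one half. The errors add up to `4 δ + 4 δ / 2 = 6 δ`. -/
lemma avg_sq_walkP_sub_le (h2 : ∀ v, 2 ≤ d.outDeg v) {t N : ℕ} (hN : 2 * t + 2 ≤ N)
    (hNm : N < d.numEdges) (v : Fin n) :
    avg (fun ω : d.Matching => ∑ x, (walkP ω (t + 1) v x - startP ω t x) ^ 2) ≤
      spread d t / 2 + 6 * ((1 / 2) ^ t + collRate d 4 N ^ 2) := by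
  classical
  set δ : ℝ := (1 / 2) ^ t + collRate d 4 N ^ 2 with hδ
  have hδ0 : 0 ≤ δ := by positivity
  have hdv := h2 v
  have hmv := numEdges_pos_of_vertex h2 v
  have hm' : (2 : ℝ) ≤ d.numEdges := by exact_mod_cast hmv
  -- Two distinct tails serve as references for the diagonal and off-diagonal values `a` and `b`;
  -- `v` has at least two.
  let f₀ : d.Tail := ⟨v, ⟨0, by omega⟩⟩
  let f₁ : d.Tail := ⟨v, ⟨1, by omega⟩⟩
  have hf : f₀ ≠ f₁ := by
    intro h
    have := (Sigma.mk.inj_iff.1 h).2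
    simp at this
  set a := meetAvg t f₀ f₀ with ha
  set b := meetAvg t f₀ f₁ with hb
  let γ : Finset d.Tail → d.Tail → ℝ := fun S i =>
    (if i ∈ S then (1 / S.card : ℝ) else 0) - 1 / d.numEdges
  have hγ : ∀ S : Finset d.Tail, S.Nonempty →
      |avg (fun ω : d.Matching => ∑ x, (∑ f, γ S f * walkP ω t (ω f).1 x) ^ 2) -
        (a - b) * (1 / S.card - 1 / d.numEdges)| ≤ 4 * δ := by
    intro S hS
    obtain ⟨h1, h3, h4⟩ := sum_indicator_sub hS
    rw [card_tail] at h1 h3 h4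
    rw [avg_sq_combination, ← h3]
    refine (abs_sum_sub_le (γ S) (meetAvg t) a b δ h1 (fun i => ?_) fun i j hij => ?_).trans ?_
    · rw [abs_le]
      constructor
      · linarith [meetAvg_diag_le h2 hN hNm f₀ i]
      · linarith [meetAvg_diag_le h2 hN hNm i f₀]
    · rw [abs_le]
      constructor
      · linarith [meetAvg_offdiag_le h2 hN hNm hf hij]
      · linarith [meetAvg_offdiag_le h2 hN hNm hij hf]
    · have h5 : 0 ≤ ∑ i, |γ S i| := Finset.sum_nonneg fun i _ => abs_nonneg _
      have h6 : (∑ i, |γ S i|) ^ 2 ≤ 2 ^ 2 := by gcongr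
      nlinarith
  have hcomb : ∀ (S : Finset d.Tail) (ω : d.Matching) (x : Fin n),
      ∑ f, γ S f * walkP ω t (ω f).1 x =
        (∑ f ∈ S, walkP ω t (ω f).1 x) / S.card - startP ω t x := by
    intro S ω x
    simp only [γ, sub_mul, Finset.sum_sub_distrib, startP_eq]
    congr 1
    · simp only [ite_mul, zero_mul, Finset.sum_ite_mem, Finset.univ_inter]
      rw [← Finset.mul_sum]; ring
    · rw [← Finset.mul_sum]; ring
  have hS1 : (a - b) * (1 - 1 / d.numEdges) - 4 * δ ≤ spread d t := by
    have hsp : spread d t = (∑ f : d.Tail, avg (fun ω : d.Matching =>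
        ∑ x, (∑ f', γ {f} f' * walkP ω t (ω f').1 x) ^ 2)) / d.numEdges := by
      rw [← avg_sum, div_eq_inv_mul, ← avg_const_mul]
      unfold spread
      congr 1
      ext ω
      rw [sum_inDeg_eq_sum_tail ω fun v => ∑ x, (walkP ω t v x - startP ω t x) ^ 2, div_eq_inv_mul]
      simp [hcomb]
    rw [hsp, le_div_iff₀ (by linarith)]
    have : ∑ f : d.Tail, ((a - b) * (1 - 1 / d.numEdges) - 4 * δ) ≤
        ∑ f : d.Tail, avg (fun ω : d.Matching =>
          ∑ x, (∑ f', γ {f} f' * walkP ω t (ω f').1 x) ^ 2) := by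
      refine Finset.sum_le_sum fun f _ => ?_
      have := abs_le.1 (hγ {f} (Finset.singleton_nonempty f))
      simp only [Finset.card_singleton, Nat.cast_one, div_one] at this
      linarith [this.1]
    rwa [Finset.sum_const, Finset.card_univ, card_tail, nsmul_eq_mul, mul_comm] at this
  let S : Finset d.Tail := Finset.univ.image fun c : Fin (d.outDeg v) => (⟨v, c⟩ : d.Tail)
  have hinj : Function.Injective fun c : Fin (d.outDeg v) => (⟨v, c⟩ : d.Tail) :=
    fun a b h => eq_of_heq (Sigma.mk.inj_iff.1 h).2
  have hScard : S.card = d.outDeg v := by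
    rw [Finset.card_image_of_injective _ hinj]; simp
  have hSne : S.Nonempty := ⟨f₀, Finset.mem_image_of_mem _ (Finset.mem_univ _)⟩
  have hfin := abs_le.1 (hγ S hSne)
  have heq : (fun ω : d.Matching => ∑ x, (∑ f, γ S f * walkP ω t (ω f).1 x) ^ 2) =
      fun ω => ∑ x, (walkP ω (t + 1) v x - startP ω t x) ^ 2 := by
    ext ω
    refine Finset.sum_congr rfl fun x _ => ?_
    rw [hcomb, Finset.sum_image fun c _ c' _ h => hinj h, hScard, walkP_succ]
  rw [heq, hScard] at hfin
  have hdv' : (2 : ℝ) ≤ d.outDeg v := by exact_mod_cast hdv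
  have hdm : (d.outDeg v : ℝ) ≤ d.numEdges := by
    exact_mod_cast Finset.single_le_sum (f := d.outDeg) (fun _ _ => Nat.zero_le _)
      (Finset.mem_univ v)
  have hspread0 : 0 ≤ spread d t := avg_nonneg fun ω =>
    div_nonneg (Finset.sum_nonneg fun v _ => mul_nonneg (Nat.cast_nonneg _)
      (Finset.sum_nonneg fun x _ => sq_nonneg _)) (Nat.cast_nonneg _)
  have hu : (1 / d.outDeg v : ℝ) ≤ 1 / 2 := one_div_le_one_div_of_le (by norm_num) hdv'
  have hw : (1 / d.numEdges : ℝ) ≤ 1 / d.outDeg v := one_div_le_one_div_of_le (by linarith) hdm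
  have hw0 : (0 : ℝ) ≤ 1 / d.numEdges := by positivity
  -- The sign of `a - b` is not known a priori; if it is negative, the nonnegativity of `spread`
  -- suffices.
  rcases le_total 0 (a - b) with hab | hab
  · have h7 : (a - b) * (1 / d.outDeg v - 1 / d.numEdges) ≤
        (a - b) * ((1 - 1 / d.numEdges) / 2) :=
      mul_le_mul_of_nonneg_left (by linarith) hab
    linarith [hfin.2]
  · have h7 : (a - b) * (1 / d.outDeg v - 1 / d.numEdges) ≤ 0 :=
      mul_nonpos_of_nonpos_of_nonneg hab (by linarith)
    linarith [hfin.2]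

/-- The weighted mean `startP ω (t + 1)` minimises the mean square distance, so it may be replaced
by `startP ω t`, to which the one-step estimate applies. -/
lemma spread_succ_le (h2 : ∀ v, 2 ≤ d.outDeg v) {t N : ℕ} (hN : 2 * t + 2 ≤ N)
    (hNm : N < d.numEdges) :
    spread d (t + 1) ≤ spread d t / 2 + 6 * ((1 / 2) ^ t + collRate d 4 N ^ 2) := by
  have hm' : (0 : ℝ) < d.numEdges := by exact_mod_cast (by omega : 0 < d.numEdges)
  have h1 : spread d (t + 1) ≤ (∑ v, (d.inDeg v : ℝ) * avg (fun ω : d.Matching =>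
      ∑ x, (walkP ω (t + 1) v x - startP ω t x) ^ 2)) / d.numEdges := by
    simp only [← avg_const_mul]
    rw [← avg_sum, div_eq_inv_mul, ← avg_const_mul]
    refine avg_mono fun ω => ?_
    rw [← div_eq_inv_mul]
    refine div_le_div_of_nonneg_right ?_ hm'.le
    simp only [Finset.mul_sum]
    rw [Finset.sum_comm]
    exact (Finset.sum_le_sum fun x _ => sum_sq_sub_mean_le (fun v => (d.inDeg v : ℝ))
      (fun v => walkP ω (t + 1) v x) sum_inDeg hm' (startP ω t x)).trans_eq Finset.sum_comm
  refine h1.trans ?_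
  rw [div_le_iff₀ hm']
  refine (Finset.sum_le_sum fun v _ => mul_le_mul_of_nonneg_left
    (avg_sq_walkP_sub_le h2 hN hNm v) (Nat.cast_nonneg _)).trans_eq ?_
  rw [← Finset.sum_mul, sum_inDeg, mul_comm]

lemma spread_le (h2 : ∀ v, 2 ≤ d.outDeg v) {t N : ℕ} (hN : 2 * t + 2 ≤ N)
    (hNm : N < d.numEdges) :
    spread d t ≤ (1 + 12 * t) * (1 / 2) ^ t + 12 * collRate d 4 N ^ 2 := by
  induction t with
  | zero =>
    have := spread_zero_le (d := d) (by omega)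
    have h0 : 0 ≤ collRate d 4 N ^ 2 := sq_nonneg _
    simp only [Nat.cast_zero, pow_zero]
    linarith
  | succ t ih =>
    have := spread_succ_le h2 (t := t) (by omega) hNm
    have := ih (by omega)
    rw [pow_succ]
    push_cast
    linarith

/-- The transition matrix of a number of steps is close to a matrix with equal rows. -/
theorem avg_sum_sq_walkP_sub_le (h2 : ∀ v, 2 ≤ d.outDeg v) {t N : ℕ} (hN : 2 * t + 2 ≤ N)
    (hNm : N < d.numEdges) :
    avg (fun ω : d.Matching => ∑ v, ∑ x, (walkP ω (t + 1) v x - startP ω t x) ^ 2) ≤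
      n * ((1 + 12 * (t + 1)) * (1 / 2) ^ (t + 1) + 12 * collRate d 4 N ^ 2) := by
  rw [avg_sum]
  refine (Finset.sum_le_card_nsmul _ _ _ fun v _ => ?_).trans_eq (by
    rw [Finset.card_univ, Fintype.card_fin, nsmul_eq_mul])
  have := avg_sq_walkP_sub_le h2 hN hNm v
  have := spread_le h2 hN hNm
  rw [pow_succ]
  linarith

end Mixing

end BiDegree

namespace BiDegree

/-! ### Stationary distributions -/

section Stationary

variable {n : ℕ} {d : BiDegree n}

lemma sum_transition_mul (ω : d.Matching) (v : Fin n) (g : Fin n → ℝ) :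
    ∑ x, transition ω v x * g x = (∑ c, g (ω ⟨v, c⟩).1) / d.outDeg v := by
  have h : ∀ x, (edgeMult ω v x : ℝ) = ∑ c : Fin (d.outDeg v),
      if (ω ⟨v, c⟩).1 = x then (1 : ℝ) else 0 := by
    intro x
    rw [edgeMult, Fintype.card_subtype, Finset.card_filter, Fintype.sum_sigma]
    push_cast
    rw [Finset.sum_eq_single v]
    · simp
    · intro u _ hu
      simp [hu]
    · simp
  simp only [transition, Matrix.of_apply, h, div_mul_eq_mul_div, ← Finset.sum_div]
  congr 1
  simp only [Finset.sum_mul]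
  rw [Finset.sum_comm]
  simp

/-- The action of `t` steps of the walk on row vectors. -/
def evolve (ω : d.Matching) (t : ℕ) (μ : Fin n → ℝ) (x : Fin n) : ℝ :=
  ∑ y, μ y * walkP ω t y x

lemma evolve_one (ω : d.Matching) (μ : Fin n → ℝ) (x : Fin n) :
    evolve ω 1 μ x = ∑ y, μ y * transition ω y x := by
  refine Finset.sum_congr rfl fun y _ => ?_
  congr 1
  have := sum_transition_mul ω y fun u => if u = x then 1 else 0
  rw [walkP_succ]
  simp only [mul_ite, mul_one, mul_zero, Finset.sum_ite_eq', Finset.mem_univ, if_true] at this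
  rw [this]; rfl

lemma evolve_add (ω : d.Matching) (s t : ℕ) (μ : Fin n → ℝ) :
    evolve ω (s + t) μ = evolve ω t (evolve ω s μ) := by
  ext x
  simp only [evolve, Finset.sum_mul]
  rw [Finset.sum_comm]
  refine Finset.sum_congr rfl fun y _ => ?_
  rw [walkP, walkE_add, walkE_eq_sum, Finset.mul_sum]
  exact Finset.sum_congr rfl fun z _ => by rw [mul_assoc]; rfl

lemma sum_evolve (h2 : ∀ v, 2 ≤ d.outDeg v) (ω : d.Matching) (t : ℕ) (μ : Fin n → ℝ) :
    ∑ x, evolve ω t μ x = ∑ x, μ x := by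
  unfold evolve
  rw [Finset.sum_comm]
  simp only [← Finset.mul_sum, walkP_sum h2, mul_one]

lemma evolve_sub (ω : d.Matching) (t : ℕ) (μ ν : Fin n → ℝ) (x : Fin n) :
    evolve ω t μ x - evolve ω t ν x = evolve ω t (fun y => μ y - ν y) x := by
  simp only [evolve, ← Finset.sum_sub_distrib, sub_mul]

lemma IsStationary.evolve_eq {ω : d.Matching} {π : Fin n → ℝ} (h : IsStationary ω π) (t : ℕ) :
    evolve ω t π = π := by
  induction t with
  | zero =>
    ext x
    simp [evolve, walkP_zero]
  | succ t ih =>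
    rw [evolve_add, ih]
    ext x
    rw [evolve_one]
    exact (h.2 x).symm

/-- Constants are right eigenvectors with eigenvalue one, so a nonzero left eigenvector `u` exists.
The inequality `|u| ≤ |u| P` holds entrywise and both sides have the same total mass, so `|u|` is
invariant and can be normalised. -/
lemma exists_isStationary (h2 : ∀ v, 2 ≤ d.outDeg v) (hn : 0 < n) (ω : d.Matching) :
    ∃ π, IsStationary ω π := by
  have hrow : ∀ v, ∑ x, transition ω v x = 1 := by
    intro v
    have := sum_transition_mul ω v fun _ => 1
    have h0 : (d.outDeg v : ℝ) ≠ 0 := by have := h2 v; positivity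
    simpa [h0] using this
  have hdet : (transition ω - 1).det = 0 := by
    refine Matrix.exists_mulVec_eq_zero_iff.1 ⟨fun _ => 1, fun h => ?_, ?_⟩
    · simpa using congrFun h ⟨0, hn⟩
    · ext v
      rw [Matrix.sub_mulVec, Matrix.one_mulVec]
      simp [Matrix.mulVec, dotProduct, hrow]
  obtain ⟨u, hu0, hu⟩ := Matrix.exists_vecMul_eq_zero_iff.2 hdet
  have hfix : ∀ x, u x = ∑ y, u y * transition ω y x := by
    intro x
    have := congrFun hu x
    rw [Matrix.vecMul_sub, Matrix.vecMul_one] at this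
    simp only [Pi.sub_apply, Matrix.vecMul, dotProduct, Pi.zero_apply] at this
    linarith
  have hle : ∀ x, |u x| ≤ ∑ y, |u y| * transition ω y x := by
    intro x
    conv_lhs => rw [hfix x]
    refine (Finset.abs_sum_le_sum_abs _ _).trans_eq (Finset.sum_congr rfl fun y _ => ?_)
    rw [abs_mul, abs_of_nonneg (a := transition ω y x)]
    exact div_nonneg (Nat.cast_nonneg _) (Nat.cast_nonneg _)
  have hsum : ∑ x, ∑ y, |u y| * transition ω y x = ∑ x, |u x| := by
    rw [Finset.sum_comm]
    simp only [← Finset.mul_sum, hrow, mul_one]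
  have heq := (Finset.sum_eq_sum_iff_of_le fun x _ => hle x).1 hsum.symm
  have hpos : 0 < ∑ x, |u x| := by
    obtain ⟨x, hx⟩ := Function.ne_iff.1 hu0
    exact Finset.sum_pos' (fun y _ => abs_nonneg _) ⟨x, Finset.mem_univ x, abs_pos.2 hx⟩
  refine ⟨fun x => |u x| / ∑ y, |u y|, ⟨fun x => by positivity, ?_⟩, fun x => ?_⟩
  · rw [← Finset.sum_div, div_self hpos.ne']
  · beta_reduce
    rw [heq x (Finset.mem_univ x), Finset.sum_div]
    exact Finset.sum_congr rfl fun y _ => by ring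

/-- Subtracting the common row `c` does not change the action on mean-zero vectors; Cauchy–Schwarz
then bounds it by the Hilbert–Schmidt norm. -/
lemma sum_sq_evolve_le {ω : d.Matching} {t : ℕ} {c : Fin n → ℝ}
    (hc : ∑ v, ∑ x, (walkP ω t v x - c x) ^ 2 ≤ 1 / 4) (μ : Fin n → ℝ) (hμ : ∑ y, μ y = 0) :
    ∑ x, evolve ω t μ x ^ 2 ≤ 1 / 4 * ∑ y, μ y ^ 2 := by
  have h1 : ∀ x, evolve ω t μ x = ∑ y, μ y * (walkP ω t y x - c x) := by
    intro x
    simp only [mul_sub, Finset.sum_sub_distrib, ← Finset.sum_mul, hμ, evolve]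
    simp
  calc ∑ x, evolve ω t μ x ^ 2
      ≤ ∑ x, (∑ y, μ y ^ 2) * ∑ y, (walkP ω t y x - c x) ^ 2 := by
        refine Finset.sum_le_sum fun x _ => ?_
        rw [h1]
        exact Finset.sum_mul_sq_le_sq_mul_sq _ _ _
    _ = (∑ y, ∑ x, (walkP ω t y x - c x) ^ 2) * ∑ y, μ y ^ 2 := by
        rw [← Finset.mul_sum, Finset.sum_comm, mul_comm]
    _ ≤ _ := by gcongr

lemma sum_sq_evolve_iterate_le (h2 : ∀ v, 2 ≤ d.outDeg v) {ω : d.Matching} {t : ℕ} {c : Fin n → ℝ}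
    (hc : ∑ v, ∑ x, (walkP ω t v x - c x) ^ 2 ≤ 1 / 4) (μ : Fin n → ℝ) (hμ : ∑ y, μ y = 0)
    (j : ℕ) : ∑ x, evolve ω (j * t) μ x ^ 2 ≤ (1 / 4) ^ j * ∑ y, μ y ^ 2 := by
  induction j with
  | zero => simp [evolve, walkP_zero]
  | succ j ih =>
    rw [Nat.succ_mul, evolve_add, pow_succ']
    refine (sum_sq_evolve_le hc _ (by rw [sum_evolve h2, hμ])).trans ?_
    rw [mul_assoc]
    gcongr

/-- If the `t`-step transition matrix is close to a matrix with equal rows, then the stationary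
distribution is unique and the walk converges to it. -/
theorem exists_unique_isStationary_of_close (h2 : ∀ v, 2 ≤ d.outDeg v) (hn : 0 < n)
    {ω : d.Matching} {t : ℕ} {c : Fin n → ℝ}
    (hc : ∑ v, ∑ x, (walkP ω t v x - c x) ^ 2 ≤ 1 / 4) (j : ℕ) :
    ∃ π, IsStationary ω π ∧ (∀ π', IsStationary ω π' → π' = π) ∧
      ∀ x, |startP ω (j * t) x - π x| ≤ 2 * (1 / 2) ^ j := by
  obtain ⟨π, hπ⟩ := exists_isStationary h2 hn ω
  refine ⟨π, hπ, fun π' hπ' => ?_, fun x => ?_⟩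
  · have h0 : ∑ y, (π' y - π y) = 0 := by
      rw [Finset.sum_sub_distrib, hπ.1.2, hπ'.1.2, sub_self]
    have h1 := sum_sq_evolve_le hc (fun y => π' y - π y) h0
    simp only [← evolve_sub, hπ.evolve_eq, hπ'.evolve_eq] at h1
    have h3 : ∑ x, (π' x - π x) ^ 2 = 0 :=
      le_antisymm (by linarith) (Finset.sum_nonneg fun x _ => sq_nonneg _)
    ext x
    have := (Finset.sum_eq_zero_iff_of_nonneg fun x _ => sq_nonneg (π' x - π x)).1 h3 x
      (Finset.mem_univ x)
    exact sub_eq_zero.1 (pow_eq_zero_iff (two_ne_zero)|>.1 this)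
  · have hm : (0 : ℝ) < d.numEdges := by
      have := numEdges_pos_of_vertex h2 ⟨0, hn⟩
      exact_mod_cast (by omega : 0 < d.numEdges)
    set μ : Fin n → ℝ := fun y => d.inDeg y / d.numEdges with hμ
    have hμ0 : ∀ y, 0 ≤ μ y := fun y => by positivity
    have hμ1 : ∑ y, μ y = 1 := by
      rw [← Finset.sum_div, sum_inDeg, div_self hm.ne']
    have hst : startP ω (j * t) x = evolve ω (j * t) μ x := by
      rw [startP, evolve, Finset.sum_div]
      exact Finset.sum_congr rfl fun y _ => by rw [hμ]; ring
    have h0 : ∑ y, (μ y - π y) = 0 := by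
      rw [Finset.sum_sub_distrib, hπ.1.2, hμ1, sub_self]
    have h1 := sum_sq_evolve_iterate_le h2 hc (fun y => μ y - π y) h0 j
    simp only [← evolve_sub, hπ.evolve_eq] at h1
    have hsq : ∀ ν : Fin n → ℝ, (∀ y, 0 ≤ ν y) → ∑ y, ν y = 1 → ∑ y, ν y ^ 2 ≤ 1 := by
      intro ν hν hν1
      rw [← hν1]
      refine Finset.sum_le_sum fun y _ => ?_
      have : ν y ≤ 1 := hν1 ▸ Finset.single_le_sum (fun z _ => hν z) (Finset.mem_univ y)
      nlinarith [hν y]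
    have h3 : ∑ y, (μ y - π y) ^ 2 ≤ 2 := by
      calc ∑ y, (μ y - π y) ^ 2 ≤ ∑ y, (μ y ^ 2 + π y ^ 2) := by
            refine Finset.sum_le_sum fun y _ => ?_
            nlinarith [mul_nonneg (hμ0 y) (hπ.1.1 y)]
        _ ≤ 2 := by
            rw [Finset.sum_add_distrib]
            linarith [hsq μ hμ0 hμ1, hsq π hπ.1.1 hπ.1.2]
    have h4 : (startP ω (j * t) x - π x) ^ 2 ≤ (2 * (1 / 2) ^ j) ^ 2 := by
      have h5 := Finset.single_le_sum (f := fun x => (evolve ω (j * t) μ x - π x) ^ 2)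
        (fun y _ => sq_nonneg _) (Finset.mem_univ x)
      have h6 : ((2 : ℝ) * (1 / 2) ^ j) ^ 2 = 4 * (1 / 4) ^ j := by
        rw [mul_pow, ← pow_mul, mul_comm j 2, pow_mul]; norm_num
      have h7 : (0 : ℝ) ≤ (1 / 4) ^ j := by positivity
      rw [hst, h6]
      nlinarith
    exact abs_le_of_sq_le_sq h4 (by positivity)

end Stationary

end BiDegree

namespace BiDegree

/-! ### Walks that reach a vertex along the shortest paths -/

section Core

variable {n : ℕ} {d : BiDegree n}

/-- There is a path of length `i` from `v` to `x`. -/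
def Reach (ω : d.Matching) (x : Fin n) : ℕ → Fin n → Prop
  | 0, v => v = x
  | i + 1, v => ∃ c, Reach ω x i (ω ⟨v, c⟩).1

/-- There is no path of length less than `h` from `v` to `x`. -/
def Far (ω : d.Matching) (x : Fin n) (h : ℕ) (v : Fin n) : Prop := ∀ j < h, ¬ Reach ω x j v

/-- The selected first tail of a path of length `i + 1` from `v` to `x`. -/
def IsPar (ω : d.Matching) (x : Fin n) (i : ℕ) (v : Fin n) (c : Fin (d.outDeg v)) : Prop :=
  ∃ hr : Reach ω x (i + 1) v, c = Classical.choose hr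

lemma IsPar.unique {ω : d.Matching} {x : Fin n} {i : ℕ} {v : Fin n} {c c' : Fin (d.outDeg v)}
    (h : IsPar ω x i v c) (h' : IsPar ω x i v c') : c = c' := by
  obtain ⟨_, rfl⟩ := h
  obtain ⟨_, rfl⟩ := h'
  rfl

lemma IsPar.reach {ω : d.Matching} {x : Fin n} {i : ℕ} {v : Fin n} {c : Fin (d.outDeg v)}
    (h : IsPar ω x i v c) : Reach ω x i (ω ⟨v, c⟩).1 := by
  obtain ⟨hr, rfl⟩ := h
  exact Classical.choose_spec hr

lemma Reach.exists_isPar {ω : d.Matching} {x : Fin n} {i : ℕ} {v : Fin n}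
    (h : Reach ω x (i + 1) v) : ∃ c, IsPar ω x i v c := ⟨_, h, rfl⟩

lemma Far.mono {ω : d.Matching} {x : Fin n} {h h' : ℕ} {v : Fin n} (H : Far ω x h v)
    (hh : h' ≤ h) : Far ω x h' v := fun j hj => H j (by omega)

/-- The steps of the selected walks: within distance `h` they follow the selected tails, and before
that they stay at distance at least `h`. -/
def Cont (ω : d.Matching) (x : Fin n) (h j : ℕ) (v : Fin n) (c : Fin (d.outDeg v)) : Prop :=
  if j < h then Far ω x (j + 1) v ∧ IsPar ω x j v c else Far ω x h v

open Classical in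
/-- The probability that the walk from `v` is at `x` after `j` steps, all of them selected. -/
def core (ω : d.Matching) (x : Fin n) (h : ℕ) : ℕ → Fin n → ℝ
  | 0, v => if v = x then 1 else 0
  | j + 1, v => (∑ c, if Cont ω x h j v c then core ω x h j (ω ⟨v, c⟩).1 else 0) / d.outDeg v

lemma core_nonneg (ω : d.Matching) (x : Fin n) (h j : ℕ) (v : Fin n) : 0 ≤ core ω x h j v := by
  classical
  induction j generalizing v with
  | zero => simp only [core]; split_ifs <;> norm_num
  | succ j ih =>
    refine div_nonneg (Finset.sum_nonneg fun c _ => ?_) (Nat.cast_nonneg _)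
    split_ifs
    · exact ih _
    · exact le_rfl

lemma core_le_walkP (ω : d.Matching) (x : Fin n) (h j : ℕ) (v : Fin n) :
    core ω x h j v ≤ walkP ω j v x := by
  induction j generalizing v with
  | zero => exact le_rfl
  | succ j ih =>
    rw [walkP_succ, core]
    gcongr with c
    split_ifs
    · exact ih _
    · exact walkP_nonneg _ _ _ _

/-- Up to `h`, the number of remaining steps of a selected walk is exactly the distance to `x`;
beyond that, the distance is at least `h`. Later, this determines the level at which a vertex can be
met. -/
lemma core_support {ω : d.Matching} {x : Fin n} {h j : ℕ} {v : Fin n}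
    (hv : core ω x h j v ≠ 0) : Far ω x (min j h) v ∧ (j ≤ h → Reach ω x j v) := by
  cases j with
  | zero =>
    have : v = x := by by_contra hc; simp [core, hc] at hv
    exact ⟨fun j hj => by omega, fun _ => this⟩
  | succ j =>
    have : ∃ c, Cont ω x h j v c := by
      by_contra! hc
      simp [core, hc] at hv
    obtain ⟨c, hc⟩ := this
    unfold Cont at hc
    split_ifs at hc with hj
    · exact ⟨hc.1.mono (by omega), fun _ => hc.2.choose⟩
    · exact ⟨hc.mono (by omega), fun _ => by omega⟩

/-- Each of the last `min j h` steps has at most one permitted tail among at least two. -/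
lemma core_le_pow (h2 : ∀ v, 2 ≤ d.outDeg v) (ω : d.Matching) (x : Fin n) (h j : ℕ) (v : Fin n) :
    core ω x h j v ≤ (1 / 2) ^ min j h := by
  classical
  induction j generalizing v with
  | zero => simp only [core]; split_ifs <;> norm_num
  | succ j ih =>
    have hd : (2 : ℝ) ≤ d.outDeg v := by exact_mod_cast h2 v
    rw [core, div_le_iff₀ (by linarith)]
    by_cases hj : j < h
    · have hm : min (j + 1) h = min j h + 1 := by omega
      have hone : ∑ c, (if Cont ω x h j v c then core ω x h j (ω ⟨v, c⟩).1 else 0) ≤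
          (1 / 2) ^ min j h := by
        by_cases hex : ∃ c, Cont ω x h j v c
        · obtain ⟨c, hc⟩ := hex
          rw [Finset.sum_eq_single c]
          · rw [if_pos hc]; exact ih _
          · intro c' _ hne
            rw [if_neg]
            intro hc'
            simp only [Cont, if_pos hj] at hc hc'
            exact hne (hc'.2.unique hc.2)
          · simp
        · push Not at hex
          simp only [hex, if_false, Finset.sum_const_zero]
          positivity
      rw [hm, pow_succ]
      have : (0 : ℝ) ≤ (1 / 2) ^ min j h := by positivity
      nlinarith
    · have hm : min (j + 1) h = min j h := by omega
      rw [hm]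
      refine (Finset.sum_le_card_nsmul _ _ ((1 / 2 : ℝ) ^ min j h) fun c _ => ?_).trans_eq (by
        rw [Finset.card_univ, Fintype.card_fin, nsmul_eq_mul, mul_comm])
      split_ifs
      · exact ih _
      · positivity

/-- If `v` is at distance less than `h` from `x`, only the length equal to this distance
contributes. Otherwise every length contributes at most `2^(-h)`, and there are `r` of them. -/
lemma sum_core_le_one (h2 : ∀ v, 2 ≤ d.outDeg v) (ω : d.Matching) (x : Fin n) {h r : ℕ}
    (hr : (r : ℝ) * (1 / 2) ^ h ≤ 1) (v : Fin n) :
    ∑ j ∈ Finset.range r, core ω x h j v ≤ 1 := by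
  classical
  by_cases hf : Far ω x h v
  · refine (Finset.sum_le_card_nsmul _ _ ((1 / 2 : ℝ) ^ h) fun j _ => ?_).trans (by
      simpa using hr)
    by_cases hj : j < h
    · by_contra! hc
      have : core ω x h j v ≠ 0 := by
        have : (0 : ℝ) < (1 / 2) ^ h := by positivity
        linarith
      exact hf j hj ((core_support this).2 hj.le)
    · have := core_le_pow h2 ω x h j v
      rwa [min_eq_right (by omega)] at this
  · have hf' : ∃ i, Reach ω x i v ∧ i < h := by
      unfold Far at hf; push Not at hf
      obtain ⟨i, hi, hr⟩ := hf
      exact ⟨i, hr, hi⟩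
    obtain ⟨hi, hih⟩ := Nat.find_spec hf'
    set i := Nat.find hf'
    have hzero : ∀ j, j ≠ i → core ω x h j v = 0 := by
      intro j hji
      by_contra hc
      obtain ⟨h1, h3⟩ := core_support hc
      have h4 : ¬ i < min j h := fun hlt => h1 i hlt hi
      have h5 : j < i := by omega
      exact Nat.find_min hf' h5 ⟨h3 (by omega), by omega⟩
    calc ∑ j ∈ Finset.range r, core ω x h j v ≤ ∑ j ∈ Finset.range r,
          if j = i then (1 : ℝ) else 0 := by
          refine Finset.sum_le_sum fun j _ => ?_
          split_ifs with hji
          · exact (core_le_pow h2 ω x h j v).trans (pow_le_one₀ (by norm_num) (by norm_num))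
          · exact (hzero j hji).le
      _ ≤ 1 := by
          rw [Finset.sum_ite_eq']
          split_ifs <;> norm_num

/-- A tail whose head leads to `x`, while its source has another selected path to `x` of length at
most `h` (or is `x` itself). -/
def IsFork (ω : d.Matching) (x : Fin n) (h : ℕ) (g : d.Tail) : Prop :=
  ∃ i ≤ h, Far ω x i g.1 ∧ Reach ω x i g.1 ∧ ∀ j, i = j + 1 → ¬ IsPar ω x j g.1 g.2

/-- If the step through `g` is not selected but the rest is, the source of `g` is at distance at
most `h` from `x`. The selected tail there cannot be `g`: that would either place the head of `g`
too close to `x` or make the step selected. -/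
lemma isFork_of_not_cont {ω : d.Matching} {x : Fin n} {h j : ℕ} {g : d.Tail}
    (hc : ¬ Cont ω x h j g.1 g.2) (hcore : core ω x h j (ω g).1 ≠ 0) : IsFork ω x h g := by
  classical
  obtain ⟨h1, h3⟩ := core_support hcore
  have key : ∀ k ≤ h, (∃ i, Reach ω x i g.1 ∧ i ≤ k) → (∀ i, Far ω x i g.1 → Reach ω x i g.1 →
      ∀ l, i = l + 1 → l + 1 ≤ k → ¬ IsPar ω x l g.1 g.2) → IsFork ω x h g := by
    intro k hk hex H
    obtain ⟨hi, hik⟩ := Nat.find_spec hex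
    have hfar : Far ω x (Nat.find hex) g.1 := fun l hl hr =>
      Nat.find_min hex hl ⟨hr, by omega⟩
    exact ⟨Nat.find hex, by omega, hfar, hi, fun l hl => H _ hfar hi l hl (by omega)⟩
  by_cases hj : j < h
  · simp only [Cont, if_pos hj] at hc
    have hr : Reach ω x (j + 1) g.1 := ⟨g.2, h3 hj.le⟩
    refine key (j + 1) hj ⟨j + 1, hr, le_rfl⟩ fun i hfi hri l hl hlk hpar => ?_
    rcases (Nat.lt_or_ge l j) with hlj | hlj
    · exact h1 l (by omega) hpar.reach
    · obtain rfl : l = j := by omega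
      exact hc ⟨hl ▸ hfi, hpar⟩
  · simp only [Cont, if_neg hj, Far] at hc
    push Not at hc
    obtain ⟨i, hi, hri⟩ := hc
    refine key (h - 1) (by omega) ⟨i, hri, by omega⟩ fun i hfi hri l hl hlk hpar => ?_
    exact h1 l (by omega) hpar.reach

lemma sum_startP_mul (ω : d.Matching) (t : ℕ) (g : Fin n → ℝ) :
    ∑ v, startP ω t v * g v = (∑ v, (d.inDeg v : ℝ) * walkE ω t g v) / d.numEdges := by
  simp only [startP, div_mul_eq_mul_div, Finset.sum_mul, ← Finset.sum_div]
  rw [Finset.sum_comm]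
  congr 1
  refine Finset.sum_congr rfl fun v _ => ?_
  rw [walkE_eq_sum, Finset.mul_sum]
  exact Finset.sum_congr rfl fun x _ => by ring

lemma sum_startP_succ_mul (ω : d.Matching) (t : ℕ) (g : Fin n → ℝ) :
    ∑ v, startP ω (t + 1) v * g v =
      ∑ f : d.Tail, startP ω t f.1 / d.outDeg f.1 * g (ω f).1 := by
  have h1 : ∑ f : d.Tail, startP ω t f.1 / d.outDeg f.1 * g (ω f).1 =
      ∑ v, startP ω t v * walkE ω 1 g v := by
    rw [Fintype.sum_sigma]
    refine Finset.sum_congr rfl fun v _ => ?_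
    simp only [walkE]
    rw [← Finset.mul_sum]; ring
  rw [h1, sum_startP_mul, sum_startP_mul]
  congr 1
  refine Finset.sum_congr rfl fun v _ => ?_
  rw [walkE_add]

lemma startP_nonneg (ω : d.Matching) (t : ℕ) (x : Fin n) : 0 ≤ startP ω t x :=
  div_nonneg (Finset.sum_nonneg fun _ _ => mul_nonneg (Nat.cast_nonneg _) (walkP_nonneg _ _ _ _))
    (Nat.cast_nonneg _)

open Classical in
/-- The contribution of the walks of length `r` ending in `x` whose last step that is not selected
uses the tail `g`. -/
def forkTerm (ω : d.Matching) (x : Fin n) (h r : ℕ) (g : d.Tail) : ℝ :=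
  ∑ j ∈ Finset.range r, startP ω (r - 1 - j) g.1 / d.outDeg g.1 *
    if Cont ω x h j g.1 g.2 then 0 else core ω x h j (ω g).1

/-- Walks ending in `x` are read backwards and split at the first step, seen from the end, that is
not selected; the induction peels off one step at a time. -/
lemma startP_eq_core_add (ω : d.Matching) (x : Fin n) (h r : ℕ) :
    startP ω r x = (∑ v, (d.inDeg v : ℝ) * core ω x h r v) / d.numEdges +
      ∑ g, forkTerm ω x h r g := by
  classical
  have key : ∀ j ≤ r, startP ω r x = ∑ v, startP ω (r - j) v * core ω x h j v +
      ∑ g : d.Tail, ∑ i ∈ Finset.range j, startP ω (r - 1 - i) g.1 / d.outDeg g.1 *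
        if Cont ω x h i g.1 g.2 then 0 else core ω x h i (ω g).1 := by
    intro j
    induction j with
    | zero => simp [core]
    | succ j ih =>
      intro hj
      rw [ih (by omega), show r - j = (r - (j + 1)) + 1 by omega, sum_startP_succ_mul]
      simp only [Finset.sum_range_succ, Finset.sum_add_distrib]
      have h1 : ∑ f : d.Tail, startP ω (r - (j + 1)) f.1 / d.outDeg f.1 * core ω x h j (ω f).1 =
          ∑ v, startP ω (r - (j + 1)) v * core ω x h (j + 1) v +
          ∑ g : d.Tail, startP ω (r - 1 - j) g.1 / d.outDeg g.1 *
            if Cont ω x h j g.1 g.2 then 0 else core ω x h j (ω g).1 := by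
        have h3 : ∑ v, startP ω (r - (j + 1)) v * core ω x h (j + 1) v = ∑ f : d.Tail,
            startP ω (r - (j + 1)) f.1 / d.outDeg f.1 *
              if Cont ω x h j f.1 f.2 then core ω x h j (ω f).1 else 0 := by
          rw [Fintype.sum_sigma]
          refine Finset.sum_congr rfl fun v _ => ?_
          rw [core, Finset.sum_div, Finset.mul_sum]
          exact Finset.sum_congr rfl fun c _ => by ring
        rw [h3, ← Finset.sum_add_distrib, show r - 1 - j = r - (j + 1) by omega]
        refine Finset.sum_congr rfl fun f _ => ?_
        split_ifs <;> ring
      rw [h1]; ring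
  rw [key r le_rfl, Nat.sub_self]
  congr 1
  rw [sum_startP_mul]; rfl

open Classical in
/-- An upper bound on `forkTerm` in terms of unrestricted walks. -/
def forkWalk (ω : d.Matching) (x : Fin n) (h r : ℕ) (g : d.Tail) : ℝ :=
  if IsFork ω x h g then ∑ j ∈ Finset.range r,
    startP ω (r - 1 - j) g.1 / d.outDeg g.1 * walkP ω j (ω g).1 x else 0

lemma forkTerm_nonneg (ω : d.Matching) (x : Fin n) (h r : ℕ) (g : d.Tail) :
    0 ≤ forkTerm ω x h r g := by
  classical
  refine Finset.sum_nonneg fun j _ => mul_nonneg (div_nonneg (startP_nonneg _ _ _)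
    (Nat.cast_nonneg _)) ?_
  split_ifs
  · exact le_rfl
  · exact core_nonneg _ _ _ _ _

lemma forkTerm_le_forkWalk (ω : d.Matching) (x : Fin n) (h r : ℕ) (g : d.Tail) :
    forkTerm ω x h r g ≤ forkWalk ω x h r g := by
  classical
  rw [forkTerm, forkWalk]
  split_ifs with hf
  · refine Finset.sum_le_sum fun j _ => mul_le_mul_of_nonneg_left ?_
      (div_nonneg (startP_nonneg _ _ _) (Nat.cast_nonneg _))
    split_ifs
    · exact walkP_nonneg _ _ _ _
    · exact core_le_walkP _ _ _ _ _
  · refine (Finset.sum_eq_zero fun j _ => ?_).le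
    split_ifs with hc
    · simp
    · by_cases h0 : core ω x h j (ω g).1 = 0
      · simp [h0]
      · exact absurd (isFork_of_not_cont hc h0) hf

lemma forkTerm_le_half (h2 : ∀ v, 2 ≤ d.outDeg v) (ω : d.Matching) (x : Fin n) {h r : ℕ}
    (hr : (r : ℝ) * (1 / 2) ^ h ≤ 1) {M : ℝ} (hM : ∀ s < r, ∀ v, startP ω s v ≤ M) (hM0 : 0 ≤ M)
    (g : d.Tail) : forkTerm ω x h r g ≤ M / 2 := by
  classical
  have hd : (2 : ℝ) ≤ d.outDeg g.1 := by exact_mod_cast h2 g.1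
  calc forkTerm ω x h r g ≤ ∑ j ∈ Finset.range r, M / 2 * core ω x h j (ω g).1 := by
        refine Finset.sum_le_sum fun j hj => ?_
        have hj := Finset.mem_range.1 hj
        have h0 := core_nonneg ω x h j (ω g).1
        refine mul_le_mul ?_ ?_ (by split_ifs <;> simp [h0]) (by positivity)
        · exact div_le_div₀ hM0 (hM _ (by omega) _) (by norm_num) hd
        · split_ifs <;> simp [h0]
    _ ≤ M / 2 := by
        rw [← Finset.mul_sum]
        have := sum_core_le_one h2 ω x hr (ω g).1
        nlinarith

open Classical in
/-- The contribution of pairs of forks. -/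
def forkPairs (ω : d.Matching) (x : Fin n) (h r : ℕ) : ℝ :=
  ∑ g, ∑ g', if g ≠ g' then forkWalk ω x h r g * forkWalk ω x h r g' else 0

/-- Let `y` be the total fork contribution. In `y ^ 2` the diagonal terms are at most `(M / 2) y`,
since each single fork contributes at most `M / 2`, and the rest is at most `b ^ 2`. Hence `y ≤ M /
2 + b`. -/
lemma startP_le_core_add (h2 : ∀ v, 2 ≤ d.outDeg v) (ω : d.Matching) (x : Fin n) {h r : ℕ}
    (hr : (r : ℝ) * (1 / 2) ^ h ≤ 1) {M b : ℝ} (hM : ∀ s < r, ∀ v, startP ω s v ≤ M) (hM0 : 0 ≤ M)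
    (hb0 : 0 ≤ b) (hb : forkPairs ω x h r ≤ b ^ 2) :
    startP ω r x ≤ (∑ v, (d.inDeg v : ℝ) * core ω x h r v) / d.numEdges + (M / 2 + b) := by
  classical
  rw [startP_eq_core_add ω x h r]
  gcongr
  set y := ∑ g, forkTerm ω x h r g with hy
  have hy0 : 0 ≤ y := Finset.sum_nonneg fun g _ => forkTerm_nonneg _ _ _ _ _
  have h1 : y ^ 2 ≤ M / 2 * y + b ^ 2 := by
    have h3 : y ^ 2 = ∑ g, ∑ g', forkTerm ω x h r g * forkTerm ω x h r g' := by
      rw [hy, sq, Finset.sum_mul_sum]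
    have h4 : ∀ g, ∑ g', forkTerm ω x h r g * forkTerm ω x h r g' ≤
        M / 2 * forkTerm ω x h r g +
        ∑ g', if g ≠ g' then forkWalk ω x h r g * forkWalk ω x h r g' else 0 := by
      intro g
      have h5 : M / 2 * forkTerm ω x h r g = ∑ g', if g = g' then M / 2 * forkTerm ω x h r g
          else 0 := by simp
      rw [h5, ← Finset.sum_add_distrib]
      refine Finset.sum_le_sum fun g' _ => ?_
      by_cases hg : g = g'
      · subst hg
        simp only [ne_eq, not_true_eq_false, if_false, if_true, add_zero]
        exact mul_le_mul_of_nonneg_right (forkTerm_le_half h2 ω x hr hM hM0 g)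
          (forkTerm_nonneg _ _ _ _ _)
      · simp only [hg, if_false, ne_eq, not_false_eq_true, if_true, zero_add]
        exact mul_le_mul (forkTerm_le_forkWalk _ _ _ _ _) (forkTerm_le_forkWalk _ _ _ _ _)
          (forkTerm_nonneg _ _ _ _ _)
          ((forkTerm_nonneg _ _ _ _ _).trans (forkTerm_le_forkWalk _ _ _ _ _))
    rw [h3]
    refine (Finset.sum_le_sum fun g _ => h4 g).trans ?_
    rw [Finset.sum_add_distrib, ← Finset.mul_sum]
    have : forkPairs ω x h r ≤ b ^ 2 := hb
    unfold forkPairs at this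
    linarith
  by_contra! hc
  nlinarith [mul_nonneg hb0 hM0]

/-- If the contributions of the selected walks and of the pairs of forks are small, then so are the
laws of the walk. -/
theorem startP_le_of_core_of_forkPairs (h2 : ∀ v, 2 ≤ d.outDeg v) (ω : d.Matching) {h T : ℕ}
    (hT : (T : ℝ) * (1 / 2) ^ h ≤ 1) {a b : ℝ} (ha : 0 ≤ a) (hb : 0 ≤ b)
    (hcore : ∀ r ≤ T, ∀ x, (∑ v, (d.inDeg v : ℝ) * core ω x h r v) / d.numEdges ≤ a)
    (hpairs : ∀ r ≤ T, ∀ x, forkPairs ω x h r ≤ b ^ 2) :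
    ∀ r ≤ T, ∀ x, startP ω r x ≤ 2 * (a + b) := by
  intro r
  induction r using Nat.strong_induction_on with
  | _ r ih =>
    intro hr x
    -- The value `2 (a + b)` is the fixed point of `M ↦ a + (M / 2 + b)`.
    have := startP_le_core_add h2 ω x (h := h) (r := r) (M := 2 * (a + b)) (b := b)
      (le_trans (by gcongr) hT) (fun s hs v => ih s hs (by omega) v) (by positivity) hb
      (hpairs r hr x)
    have := hcore r hr x
    linarith

end Core

end BiDegree

namespace BiDegree

/-! ### Moments of the contribution of the selected walks -/

section Moments

variable {n : ℕ} {d : BiDegree n}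

/-- The vertices in `𝒯 i` are at distance `i` from `x` if `i < h`, and at distance at least `h` if
`i = h`. -/
def Levels (ω : d.Matching) (x : Fin n) (h : ℕ) (𝒯 : ℕ → Finset (Fin n)) : Prop :=
  ∀ i ≤ h, ∀ v ∈ 𝒯 i, Far ω x i v ∧ (i < h → Reach ω x i v)

/-- The number of vertices of level `i` on a selected walk of length `j`, not counting its end. -/
def levelCount (h : ℕ) : ℕ → ℕ → ℕ
  | 0, _ => 0
  | j + 1, i => levelCount h j i + if i = min (j + 1) h then 1 else 0

lemma levelCount_le (h j i : ℕ) : levelCount h j i ≤ j := by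
  induction j with
  | zero => exact le_rfl
  | succ j ih => simp only [levelCount]; split_ifs <;> omega

/-- Below `h` the distance drops by one at each selected step, so every such level is visited at
most once; only level `h` can collect many vertices. -/
lemma levelCount_le_one {h i : ℕ} (hi : i < h) (j : ℕ) :
    levelCount h j i ≤ if i ≤ j then 1 else 0 := by
  induction j with
  | zero => simp [levelCount]
  | succ j ih => simp only [levelCount]; split_ifs at ih ⊢ <;> omega

/-- The sources of the revealed tails are recorded in the levels, and so is `x`. -/
def Recorded (x : Fin n) (h : ℕ) (S : Finset d.Tail) (𝒯 : ℕ → Finset (Fin n)) : Prop :=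
  (∀ f ∈ S, ∃ i ≤ h, f.1 ∈ 𝒯 i) ∧ x ∈ 𝒯 0

/-- Add the vertex `v` to the level `i`. -/
def addLevel (𝒯 : ℕ → Finset (Fin n)) (i : ℕ) (v : Fin n) : ℕ → Finset (Fin n) :=
  Function.update 𝒯 i (insert v (𝒯 i))

lemma addLevel_self (𝒯 : ℕ → Finset (Fin n)) (i : ℕ) (v : Fin n) :
    addLevel 𝒯 i v i = insert v (𝒯 i) := by simp [addLevel]

lemma addLevel_of_ne (𝒯 : ℕ → Finset (Fin n)) {i k : ℕ} (h : k ≠ i) (v : Fin n) :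
    addLevel 𝒯 i v k = 𝒯 k := by simp [addLevel, h]

/-- The number of heads attached to the vertices of a level. -/
def levelDeg (d : BiDegree n) (𝒯 : ℕ → Finset (Fin n)) (i : ℕ) : ℝ := ∑ v ∈ 𝒯 i, (d.inDeg v : ℝ)

lemma levelDeg_nonneg (𝒯 : ℕ → Finset (Fin n)) (i : ℕ) : 0 ≤ levelDeg d 𝒯 i :=
  Finset.sum_nonneg fun _ _ => Nat.cast_nonneg _

lemma levelDeg_le (𝒯 : ℕ → Finset (Fin n)) (i : ℕ) :
    levelDeg d 𝒯 i ≤ (𝒯 i).card * d.maxInDeg := by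
  refine (Finset.sum_le_card_nsmul _ _ (d.maxInDeg : ℝ) fun v _ => ?_).trans_eq (by simp)
  exact_mod_cast inDeg_le_maxInDeg v

lemma sum_inDeg_ite (𝒯 : ℕ → Finset (Fin n)) (i : ℕ) :
    ∑ v, (d.inDeg v : ℝ) * (if v ∈ 𝒯 i then 1 else 0) = levelDeg d 𝒯 i := by
  simp [levelDeg]

open Classical in
/-- Following a selected walk step by step: it pays `β` when it hits the levels recorded before,
and the potential `κ j + λ j` bounds the expected payoff of a walk of length `j`. -/
theorem cavg_core_le_potential (h2 : ∀ v, 2 ≤ d.outDeg v) (x : Fin n) (h : ℕ) {Q : d.Matching → ℝ}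
    (hQ : ∀ ω, 0 ≤ Q ω) {N N' : ℕ} (hN : N < d.numEdges) (hN' : N' ≤ N)
    (Good : ℕ → (ℕ → Finset (Fin n)) → Prop) (β : (ℕ → Finset (Fin n)) → ℝ)
    (κ : ℕ → (ℕ → Finset (Fin n)) → ℝ) (lam : ℕ → Fin n → ℝ)
    (hβ : ∀ 𝒯, 0 ≤ β 𝒯) (hκ : ∀ j 𝒯, 0 ≤ κ j 𝒯) (hlam : ∀ j v, 0 ≤ lam j v)
    (hbase : ∀ (S : Finset d.Tail) (ω₀ : d.Matching) (𝒯 : ℕ → Finset (Fin n)),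
      Recorded x h S 𝒯 → S.card ≤ N' → Good 0 𝒯 →
      cavg S ω₀ (fun ω => if Levels ω x h 𝒯 then Q ω else 0) ≤ β 𝒯)
    (hgood : ∀ j 𝒯, Good (j + 1) 𝒯 → Good j 𝒯)
    (hadd : ∀ j 𝒯 v, Good (j + 1) 𝒯 → Good j (addLevel 𝒯 (min (j + 1) h) v))
    (hstep : ∀ j 𝒯 v, Good (j + 1) 𝒯 → (∀ i ≤ h, v ∉ 𝒯 i) →
      levelDeg d (addLevel 𝒯 (min (j + 1) h) v) (min j h) * ((1 / 2) ^ min j h *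
        β (addLevel 𝒯 (min (j + 1) h) v)) / (d.numEdges - N) +
        (∑ u, (d.inDeg u : ℝ) * lam j u) / (d.numEdges - N) +
        κ j (addLevel 𝒯 (min (j + 1) h) v) ≤ κ (j + 1) 𝒯 + lam (j + 1) v) (j : ℕ) :
    ∀ (S : Finset d.Tail) (ω₀ : d.Matching) (𝒯 : ℕ → Finset (Fin n)),
      Recorded x h S 𝒯 → S.card + j ≤ N' → Good j 𝒯 →
      ∀ v, cavg S ω₀ (fun ω => if Levels ω x h 𝒯 then core ω x h j v * Q ω else 0) ≤
        if v ∈ 𝒯 (min j h) then (1 / 2) ^ min j h * β 𝒯 else κ j 𝒯 + lam j v := by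
  have hmN : (0 : ℝ) < d.numEdges - N := sub_pos.2 (by exact_mod_cast hN)
  have hgood0 : ∀ j 𝒯, Good j 𝒯 → Good 0 𝒯 := by
    intro j 𝒯
    induction j with
    | zero => exact id
    | succ j ih => exact fun h => ih (hgood j 𝒯 h)
  induction j with
  | zero =>
    intro S ω₀ 𝒯 hrec hS hG v
    split_ifs with hv
    · simp only [Nat.zero_min, pow_zero, one_mul]
      refine (cavg_mono fun ω _ => ?_).trans (hbase S ω₀ 𝒯 hrec (by omega) hG)
      split_ifs
      · have := core_le_pow h2 ω x h 0 v
        simp only [Nat.zero_min, pow_zero] at this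
        nlinarith [hQ ω]
      · exact le_rfl
    · have : v ≠ x := by
        rintro rfl
        exact hv (by simpa using hrec.2)
      simp only [core, this, if_false, zero_mul, ite_self, cavg_const]
      exact add_nonneg (hκ _ _) (hlam _ _)
  | succ j ih =>
    intro S ω₀ 𝒯 hrec hS hG v
    -- Three cases. A vertex recorded at the expected level pays `β` times the largest possible
    -- remaining weight. A vertex recorded at another level contradicts the distances, so the core
    -- vanishes. A new vertex is recorded and its tails are revealed.
    by_cases hv : v ∈ 𝒯 (min (j + 1) h)
    · rw [if_pos hv]
      calc _ ≤ cavg S ω₀ (fun ω => (1 / 2) ^ min (j + 1) h *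
            if Levels ω x h 𝒯 then Q ω else 0) := by
            refine cavg_mono fun ω _ => ?_
            split_ifs
            · exact mul_le_mul_of_nonneg_right (core_le_pow h2 ω x h _ v) (hQ ω)
            · simp
        _ ≤ _ := by
            rw [cavg_const_mul]
            gcongr
            exact hbase S ω₀ 𝒯 hrec (by omega) (hgood0 _ _ hG)
    rw [if_neg hv]
    by_cases hv' : ∃ i ≤ h, v ∈ 𝒯 i
    · obtain ⟨i, hih, hvi⟩ := hv'
      refine (cavg_mono (G := fun _ => 0) fun ω _ => ?_).trans (by
        rw [cavg_const]; exact add_nonneg (hκ _ _) (hlam _ _))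
      split_ifs with hL
      · by_cases h0 : core ω x h (j + 1) v = 0
        · simp [h0]
        exfalso
        obtain ⟨h1, h3⟩ := core_support h0
        obtain ⟨h4, h5⟩ := hL i hih v hvi
        have hne : i ≠ min (j + 1) h := fun hi => hv (hi ▸ hvi)
        rcases Nat.lt_or_ge i (min (j + 1) h) with hlt | hge
        · exact h1 i hlt (h5 (by omega))
        · exact h4 (j + 1) (by omega) (h3 (by omega))
      · exact le_rfl
    push Not at hv'
    set ℓ := min (j + 1) h with hℓ
    set 𝒯' := addLevel 𝒯 ℓ v with h𝒯'
    have hd : (0 : ℝ) < d.outDeg v := by have := h2 v; positivity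
    have hmem' : ∀ i, 𝒯 i ⊆ 𝒯' i := by
      intro i
      by_cases hi : i = ℓ
      · subst hi; rw [h𝒯', addLevel_self]; exact Finset.subset_insert _ _
      · rw [h𝒯', addLevel_of_ne _ hi]
    -- A nonzero core certifies the level of `v`, so the enlarged record is still correct; the
    -- selection of this step is then dropped, which only increases the bound.
    have hselect : cavg S ω₀ (fun ω => if Levels ω x h 𝒯 then core ω x h (j + 1) v * Q ω else 0) ≤
        cavg S ω₀ (fun ω => (1 / d.outDeg v) * ∑ c : Fin (d.outDeg v),
          if Levels ω x h 𝒯' then core ω x h j (ω ⟨v, c⟩).1 * Q ω else 0) := by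
      refine cavg_mono fun ω _ => ?_
      have hnn : 0 ≤ (1 / (d.outDeg v : ℝ)) * ∑ c : Fin (d.outDeg v),
          if Levels ω x h 𝒯' then core ω x h j (ω ⟨v, c⟩).1 * Q ω else 0 := by
        refine mul_nonneg (by positivity) (Finset.sum_nonneg fun c _ => ?_)
        split_ifs
        · exact mul_nonneg (core_nonneg _ _ _ _ _) (hQ ω)
        · exact le_rfl
      by_cases hL : Levels ω x h 𝒯
      · rw [if_pos hL]
        by_cases h0 : core ω x h (j + 1) v = 0
        · rw [h0, zero_mul]
          exact hnn
        obtain ⟨h1, h3⟩ := core_support h0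
        have hL' : Levels ω x h 𝒯' := by
          intro i hi u hu
          by_cases hiℓ : i = ℓ
          · subst hiℓ
            rw [h𝒯', addLevel_self, Finset.mem_insert] at hu
            rcases hu with rfl | hu
            · refine ⟨h1, fun hlt => ?_⟩
              have : ℓ = j + 1 := by omega
              rw [this]
              exact h3 (by omega)
            · exact hL _ hi u hu
          · rw [h𝒯', addLevel_of_ne _ hiℓ] at hu
            exact hL _ hi u hu
        simp only [hL', if_true]
        rw [← Finset.sum_mul, ← mul_assoc, one_div_mul_eq_div]
        refine mul_le_mul_of_nonneg_right ?_ (hQ ω)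
        rw [core]
        gcongr with c
        split_ifs
        · exact le_rfl
        · exact core_nonneg _ _ _ _ _
      · rw [if_neg hL]
        exact hnn
    refine hselect.trans ?_
    rw [cavg_const_mul, cavg_sum, one_div_mul_eq_div, div_le_iff₀ hd]
    refine (Finset.sum_le_card_nsmul _ _ (κ (j + 1) 𝒯 + lam (j + 1) v) fun c _ => ?_).trans_eq (by
      rw [Finset.card_univ, Fintype.card_fin, nsmul_eq_mul, mul_comm])
    -- Sources of revealed tails are recorded and `v` is not, so its tails are still free.
    have hf : (⟨v, c⟩ : d.Tail) ∉ S := by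
      intro hf
      obtain ⟨i, hi, hvi⟩ := hrec.1 _ hf
      exact hv' i hi hvi
    have hrec' : Recorded x h (insert (⟨v, c⟩ : d.Tail) S) 𝒯' := by
      refine ⟨fun f hf => ?_, hmem' 0 hrec.2⟩
      rcases Finset.mem_insert.1 hf with rfl | hf
      · exact ⟨ℓ, min_le_right _ _, by rw [h𝒯', addLevel_self]; exact Finset.mem_insert_self _ _⟩
      · obtain ⟨i, hi, hvi⟩ := hrec.1 f hf
        exact ⟨i, hi, hmem' i hvi⟩
    have hS' : (insert (⟨v, c⟩ : d.Tail) S).card + j ≤ N' := by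
      rw [Finset.card_insert_of_notMem hf]; omega
    have hβ' : 0 ≤ (1 / 2) ^ min j h * β 𝒯' := mul_nonneg (by positivity) (hβ _)
    refine (cavg_reveal_le_add hf ω₀
      (b := fun e => (fun u => (if u ∈ 𝒯' (min j h) then (1 : ℝ) else 0) *
        ((1 / 2) ^ min j h * β 𝒯') + lam j u) e.1)
      (c := κ j 𝒯') (fun e => add_nonneg (mul_nonneg (by split_ifs <;> norm_num) hβ') (hlam _ _))
      fun e _ => ?_).trans ?_
    · rw [cavg_congr (G := fun ω => if Levels ω x h 𝒯' then core ω x h j e.1 * Q ω else 0)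
        fun ω hω => by rw [hω _ (Finset.mem_insert_self _ _), redirect_self]]
      refine (ih _ _ 𝒯' hrec' hS' (hadd j 𝒯 v hG) e.1).trans ?_
      have h0 := hκ j 𝒯'
      have h0' := hlam j e.1
      by_cases he : e.1 ∈ 𝒯' (min j h)
      · simp only [he, if_true]; linarith
      · simp only [he, if_false]; linarith
    · have hSN : (S.card : ℝ) ≤ N := by exact_mod_cast (by omega : S.card ≤ N)
      refine le_trans ?_ (hstep j 𝒯 v hG hv')
      rw [sum_head (fun u => (if u ∈ 𝒯' (min j h) then (1 : ℝ) else 0) *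
        ((1 / 2) ^ min j h * β 𝒯') + lam j u)]
      have h1 : ∑ u, (d.inDeg u : ℝ) * ((if u ∈ 𝒯' (min j h) then (1 : ℝ) else 0) *
          ((1 / 2) ^ min j h * β 𝒯') + lam j u) =
          levelDeg d 𝒯' (min j h) * ((1 / 2) ^ min j h * β 𝒯') +
            ∑ u, (d.inDeg u : ℝ) * lam j u := by
        rw [← sum_inDeg_ite, Finset.sum_mul, ← Finset.sum_add_distrib]
        exact Finset.sum_congr rfl fun u _ => by ring
      have h3 : 0 ≤ ∑ u, (d.inDeg u : ℝ) * lam j u :=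
        Finset.sum_nonneg fun u _ => mul_nonneg (Nat.cast_nonneg _) (hlam _ _)
      have h4 := mul_nonneg (levelDeg_nonneg (d := d) 𝒯' (min j h)) hβ'
      rw [h1, ← add_div]
      gcongr

/-- The contribution of the selected walks started from the in-degree distribution. -/
def coreStart (ω : d.Matching) (x : Fin n) (h r : ℕ) : ℝ :=
  (∑ v, (d.inDeg v : ℝ) * core ω x h r v) / d.numEdges

lemma coreStart_nonneg (ω : d.Matching) (x : Fin n) (h r : ℕ) : 0 ≤ coreStart ω x h r :=
  div_nonneg (Finset.sum_nonneg fun _ _ => mul_nonneg (Nat.cast_nonneg _) (core_nonneg _ _ _ _ _))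
    (Nat.cast_nonneg _)

open Classical in
lemma cavg_coreStart_mul_le {N : ℕ} (hN : N < d.numEdges) {x : Fin n} {h r : ℕ}
    {Q : d.Matching → ℝ} {S : Finset d.Tail} {ω₀ : d.Matching} {𝒯 : ℕ → Finset (Fin n)}
    {β κ : ℝ} {lam : Fin n → ℝ} (hβ : 0 ≤ β) (hκ : 0 ≤ κ) (hlam : ∀ v, 0 ≤ lam v)
    (H : ∀ v, cavg S ω₀ (fun ω => if Levels ω x h 𝒯 then core ω x h r v * Q ω else 0) ≤
      if v ∈ 𝒯 (min r h) then β else κ + lam v) :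
    cavg S ω₀ (fun ω => if Levels ω x h 𝒯 then coreStart ω x h r * Q ω else 0) ≤
      levelDeg d 𝒯 (min r h) * β / (d.numEdges - N) +
        (∑ v, (d.inDeg v : ℝ) * lam v) / (d.numEdges - N) + κ := by
  have hmN : (0 : ℝ) < d.numEdges - N := sub_pos.2 (by exact_mod_cast hN)
  have hN0 : (0 : ℝ) ≤ N := Nat.cast_nonneg _
  have hm : (0 : ℝ) < d.numEdges := by linarith
  have hsum : cavg S ω₀ (fun ω => if Levels ω x h 𝒯 then coreStart ω x h r * Q ω else 0) =
      (∑ v, (d.inDeg v : ℝ) * cavg S ω₀ (fun ω => if Levels ω x h 𝒯 then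
        core ω x h r v * Q ω else 0)) / d.numEdges := by
    simp only [← cavg_const_mul]
    rw [← cavg_sum, div_eq_inv_mul, ← cavg_const_mul]
    congr 1
    ext ω
    split_ifs
    · rw [coreStart, div_eq_inv_mul, Finset.mul_sum, Finset.mul_sum, Finset.sum_mul]
      exact Finset.sum_congr rfl fun v _ => by ring
    · simp
  have h1 : ∑ v, (d.inDeg v : ℝ) * cavg S ω₀ (fun ω => if Levels ω x h 𝒯 then
      core ω x h r v * Q ω else 0) ≤ levelDeg d 𝒯 (min r h) * β +
        ∑ v, (d.inDeg v : ℝ) * lam v + κ * d.numEdges := by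
    calc _ ≤ ∑ v, (d.inDeg v : ℝ) * ((if v ∈ 𝒯 (min r h) then 1 else 0) * β + lam v + κ) := by
          refine Finset.sum_le_sum fun v _ => mul_le_mul_of_nonneg_left ((H v).trans ?_)
            (Nat.cast_nonneg _)
          have := hlam v
          split_ifs <;> linarith
      _ = _ := by
          rw [← sum_inDeg_ite, ← sum_inDeg, Finset.sum_mul, Finset.mul_sum,
            ← Finset.sum_add_distrib, ← Finset.sum_add_distrib]
          exact Finset.sum_congr rfl fun u _ => by ring
  rw [hsum]
  have h3 : 0 ≤ levelDeg d 𝒯 (min r h) * β := mul_nonneg (levelDeg_nonneg _ _) hβ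
  have h4 : 0 ≤ ∑ v, (d.inDeg v : ℝ) * lam v :=
    Finset.sum_nonneg fun u _ => mul_nonneg (Nat.cast_nonneg _) (hlam _)
  calc _ ≤ (levelDeg d 𝒯 (min r h) * β + ∑ v, (d.inDeg v : ℝ) * lam v +
        κ * d.numEdges) / d.numEdges := by gcongr
    _ = (levelDeg d 𝒯 (min r h) * β + ∑ v, (d.inDeg v : ℝ) * lam v) / d.numEdges + κ := by
        field_simp
    _ ≤ (levelDeg d 𝒯 (min r h) * β + ∑ v, (d.inDeg v : ℝ) * lam v) / (d.numEdges - N) + κ := by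
        gcongr
        linarith
    _ = _ := by rw [add_div]

/-- The bound for the expected contribution of one more selected walk. -/
def levelSum (d : BiDegree n) (h : ℕ) (cap : ℕ → ℕ) (N j : ℕ) : ℝ :=
  ∑ i ∈ Finset.range j, (cap (min i h) : ℝ) * (1 / 2) ^ min i h * (d.maxInDeg / (d.numEdges - N))

lemma levelSum_nonneg {h : ℕ} {cap : ℕ → ℕ} {N j : ℕ} (hN : N < d.numEdges) :
    0 ≤ levelSum d h cap N j := by
  have : (0 : ℝ) < d.numEdges - N := sub_pos.2 (by exact_mod_cast hN)
  unfold levelSum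
  positivity

open Classical in
-- The power is a product over `k` walks revealed in turn: `j` are done and `k'` remain. Each new
-- walk must meet `x` or an earlier vertex, including its own past, at the right level. This costs
-- at most `levelSum`, whatever has been revealed before.
lemma cavg_coreStart_pow_le (h2 : ∀ v, 2 ≤ d.outDeg v) (x : Fin n) (h r k : ℕ)
    (hN : k * r < d.numEdges) (k' : ℕ) :
    ∀ j, k' + j = k → ∀ (S : Finset d.Tail) (ω₀ : d.Matching) (𝒯 : ℕ → Finset (Fin n)),
      Recorded x h S 𝒯 → S.card ≤ j * r → (∀ i ≤ h, (𝒯 i).card ≤ j * levelCount h r i + 1) →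
      cavg S ω₀ (fun ω => if Levels ω x h 𝒯 then coreStart ω x h r ^ k' else 0) ≤
        levelSum d h (fun i => k * levelCount h r i + 1) (k * r) (r + 1) ^ k' := by
  set cap := fun i => k * levelCount h r i + 1 with hcapdef
  set B := levelSum d h cap (k * r) (r + 1) with hB
  have hB0 : 0 ≤ B := levelSum_nonneg hN
  have hmN : (0 : ℝ) < d.numEdges - (k * r : ℕ) := sub_pos.2 (by exact_mod_cast hN)
  have hcost : ∀ (𝒯 : ℕ → Finset (Fin n)) (i : ℕ) (β : ℝ), 0 ≤ β → (𝒯 (min i h)).card ≤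
      cap (min i h) → levelDeg d 𝒯 (min i h) * ((1 / 2) ^ min i h * β) /
        (d.numEdges - (k * r : ℕ)) + levelSum d h cap (k * r) i * β ≤
        levelSum d h cap (k * r) (i + 1) * β := by
    intro 𝒯 i β hβ hc
    have h1 : levelDeg d 𝒯 (min i h) ≤ cap (min i h) * d.maxInDeg :=
      (levelDeg_le _ _).trans (by gcongr)
    calc _ ≤ (cap (min i h) * d.maxInDeg) * ((1 / 2) ^ min i h * β) /
          (d.numEdges - (k * r : ℕ)) + levelSum d h cap (k * r) i * β := by gcongr
      _ = _ := by rw [levelSum, levelSum, Finset.sum_range_succ]; ring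
  induction k' with
  | zero =>
    intro j _ S ω₀ 𝒯 _ _ _
    refine (cavg_mono (G := fun _ => 1) fun ω _ => ?_).trans_eq (by simp [cavg_one])
    split_ifs <;> norm_num
  | succ k' ih =>
    intro j hj S ω₀ 𝒯 hrec hS hcap
    have hjk : (j + 1) * r ≤ k * r := Nat.mul_le_mul_right r (by omega)
    have hjr : (j + 1) * r = j * r + r := by ring
    have hmulc : ∀ i, (j + 1) * levelCount h r i ≤ k * levelCount h r i := fun i =>
      Nat.mul_le_mul_right _ (by omega)
    have hBk : 0 ≤ B ^ k' := by positivity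
    have key := cavg_core_le_potential h2 x h (Q := fun ω => coreStart ω x h r ^ k')
      (fun ω => pow_nonneg (coreStart_nonneg _ _ _ _) _) hN hjk
      -- Vertices recorded so far plus those the current walk may still record with `i` steps left;
      -- the extra `1` accounts for `x`.
      (fun i 𝒯 => ∀ l ≤ h, (𝒯 l).card + levelCount h i l ≤ (j + 1) * levelCount h r l + 1)
      (fun _ => B ^ k') (fun i _ => levelSum d h cap (k * r) i * B ^ k') (fun _ _ => 0)
      (fun _ => hBk) (fun _ _ => mul_nonneg (levelSum_nonneg hN) hBk) (fun _ _ => le_rfl)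
      (fun S ω₀ 𝒯 h1 h3 h4 => ih (j + 1) (by omega) S ω₀ 𝒯 h1 h3 fun i hi => by
        have := h4 i hi; omega)
      (fun i 𝒯 hG l hl => by have := hG l hl; simp only [levelCount] at this; omega)
      (fun i 𝒯 v hG l hl => by
        have h1 := hG l hl
        simp only [levelCount] at h1
        by_cases hlm : l = min (i + 1) h
        · rw [if_pos hlm] at h1
          rw [← hlm, addLevel_self]
          have := Finset.card_insert_le v (𝒯 l)
          omega
        · rw [addLevel_of_ne _ hlm]; omega)
      (fun i 𝒯 v hG _ => by
        simp only [mul_zero, Finset.sum_const_zero, zero_div, add_zero]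
        refine hcost _ i _ hBk ?_
        have h1 := hG (min i h) (min_le_right _ _)
        simp only [levelCount] at h1
        have h3 := hmulc (min i h)
        by_cases hlm : min i h = min (i + 1) h
        · rw [if_pos hlm] at h1
          have h4 := Finset.card_insert_le v (𝒯 (min i h))
          rw [← hlm, addLevel_self]
          simp only [hcapdef]; omega
        · rw [addLevel_of_ne _ hlm]
          simp only [hcapdef]; omega)
      r S ω₀ 𝒯 hrec (by omega) fun i hi => by
        have := hcap i hi
        have : (j + 1) * levelCount h r i = j * levelCount h r i + levelCount h r i := by ring
        omega
    simp only [pow_succ']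
    refine (cavg_coreStart_mul_le hN (mul_nonneg (by positivity) hBk)
      (mul_nonneg (levelSum_nonneg hN) hBk) (fun _ => le_rfl) key).trans ?_
    simp only [mul_zero, Finset.sum_const_zero, zero_div, add_zero]
    refine hcost 𝒯 r _ hBk ?_
    have h6 := hcap (min r h) (min_le_right _ _)
    have h7 : j * levelCount h r (min r h) ≤ k * levelCount h r (min r h) :=
      Nat.mul_le_mul_right _ (by omega)
    simp only [hcapdef]; omega

/-- The moments of the contribution of the selected walks. -/
theorem avg_coreStart_pow_le (h2 : ∀ v, 2 ≤ d.outDeg v) (x : Fin n) {h r k : ℕ}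
    (hN : k * r < d.numEdges) (hr : ((r : ℝ) + 1) ^ 2 * (1 / 2) ^ h ≤ 1) :
    avg (fun ω : d.Matching => coreStart ω x h r ^ k) ≤
      (3 * (k + 1) * (d.maxInDeg / (d.numEdges - (k * r : ℕ)))) ^ k := by
  classical
  have hmN : (0 : ℝ) < d.numEdges - (k * r : ℕ) := sub_pos.2 (by exact_mod_cast hN)
  have key := cavg_coreStart_pow_le h2 x h r k hN k 0 rfl ∅ (Classical.arbitrary _)
    (fun i => if i = 0 then {x} else ∅) ⟨by simp, by simp⟩ (by simp) fun i _ => by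
      split_ifs <;> simp
  rw [cavg_empty] at key
  refine le_trans (avg_mono fun ω => ?_) (key.trans ?_)
  · rw [if_pos]
    intro i _ v hv
    beta_reduce at hv
    split_ifs at hv with hi
    · subst hi
      exact ⟨fun j hj => by omega, fun _ => by simpa [Reach] using hv⟩
    · simp at hv
  · refine pow_le_pow_left₀ (levelSum_nonneg hN) ?_ k
    unfold levelSum
    rw [← Finset.sum_mul]
    gcongr
    -- Levels below `h` hold at most `k + 1` vertices and give a geometric series, bounded by `2 (k
    -- + 1)`. Level `h` may hold `k r + 1`, but its weight `2^(-h)` makes the total at most `k + 1`.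
    calc ∑ i ∈ Finset.range (r + 1), ((k * levelCount h r (min i h) + 1 : ℕ) : ℝ) *
          (1 / 2) ^ min i h ≤ ∑ i ∈ Finset.range (r + 1), (((k : ℝ) + 1) * (1 / 2) ^ i +
          ((k : ℝ) + 1) * (((r : ℝ) + 1) * (1 / 2) ^ h)) := by
          refine Finset.sum_le_sum fun i _ => ?_
          rcases Nat.lt_or_ge i h with hi | hi
          · rw [min_eq_left hi.le]
            have h1 : levelCount h r i ≤ 1 := (levelCount_le_one hi r).trans (by split_ifs <;> simp)
            have h3 : ((k * levelCount h r i + 1 : ℕ) : ℝ) ≤ k + 1 := by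
              have h6 : k * levelCount h r i ≤ k * 1 := Nat.mul_le_mul_left k h1
              exact_mod_cast (by omega : k * levelCount h r i + 1 ≤ k + 1)
            have h4 : (0 : ℝ) ≤ (k + 1) * ((r + 1) * (1 / 2) ^ h) := by positivity
            have h5 := mul_le_mul_of_nonneg_right h3 (by positivity : (0 : ℝ) ≤ (1 / 2) ^ i)
            linarith
          · rw [min_eq_right hi]
            have h1 := levelCount_le h r h
            have h3 : ((k * levelCount h r h + 1 : ℕ) : ℝ) ≤ (k + 1) * (r + 1) := by
              have : k * levelCount h r h ≤ k * r := Nat.mul_le_mul_left k h1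
              exact_mod_cast (by nlinarith : k * levelCount h r h + 1 ≤ (k + 1) * (r + 1))
            have h4 : (0 : ℝ) ≤ (k + 1) * (1 / 2) ^ i := by positivity
            have h5 := mul_le_mul_of_nonneg_right h3 (by positivity : (0 : ℝ) ≤ (1 / 2) ^ h)
            linarith
      _ = ((k : ℝ) + 1) * ∑ i ∈ Finset.range (r + 1), (1 / 2 : ℝ) ^ i +
          ((k : ℝ) + 1) * (((r : ℝ) + 1) ^ 2 * (1 / 2) ^ h) := by
          rw [Finset.sum_add_distrib, ← Finset.mul_sum, Finset.sum_const, Finset.card_range]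
          simp only [nsmul_eq_mul]; push_cast; ring
      _ ≤ (k + 1) * 2 + (k + 1) * 1 := by
          gcongr
          exact sum_geometric_two_le _
      _ = 3 * (k + 1) := by ring

end Moments

end BiDegree

namespace BiDegree

/-! ### Pairs of forks are rare -/

section Forks

variable {n : ℕ} {d : BiDegree n}

/-- The choices `q` lead from the source of `g` to `x` along a shortest path that starts with the
selected tail, and this tail is not `g`. -/
def ForkPath (ω : d.Matching) (x : Fin n) (g : d.Tail) (q : List (Choice d)) : Prop :=
  Far ω x q.length g.1 ∧ walkPos ω g.1 q = x ∧
    ∀ c q', q = c :: q' → IsPar ω x q'.length g.1 (c g.1) ∧ c g.1 ≠ g.2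

/-- A path of length `i` is followed with probability at least `K^(-i)`. This replaces the existence
of a path by a random one that can be explored, at a cost that stays polylogarithmic for the chosen
`h`. -/
lemma Reach.one_le_walkP (h2 : ∀ v, 2 ≤ d.outDeg v) {K : ℕ} (hK : ∀ v, d.outDeg v ≤ K)
    {ω : d.Matching} {x : Fin n} {i : ℕ} {v : Fin n} (h : Reach ω x i v) :
    1 ≤ (K : ℝ) ^ i * walkP ω i v x := by
  induction i generalizing v with
  | zero => simp only [Reach] at h; simp [walkP_zero, h]
  | succ i ih =>
    obtain ⟨c, hc⟩ := h
    have h1 := ih hc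
    have hd : (0 : ℝ) < d.outDeg v := by have := h2 v; positivity
    have hdK : (d.outDeg v : ℝ) ≤ K := by exact_mod_cast hK v
    have h3 : walkP ω i (ω ⟨v, c⟩).1 x ≤ ∑ c, walkP ω i (ω ⟨v, c⟩).1 x :=
      Finset.single_le_sum (f := fun c => walkP ω i (ω ⟨v, c⟩).1 x)
        (fun c _ => walkP_nonneg _ _ _ _) (Finset.mem_univ c)
    have h4 : walkP ω i (ω ⟨v, c⟩).1 x ≤ K * walkP ω (i + 1) v x := by
      rw [walkP_succ, mul_div_assoc', le_div_iff₀ hd, mul_comm]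
      have := walkP_nonneg ω i (ω ⟨v, c⟩).1 x
      exact mul_le_mul hdK h3 this (by positivity)
    calc (1 : ℝ) ≤ (K : ℝ) ^ i * walkP ω i (ω ⟨v, c⟩).1 x := h1
      _ ≤ (K : ℝ) ^ i * (K * walkP ω (i + 1) v x) := by gcongr
      _ = _ := by ring

open Classical in
lemma IsFork.exists_one_le (h2 : ∀ v, 2 ≤ d.outDeg v) {K : ℕ} (hK : ∀ v, d.outDeg v ≤ K)
    {ω : d.Matching} {x : Fin n} {h : ℕ} {g : d.Tail} (hg : IsFork ω x h g) :
    ∃ i ≤ h, 1 ≤ (K : ℝ) ^ i * avgW i (fun q => if ForkPath ω x g q then (1 : ℝ) else 0) := by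
  obtain ⟨i, hi, hfar, hreach, hpar⟩ := hg
  refine ⟨i, hi, ?_⟩
  cases i with
  | zero =>
    have : ForkPath ω x g [] := ⟨fun j hj => by simp at hj, hreach, by simp⟩
    simp [avgW, this]
  | succ i =>
    obtain ⟨c₀, hc₀⟩ := hreach.exists_isPar
    have hne : c₀ ≠ g.2 := by
      rintro rfl
      exact hpar i rfl hc₀
    have h1 := hc₀.reach.one_le_walkP h2 hK
    have hd : (0 : ℝ) < d.outDeg g.1 := by have := h2 g.1; positivity
    have hdK : (d.outDeg g.1 : ℝ) ≤ K := by exact_mod_cast hK g.1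
    have h3 : walkP ω i (ω ⟨g.1, c₀⟩).1 x / d.outDeg g.1 ≤
        avgW (i + 1) (fun q => if ForkPath ω x g q then (1 : ℝ) else 0) := by
      have h4 := choiceAvg_apply h2 g.1 fun c =>
        if c = c₀ then walkP ω i (ω ⟨g.1, c₀⟩).1 x else 0
      rw [Finset.sum_ite_eq' Finset.univ c₀, if_pos (Finset.mem_univ _)] at h4
      rw [← h4]
      refine choiceAvg_mono fun c => ?_
      split_ifs with hc
      · rw [walkP, ← avgW_walkPos h2]
        refine avgW_mono fun q hq => ?_
        beta_reduce
        by_cases hx : walkPos ω (ω ⟨g.1, c₀⟩).1 q = x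
        · rw [if_pos hx, if_pos]
          refine ⟨by rwa [List.length_cons, hq], by simp only [walkPos, hc, hx], ?_⟩
          rintro c' q' he
          obtain ⟨rfl, rfl⟩ := List.cons.inj he
          rw [hc, hq]
          exact ⟨hc₀, hne⟩
        · rw [if_neg hx]
          split_ifs <;> norm_num
      · exact avgW_nonneg fun q => by beta_reduce; split_ifs <;> norm_num
    have h5 := avgW_nonneg (t := i + 1) (F := fun q => if ForkPath ω x g q then (1 : ℝ) else 0)
      fun q => by split_ifs <;> norm_num
    rw [div_le_iff₀ hd] at h3
    calc (1 : ℝ) ≤ (K : ℝ) ^ i * walkP ω i (ω ⟨g.1, c₀⟩).1 x := h1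
      _ ≤ (K : ℝ) ^ i * (avgW (i + 1) (fun q => if ForkPath ω x g q then (1 : ℝ) else 0) * K) := by
          gcongr
          exact h3.trans (by gcongr)
      _ = _ := by ring

/-- The average over a walk of length `s`, one more choice, a walk of length `j` and a walk of
length `i`. -/
def avgQ (s j i : ℕ) (F : List (Choice d) → Choice d → List (Choice d) → List (Choice d) → ℝ) : ℝ :=
  avgW s fun l => choiceAvg fun c => avgW j fun l₂ => avgW i fun q => F l c l₂ q

lemma avg_choiceAvg (F : d.Matching → Choice d → ℝ) :
    avg (fun ω => choiceAvg (F ω)) = choiceAvg (fun c => avg fun ω => F ω c) := by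
  simp only [avg, choiceAvg, ← Finset.sum_div]
  rw [Finset.sum_comm, div_div, div_div, mul_comm]

lemma avg_avgQ (s j i : ℕ)
    (F : d.Matching → List (Choice d) → Choice d → List (Choice d) → List (Choice d) → ℝ) :
    avg (fun ω => avgQ s j i (F ω)) = avgQ s j i fun l c l₂ q => avg fun ω => F ω l c l₂ q := by
  unfold avgQ
  simp only [avg_avgW, avg_choiceAvg]

lemma avgQ_le (h2 : ∀ v, 2 ≤ d.outDeg v) {s j i : ℕ}
    {F : List (Choice d) → Choice d → List (Choice d) → List (Choice d) → ℝ} {a : ℝ}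
    (h : ∀ l c l₂ q, l.length = s → l₂.length = j → q.length = i → F l c l₂ q ≤ a) :
    avgQ s j i F ≤ a := by
  refine (avgW_mono fun l hl => ?_).trans_eq (avgW_const h2 s a)
  refine (choiceAvg_mono fun c => ?_).trans_eq (choiceAvg_const h2 a)
  refine (avgW_mono fun l₂ hl₂ => ?_).trans_eq (avgW_const h2 j a)
  exact (avgW_mono fun q hq => h l c l₂ q hl hl₂ hq).trans_eq (avgW_const h2 i a)

/-- The tail chosen by `c` at the end of the walk. -/
def tailAt (ω : d.Matching) (v : Fin n) (l : List (Choice d)) (c : Choice d) : d.Tail :=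
  ⟨walkPos ω v l, c (walkPos ω v l)⟩

/-- The walk through the tail `tailAt ω v l c` ends at `x`, and `q` is another path to `x`. -/
def ForkEvent (ω : d.Matching) (x v : Fin n) (l : List (Choice d)) (c : Choice d)
    (l₂ q : List (Choice d)) : Prop :=
  walkPos ω (ω (tailAt ω v l c)).1 l₂ = x ∧ ForkPath ω x (tailAt ω v l c) q

open Classical in
-- The weight `startP ω s g.1 / d.outDeg g.1` is the probability that step `s + 1` uses `g`. The sum
-- over tails thus becomes an average over choices, for which the forks are found by an exploration.
lemma sum_tail_mul_eq_avgQ (h2 : ∀ v, 2 ≤ d.outDeg v) (ω : d.Matching) (x : Fin n) (s j i : ℕ)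
    (Φ : d.Tail → ℝ) :
    ∑ g : d.Tail, startP ω s g.1 / d.outDeg g.1 * walkP ω j (ω g).1 x *
        avgW i (fun q => if ForkPath ω x g q then (1 : ℝ) else 0) * Φ g =
      (∑ v, (d.inDeg v : ℝ) * avgQ s j i fun l c l₂ q =>
        Φ (tailAt ω v l c) * if ForkEvent ω x v l c l₂ q then 1 else 0) / d.numEdges := by
  let G : d.Tail → ℝ := fun g => walkP ω j (ω g).1 x *
        avgW i (fun q => if ForkPath ω x g q then (1 : ℝ) else 0) * Φ g
  have h1 : ∀ v, (avgQ s j i fun l c l₂ q =>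
      Φ (tailAt ω v l c) * if ForkEvent ω x v l c l₂ q then 1 else 0) =
      walkE ω s (fun u => (∑ c, G ⟨u, c⟩) / d.outDeg u) v := by
    intro v
    rw [← avgW_walkPos h2]
    refine avgW_congr fun l _ => ?_
    rw [← choiceAvg_apply h2 (walkPos ω v l) fun c => G ⟨_, c⟩]
    congr 1
    ext c
    have h3 : ∀ l₂ q, (Φ (tailAt ω v l c) * if ForkEvent ω x v l c l₂ q then (1 : ℝ) else 0) =
        (Φ (tailAt ω v l c) * if walkPos ω (ω (tailAt ω v l c)).1 l₂ = x then 1 else 0) *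
          if ForkPath ω x (tailAt ω v l c) q then 1 else 0 := by
      intro l₂ q
      by_cases h5 : walkPos ω (ω (tailAt ω v l c)).1 l₂ = x <;>
        by_cases h6 : ForkPath ω x (tailAt ω v l c) q <;> simp [ForkEvent, h5, h6]
    simp only [h3, avgW_mul]
    have h4 : ∀ l₂, ((Φ (tailAt ω v l c) * if walkPos ω (ω (tailAt ω v l c)).1 l₂ = x then 1
        else 0) * avgW i fun q => if ForkPath ω x (tailAt ω v l c) q then (1 : ℝ) else 0) =
        ((avgW i fun q => if ForkPath ω x (tailAt ω v l c) q then (1 : ℝ) else 0) *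
          Φ (tailAt ω v l c)) *
          (fun u => if u = x then (1 : ℝ) else 0) (walkPos ω (ω (tailAt ω v l c)).1 l₂) :=
      fun l₂ => by ring
    simp only [h4, avgW_mul]
    rw [avgW_walkPos h2 ω j (fun u => if u = x then (1 : ℝ) else 0)]
    change _ = G (tailAt ω v l c)
    simp only [G, walkP]
    ring
  simp only [h1]
  rw [← sum_startP_mul, Fintype.sum_sigma]
  refine Finset.sum_congr rfl fun v _ => ?_
  rw [Finset.sum_div, Finset.mul_sum]
  refine Finset.sum_congr rfl fun c _ => ?_
  simp only [G]; ring

/-- Every vertex on the walk except possibly its end is left through a tail in `E`. This is what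
bounds the number of vertices by the number of edges. -/
lemma walk_closed (ω : d.Matching) (x : Fin n) (E : Finset d.Tail) (v : Fin n)
    (l : List (Choice d)) (hl : ∀ f ∈ walkTails ω v l, f ∈ E)
    (hend : walkPos ω v l = x ∨ ∃ f ∈ E, f.1 = walkPos ω v l) :
    (v = x ∨ ∃ f ∈ E, f.1 = v) ∧
      ∀ f ∈ walkTails ω v l, (ω f).1 = x ∨ ∃ g ∈ E, g.1 = (ω f).1 := by
  induction l generalizing v with
  | nil => exact ⟨hend, by simp [walkTails]⟩
  | cons c l ih =>
    simp only [walkTails, List.mem_cons, forall_eq_or_imp] at hl ⊢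
    obtain ⟨h1, h3⟩ := ih (ω ⟨v, c v⟩).1 hl.2 hend
    exact ⟨Or.inr ⟨_, hl.1, rfl⟩, h1, h3⟩

/-- The tails used by a walk through a fork and the second path from the fork. -/
def forkTails (ω : d.Matching) (v : Fin n) (l : List (Choice d)) (c : Choice d)
    (l₂ q : List (Choice d)) : Finset d.Tail :=
  (walkTails ω v l).toFinset ∪ insert (tailAt ω v l c)
    ((walkTails ω (ω (tailAt ω v l c)).1 l₂).toFinset ∪
      (walkTails ω (tailAt ω v l c).1 q).toFinset)

lemma ForkEvent.closed {ω : d.Matching} {x v : Fin n} {l : List (Choice d)} {c : Choice d}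
    {l₂ q : List (Choice d)} (h : ForkEvent ω x v l c l₂ q) {E : Finset d.Tail}
    (hE : forkTails ω v l c l₂ q ⊆ E) :
    (v = x ∨ ∃ f ∈ E, f.1 = v) ∧
      ∀ f ∈ forkTails ω v l c l₂ q, (ω f).1 = x ∨ ∃ g ∈ E, g.1 = (ω f).1 := by
  have hg : tailAt ω v l c ∈ E := hE (by simp [forkTails])
  obtain ⟨h1, h3⟩ := walk_closed ω x E v l (fun f hf => hE (by simp [forkTails, hf]))
    (Or.inr ⟨_, hg, rfl⟩)
  obtain ⟨h4, h5⟩ := walk_closed ω x E _ l₂ (fun f hf => hE (by simp [forkTails, hf]))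
    (Or.inl h.1)
  obtain ⟨-, h6⟩ := walk_closed ω x E _ q (fun f hf => hE (by simp [forkTails, hf]))
    (Or.inl h.2.2.1)
  refine ⟨h1, fun f hf => ?_⟩
  simp only [forkTails, Finset.mem_union, Finset.mem_insert, List.mem_toFinset] at hf
  rcases hf with hf | rfl | hf | hf
  exacts [h3 f hf, h4, h5 f hf, h6 f hf]

lemma Far.eq_of_reach {ω : d.Matching} {x v : Fin n} {i j : ℕ} (hi : Far ω x i v)
    (hi' : Reach ω x i v) (hj : Far ω x j v) (hj' : Reach ω x j v) : i = j := by
  rcases lt_trichotomy i j with h | h | h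
  exacts [absurd hi' (hj i h), h, absurd hj' (hi j h)]

lemma reach_of_walkPos {ω : d.Matching} {x v : Fin n} {q : List (Choice d)}
    (h : walkPos ω v q = x) : Reach ω x q.length v := by
  induction q generalizing v with
  | nil => exact h
  | cons c q ih => exact ⟨c v, ih h⟩

/-- Two walks through different forks use edges with large excess. -/
lemma excess_of_forks {ω : d.Matching} {x v v' : Fin n} {l l' : List (Choice d)} {c c' : Choice d}
    {l₂ q l₂' q' : List (Choice d)} (h : ForkEvent ω x v l c l₂ q)
    (h' : ForkEvent ω x v' l' c' l₂' q') (hne : tailAt ω v l c ≠ tailAt ω v' l' c') :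
    (({x, v, v'} : Finset (Fin n)) ∪
      (forkTails ω v l c l₂ q ∪ forkTails ω v' l' c' l₂' q').image fun f => (ω f).1).card + 1 ≤
      (forkTails ω v l c l₂ q ∪ forkTails ω v' l' c' l₂' q').card := by
  set E := forkTails ω v l c l₂ q ∪ forkTails ω v' l' c' l₂' q' with hE
  set W := ({x, v, v'} : Finset (Fin n)) ∪ E.image fun f => (ω f).1 with hW
  set g := tailAt ω v l c with hg
  set g' := tailAt ω v' l' c' with hg'
  obtain ⟨hv, hland⟩ := h.closed (E := E) Finset.subset_union_left
  obtain ⟨hv', hland'⟩ := h'.closed (E := E) Finset.subset_union_right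
  have hgE : g ∈ E := Finset.mem_union_left _ (by simp [forkTails, ← hg])
  have hgE' : g' ∈ E := Finset.mem_union_right _ (by simp [forkTails, ← hg'])
  have par : ∀ (p : d.Tail) (r : List (Choice d)), ForkPath ω x p r → p.1 ≠ x →
      ∃ (a : Choice d) (i : ℕ), r = a :: r.tail ∧ i + 1 = r.length ∧ IsPar ω x i p.1 (a p.1) ∧
        a p.1 ≠ p.2 := by
    intro p r hp hpx
    rcases r with _ | ⟨a, r⟩
    · exact absurd hp.2.1 hpx
    · obtain ⟨h1, h3⟩ := hp.2.2 a r rfl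
      exact ⟨a, r.length, rfl, rfl, h1, h3⟩
  have hmem : ∀ (a : Choice d), q = a :: q.tail → (⟨g.1, a g.1⟩ : d.Tail) ∈ E := by
    intro a ha
    refine Finset.mem_union_left _ ?_
    rw [forkTails, ← hg, ha]
    simp [walkTails]
  have hmem' : ∀ (a : Choice d), q' = a :: q'.tail → (⟨g'.1, a g'.1⟩ : d.Tail) ∈ E := by
    intro a ha
    refine Finset.mem_union_right _ ?_
    rw [forkTails, ← hg', ha]
    simp [walkTails]
  -- At a fork away from `x`, the selected tail is also in use. It differs from both fork tails,
  -- even if the forks share their source, because the selected tail of a vertex at its distance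
  -- from `x` is unique.
  have other : ∀ (p p' : d.Tail) (r r' : List (Choice d)), ForkPath ω x p r → ForkPath ω x p' r' →
      p.1 ≠ x → (∀ a : Choice d, r = a :: r.tail → (⟨p.1, a p.1⟩ : d.Tail) ∈ E) →
      ∃ f ∈ E, f.1 = p.1 ∧ f ≠ p ∧ f ≠ p' := by
    intro p p' r r' hp hp' hpx hm
    obtain ⟨a, i, ha, hi, hpar, hap⟩ := par p r hp hpx
    refine ⟨⟨p.1, a p.1⟩, hm a ha, rfl, ?_, ?_⟩
    · rintro he
      apply hap
      have := (Sigma.ext_iff.1 he).2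
      exact eq_of_heq this
    · rintro he
      have hsrc : p.1 = p'.1 := by
        have := congrArg Sigma.fst he
        exact this
      obtain ⟨a', i', ha', hi', hpar', hap'⟩ := par p' r' hp' (hsrc ▸ hpx)
      have hlen : r.length = r'.length := by
        refine Far.eq_of_reach hp.1 (reach_of_walkPos hp.2.1) ?_ ?_
        · rw [hsrc]; exact hp'.1
        · rw [hsrc]; exact reach_of_walkPos hp'.2.1
      obtain rfl : i = i' := by omega
      obtain ⟨u, b⟩ := p'
      simp only at hsrc hpar' hap'
      subst hsrc
      have hb : a p.1 = b := eq_of_heq (Sigma.ext_iff.1 he).2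
      exact hap' (hpar'.unique (hb ▸ hpar))
  -- Hence removing both fork tails loses no source other than possibly `x`, and `|W| - 1 ≤ |E| -
  -- 2`.
  have hsub : W.erase x ⊆ (E \ {g, g'}).image Sigma.fst := by
    intro w hw
    obtain ⟨hwx, hwW⟩ := Finset.mem_erase.1 hw
    have hsrc : ∃ f ∈ E, f.1 = w := by
      simp only [hW, Finset.mem_union, Finset.mem_insert, Finset.mem_singleton,
        Finset.mem_image] at hwW
      rcases hwW with (rfl | rfl | rfl) | ⟨f, hf, rfl⟩
      · exact absurd rfl hwx
      · exact hv.resolve_left hwx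
      · exact hv'.resolve_left hwx
      · rcases Finset.mem_union.1 hf with hf | hf
        · exact (hland f hf).resolve_left hwx
        · exact (hland' f hf).resolve_left hwx
    obtain ⟨f, hf, rfl⟩ := hsrc
    by_cases h1 : f = g
    · subst h1
      obtain ⟨f, hf, h3, h4, h5⟩ := other g g' q q' h.2 h'.2 hwx hmem
      exact Finset.mem_image.2 ⟨f, by simp [hf, h4, h5], h3⟩
    by_cases h3 : f = g'
    · subst h3
      obtain ⟨f, hf, h3, h4, h5⟩ := other g' g q' q h'.2 h.2 hwx hmem'
      exact Finset.mem_image.2 ⟨f, by simp [hf, h4, h5], h3⟩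
    · exact Finset.mem_image.2 ⟨f, by simp [hf, h1, h3], rfl⟩
  have hc1 : (W.erase x).card + 1 = W.card :=
    Finset.card_erase_add_one (by simp [hW])
  have hc2 : ({g, g'} : Finset d.Tail).card = 2 := Finset.card_pair hne
  have hsub2 : ({g, g'} : Finset d.Tail) ⊆ E := by
    simp [Finset.insert_subset_iff, hgE, hgE']
  have hc3 := Finset.card_sdiff_add_card_eq_card hsub2
  have hc4 := (Finset.card_le_card hsub).trans Finset.card_image_le
  omega

/-- The exploration that reveals `forkTails`. -/
def Explore.fork (v : Fin n) (l : List (Choice d)) (c : Choice d) (l₂ q : List (Choice d))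
    (k : Explore d) : Explore d :=
  .walk v l fun u => .query ⟨u, c u⟩ fun e => .walk e.1 l₂ fun _ => .walk u q fun _ => k

lemma Explore.within_fork {N : ℕ} (v : Fin n) (l : List (Choice d)) (c : Choice d)
    (l₂ q : List (Choice d)) {k : Explore d} (hk : k.Within N) :
    (Explore.fork v l c l₂ q k).Within (l.length + ((l₂.length + (q.length + N)) + 1)) :=
  within_walk _ _ _ fun _ _ => within_walk _ _ _ fun _ => within_walk _ _ _ fun _ => hk

lemma Explore.tails_fork (ω : d.Matching) (v : Fin n) (l : List (Choice d)) (c : Choice d)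
    (l₂ q : List (Choice d)) (k : Explore d) :
    (Explore.fork v l c l₂ q k).tails ω = forkTails ω v l c l₂ q ∪ k.tails ω := by
  simp only [fork, tails_walk, tails, forkTails, tailAt]
  simp only [Finset.insert_union, Finset.union_assoc]

/-- The excess relative to `Y = {x, v, v'}` is at least `|Y| + 1`, which gives four factors
`collRate` in general and fewer when the vertices coincide. The product form records these
coincidences so that the average over `v` and `v'` can restore the lost factors. -/
lemma prob_forks_le {N : ℕ} (hN : N < d.numEdges) (x v v' : Fin n) (l l' : List (Choice d))
    (c c' : Choice d) (l₂ q l₂' q' : List (Choice d))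
    (hl : l.length + l₂.length + q.length + l'.length + l₂'.length + q'.length + 2 ≤ N)
    (hp : collRate d 3 N ≤ 1) :
    prob (fun ω => ForkEvent ω x v l c l₂ q ∧ ForkEvent ω x v' l' c' l₂' q' ∧
      tailAt ω v l c ≠ tailAt ω v' l' c') ≤
      collRate d 3 N ^ 2 * ((collRate d 3 N + if v = x then 1 else 0) *
        (collRate d 3 N + ((if v' = x then 1 else 0) + if v' = v then 1 else 0))) := by
  have hmN : (0 : ℝ) < d.numEdges - N := sub_pos.2 (by exact_mod_cast hN)
  set Y : Finset (Fin n) := {x, v, v'} with hY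
  let T : Explore d := .fork v l c l₂ q (.fork v' l' c' l₂' q' .done)
  have hT : T.Within N := by
    refine Explore.Within.mono (Explore.within_fork (N := _) v l c l₂ q
      (Explore.within_fork (N := 0) v' l' c' l₂' q' (by simp [Explore.Within]))) (by omega)
  have hTt : ∀ ω, T.tails ω = forkTails ω v l c l₂ q ∪ forkTails ω v' l' c' l₂' q' := by
    intro ω
    simp only [T, Explore.tails_fork, Explore.tails, Finset.union_empty]
  have key := Explore.prob_excess_le T hT hN Y (Y.card + 1)
  simp only [hTt] at key
  set p := collRate d 3 N with hpdef
  have hp0 : 0 ≤ p := by unfold p collRate; positivity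
  have hYc : Y.card ≤ 3 := Finset.card_le_three
  refine (prob_mono fun ω hω => ?_).trans (key.trans ?_)
  · have := excess_of_forks hω.1 hω.2.1 hω.2.2
    rw [← hY] at this
    omega
  · have h1 : (N * ((Y.card + N : ℕ) * d.maxInDeg / (d.numEdges - N) : ℝ)) ^ (Y.card + 1) ≤
        p ^ (Y.card + 1) := by
      unfold p collRate
      gcongr
    refine h1.trans ?_
    by_cases hvx : v = x
    · subst hvx
      by_cases hv' : v' = v
      · subst hv'
        have : Y.card = 1 := by simp [hY]
        rw [this]
        simp only [if_true]
        exact le_mul_of_one_le_right (by positivity) (by nlinarith)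
      · have : Y.card = 2 := by
          rw [hY, Finset.insert_eq_of_mem (by simp), Finset.card_pair (Ne.symm hv')]
        rw [this]
        simp only [if_true, hv', if_false, add_zero]
        rw [pow_succ]
        exact mul_le_mul_of_nonneg_left (by nlinarith) (by positivity)
    · by_cases hv' : v' = x ∨ v' = v
      · have : Y.card = 2 := by
          rcases hv' with rfl | rfl
          · rw [hY, Finset.pair_comm, Finset.insert_eq_of_mem (by simp), Finset.card_pair (Ne.symm hvx)]
          · rw [hY, Finset.pair_eq_singleton, Finset.card_pair (Ne.symm hvx)]
        rw [this]
        have h3 : (1 : ℝ) ≤ (if v' = x then 1 else 0) + if v' = v then 1 else 0 := by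
          rcases hv' with h | h <;> simp only [h, if_true] <;> split_ifs <;> norm_num
        rw [if_neg hvx, add_zero, pow_succ]
        refine mul_le_mul_of_nonneg_left ?_ (by positivity)
        nlinarith
      · push Not at hv'
        have : Y.card = 3 := Finset.card_eq_three.2
          ⟨x, v, v', Ne.symm hvx, Ne.symm hv'.1, Ne.symm hv'.2, rfl⟩
        rw [this]
        simp only [hvx, hv'.1, hv'.2, if_false, add_zero]
        exact le_of_eq (by ring)

open Classical in
/-- One summand of the bound for `forkWalk`. -/
def forkPart (ω : d.Matching) (x : Fin n) (r j i : ℕ) (g : d.Tail) : ℝ :=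
  startP ω (r - 1 - j) g.1 / d.outDeg g.1 * walkP ω j (ω g).1 x *
    avgW i (fun q => if ForkPath ω x g q then (1 : ℝ) else 0)

lemma forkPart_nonneg (ω : d.Matching) (x : Fin n) (r j i : ℕ) (g : d.Tail) :
    0 ≤ forkPart ω x r j i g :=
  mul_nonneg (mul_nonneg (div_nonneg (startP_nonneg _ _ _) (Nat.cast_nonneg _))
    (walkP_nonneg _ _ _ _)) (avgW_nonneg fun q => by split_ifs <;> norm_num)

lemma forkWalk_le (h2 : ∀ v, 2 ≤ d.outDeg v) {K : ℕ} (hK : ∀ v, d.outDeg v ≤ K) (ω : d.Matching)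
    (x : Fin n) (h r : ℕ) (g : d.Tail) :
    forkWalk ω x h r g ≤ (K : ℝ) ^ h *
      ∑ p ∈ Finset.range r ×ˢ Finset.range (h + 1), forkPart ω x r p.1 p.2 g := by
  classical
  have hK1 : (1 : ℝ) ≤ K := by
    have := h2 g.1
    have := hK g.1
    exact_mod_cast (by omega : 1 ≤ K)
  rw [Finset.sum_product, forkWalk]
  split_ifs with hg
  · obtain ⟨i, hi, h1⟩ := hg.exists_one_le h2 hK
    rw [Finset.mul_sum]
    refine Finset.sum_le_sum fun j _ => ?_
    set a := startP ω (r - 1 - j) g.1 / d.outDeg g.1 * walkP ω j (ω g).1 x with ha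
    have ha0 : 0 ≤ a := mul_nonneg (div_nonneg (startP_nonneg _ _ _) (Nat.cast_nonneg _))
      (walkP_nonneg _ _ _ _)
    have hb0 := avgW_nonneg (t := i) (F := fun q => if ForkPath ω x g q then (1 : ℝ) else 0)
      fun q => by split_ifs <;> norm_num
    calc a ≤ a * ((K : ℝ) ^ i * avgW i (fun q => if ForkPath ω x g q then (1 : ℝ) else 0)) :=
          le_mul_of_one_le_right ha0 h1
      _ ≤ a * ((K : ℝ) ^ h * avgW i (fun q => if ForkPath ω x g q then (1 : ℝ) else 0)) := by
          gcongr
      _ = (K : ℝ) ^ h * forkPart ω x r j i g := by rw [forkPart]; ring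
      _ ≤ _ := by
          gcongr
          exact Finset.single_le_sum (f := fun i => forkPart ω x r j i g)
            (fun i _ => forkPart_nonneg _ _ _ _ _ _) (Finset.mem_range.2 (by omega))
  · exact mul_nonneg (by positivity) (Finset.sum_nonneg fun j _ => Finset.sum_nonneg fun i _ =>
      forkPart_nonneg _ _ _ _ _ _)

lemma maxInDeg_div_le_collRate {y N : ℕ} (hN0 : 0 < N) (hN : N < d.numEdges) :
    (d.maxInDeg : ℝ) / d.numEdges ≤ collRate d y N := by
  have hmN : (0 : ℝ) < d.numEdges - N := sub_pos.2 (by exact_mod_cast hN)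
  have h1 : (1 : ℝ) ≤ N := by exact_mod_cast hN0
  have h3 : (1 : ℝ) ≤ (y + N : ℕ) := by exact_mod_cast (by omega : 1 ≤ y + N)
  unfold collRate
  calc (d.maxInDeg : ℝ) / d.numEdges ≤ d.maxInDeg / (d.numEdges - N) := by gcongr; linarith
    _ = 1 * (1 * d.maxInDeg / (d.numEdges - N)) := by ring
    _ ≤ _ := by gcongr

open Classical in
lemma sum_forkPart_eq (h2 : ∀ v, 2 ≤ d.outDeg v) (ω : d.Matching) (r j j' i i' : ℕ) (x : Fin n) :
    ( ∑ g, ∑ g', if g ≠ g' then forkPart ω x r j i g *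
      forkPart ω x r j' i' g' else 0) = (1 / (d.numEdges : ℝ)) *
      ∑ v, (d.inDeg v : ℝ) * avgQ (r - 1 - j) j i fun l c l₂ q =>
        (1 / (d.numEdges : ℝ)) * ∑ v', (d.inDeg v' : ℝ) * avgQ (r - 1 - j') j' i'
          fun l' c' l₂' q' => if ForkEvent ω x v l c l₂ q ∧ ForkEvent ω x v' l' c' l₂' q' ∧
            tailAt ω v l c ≠ tailAt ω v' l' c' then 1 else 0 := by
  have h1 : ∀ g, ∑ g', (if g ≠ g' then forkPart ω x r j i g * forkPart ω x r j' i' g' else 0) =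
      forkPart ω x r j i g * ((∑ v', (d.inDeg v' : ℝ) * avgQ (r - 1 - j') j' i'
        fun l c l₂ q => (if g ≠ tailAt ω v' l c then 1 else 0) *
          if ForkEvent ω x v' l c l₂ q then 1 else 0) / d.numEdges) := by
    intro g
    rw [← sum_tail_mul_eq_avgQ h2 ω x _ j' i' fun g' => if g ≠ g' then 1 else 0, Finset.mul_sum]
    refine Finset.sum_congr rfl fun g' _ => ?_
    rw [forkPart, forkPart]
    split_ifs <;> ring
  simp only [h1]
  have h3 := sum_tail_mul_eq_avgQ h2 ω x (r - 1 - j) j i fun g => (∑ v', (d.inDeg v' : ℝ) *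
    avgQ (r - 1 - j') j' i' fun l c l₂ q => (if g ≠ tailAt ω v' l c then 1 else 0) *
      if ForkEvent ω x v' l c l₂ q then 1 else 0) / d.numEdges
  simp only [forkPart]
  rw [h3, one_div_mul_eq_div]
  congr 1
  refine Finset.sum_congr rfl fun v _ => ?_
  congr 1
  refine avgW_congr fun l _ => congrArg _ (funext fun c => avgW_congr fun l₂ _ =>
    avgW_congr fun q _ => ?_)
  beta_reduce
  by_cases hF : ForkEvent ω x v l c l₂ q
  · rw [if_pos hF, mul_one, one_div_mul_eq_div]
    congr 1
    refine Finset.sum_congr rfl fun v' _ => ?_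
    congr 1
    refine avgW_congr fun l' _ => congrArg _ (funext fun c' => avgW_congr fun l₂' _ =>
      avgW_congr fun q' _ => ?_)
    beta_reduce
    by_cases h5 : tailAt ω v l c ≠ tailAt ω v' l' c' <;>
      by_cases h6 : ForkEvent ω x v' l' c' l₂' q'
    · simp [hF, h5, h6]
    · simp [h6]
    · simp only [h5, and_false, if_false, zero_mul]
    · simp only [h5, and_false, if_false, zero_mul]
  · rw [if_neg hF, mul_zero]
    simp only [hF, false_and, if_false]
    have : avgQ (d := d) (r - 1 - j') j' i' (fun _ _ _ _ => 0) = 0 := by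
      simp [avgQ, avgW_const h2, choiceAvg_const h2]
    simp [this]

open Classical in
-- A starting vertex equals a given vertex with probability at most `Δ⁻/m ≤ collRate`, which
-- compensates for each coincidence. The sum over `v'` has three such terms and the sum over `v`
-- two, hence the `6`.
lemma avg_sum_forkPart_le (h2 : ∀ v, 2 ≤ d.outDeg v) {N r j j' i i' : ℕ} (hN : N < d.numEdges)
    (hp : collRate d 3 N ≤ 1) (x : Fin n) (hj : j < r) (hj' : j' < r)
    (hl : 2 * r + i + i' ≤ N) :
    avg (fun ω : d.Matching => ∑ g, ∑ g', if g ≠ g' then forkPart ω x r j i g *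
      forkPart ω x r j' i' g' else 0) ≤ 6 * collRate d 3 N ^ 4 := by
  set p := collRate d 3 N with hpdef
  have hmN : (0 : ℝ) < d.numEdges - N := sub_pos.2 (by exact_mod_cast hN)
  have hm : (0 : ℝ) < d.numEdges := by
    have : (0 : ℝ) ≤ N := Nat.cast_nonneg _
    linarith
  have hp0 : 0 ≤ p := by unfold p collRate; positivity
  simp only [sum_forkPart_eq h2]
  rw [avg_const_mul, avg_sum]
  simp only [avg_const_mul, avg_avgQ, avg_sum]
  have hprob : ∀ v v', ∀ l c l₂ q, l.length = r - 1 - j → l₂.length = j → q.length = i →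
      ∀ l' c' l₂' q', l'.length = r - 1 - j' → l₂'.length = j' → q'.length = i' →
      avg (fun ω : d.Matching => if ForkEvent ω x v l c l₂ q ∧ ForkEvent ω x v' l' c' l₂' q' ∧
            tailAt ω v l c ≠ tailAt ω v' l' c' then (1 : ℝ) else 0) ≤
      p ^ 2 * ((p + if v = x then 1 else 0) *
        (p + ((if v' = x then 1 else 0) + if v' = v then 1 else 0))) := by
    intro v v' l c l₂ q h1 h3 h4 l' c' l₂' q' h5 h6 h7
    refine le_trans (le_of_eq ?_) (prob_forks_le hN x v v' l l' c c' l₂ q l₂' q' (by omega) hp)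
    unfold prob
    congr 1
    ext ω
    beta_reduce
    congr
  have hDm : (d.maxInDeg : ℝ) / d.numEdges ≤ p := maxInDeg_div_le_collRate (by omega) hN
  have hDm' : (d.maxInDeg : ℝ) ≤ p * d.numEdges := by rwa [div_le_iff₀ hm] at hDm
  have hin : ∀ v, (d.inDeg v : ℝ) ≤ p * d.numEdges := fun v =>
    le_trans (by exact_mod_cast inDeg_le_maxInDeg v) hDm'
  have hinner : ∀ v, (1 / (d.numEdges : ℝ)) * ∑ v', (d.inDeg v' : ℝ) *
      (p ^ 2 * ((p + if v = x then 1 else 0) *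
        (p + ((if v' = x then 1 else 0) + if v' = v then 1 else 0)))) ≤
      3 * p ^ 3 * (p + if v = x then 1 else 0) := by
    intro v
    have h1 : ∑ v', (d.inDeg v' : ℝ) * (p ^ 2 * ((p + if v = x then 1 else 0) *
        (p + ((if v' = x then 1 else 0) + if v' = v then 1 else 0)))) =
        p ^ 2 * (p + if v = x then 1 else 0) *
          (d.numEdges * p + d.inDeg x + d.inDeg v) := by
      rw [← sum_inDeg]
      have : ∀ v', (d.inDeg v' : ℝ) * (p ^ 2 * ((p + if v = x then 1 else 0) *
        (p + ((if v' = x then 1 else 0) + if v' = v then 1 else 0)))) =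
        p ^ 2 * (p + if v = x then 1 else 0) * (d.inDeg v' * p +
          (if v' = x then (d.inDeg v' : ℝ) else 0) + if v' = v then (d.inDeg v' : ℝ) else 0) := by
        intro v'
        split_ifs <;> ring
      simp only [this, ← Finset.mul_sum, Finset.sum_add_distrib, ← Finset.sum_mul]
      simp
    rw [h1, one_div_mul_eq_div, div_le_iff₀ hm]
    have h3 : 0 ≤ p ^ 2 * (p + if v = x then 1 else 0) := by split_ifs <;> positivity
    have := mul_le_mul_of_nonneg_left
      (by linarith [hin x, hin v] : (d.numEdges * p + d.inDeg x + d.inDeg v : ℝ) ≤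
        3 * (p * d.numEdges)) h3
    refine this.trans_eq (by ring)
  calc _ ≤ (1 / (d.numEdges : ℝ)) * ∑ v, (d.inDeg v : ℝ) *
        (3 * p ^ 3 * (p + if v = x then 1 else 0)) := by
        refine mul_le_mul_of_nonneg_left (Finset.sum_le_sum fun v _ =>
          mul_le_mul_of_nonneg_left (avgQ_le h2 fun l c l₂ q h1 h3 h4 => ?_) (Nat.cast_nonneg _))
          (by positivity)
        refine le_trans ?_ (hinner v)
        refine mul_le_mul_of_nonneg_left (Finset.sum_le_sum fun v' _ =>
          mul_le_mul_of_nonneg_left (avgQ_le h2 fun l' c' l₂' q' h5 h6 h7 =>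
            hprob v v' l c l₂ q h1 h3 h4 l' c' l₂' q' h5 h6 h7) (Nat.cast_nonneg _)) (by positivity)
    _ = (1 / (d.numEdges : ℝ)) * (3 * p ^ 3 * (d.numEdges * p + d.inDeg x)) := by
        rw [← sum_inDeg]
        congr 1
        have : ∀ v, (d.inDeg v : ℝ) * (3 * p ^ 3 * (p + if v = x then 1 else 0)) =
          3 * p ^ 3 * (d.inDeg v * p + if v = x then (d.inDeg v : ℝ) else 0) := by
          intro v; split_ifs <;> ring
        simp only [this, ← Finset.mul_sum, Finset.sum_add_distrib, ← Finset.sum_mul]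
        simp
    _ ≤ (1 / (d.numEdges : ℝ)) * (3 * p ^ 3 * (d.numEdges * p + p * d.numEdges)) := by
        gcongr
        exact hin x
    _ = 6 * p ^ 4 := by field_simp; ring

/-- The expected contribution of the pairs of forks. -/
theorem avg_forkPairs_le (h2 : ∀ v, 2 ≤ d.outDeg v) {K : ℕ} (hK : ∀ v, d.outDeg v ≤ K)
    {N r h : ℕ} (hN : N < d.numEdges) (hp : collRate d 3 N ≤ 1) (x : Fin n)
    (hl : 2 * (r + h) ≤ N) :
    avg (fun ω : d.Matching => forkPairs ω x h r) ≤
      ((K : ℝ) ^ h * (r * (h + 1))) ^ 2 * (6 * collRate d 3 N ^ 4) := by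
  classical
  set P := Finset.range r ×ˢ Finset.range (h + 1) with hP
  have hpt : ∀ ω : d.Matching, forkPairs ω x h r ≤ ((K : ℝ) ^ h) ^ 2 * ∑ p ∈ P, ∑ p' ∈ P,
      ∑ g, ∑ g', if g ≠ g' then forkPart ω x r p.1 p.2 g * forkPart ω x r p'.1 p'.2 g' else 0 := by
    intro ω
    have h1 : ∑ p ∈ P, ∑ p' ∈ P, ∑ g, ∑ g', (if g ≠ g' then forkPart ω x r p.1 p.2 g *
        forkPart ω x r p'.1 p'.2 g' else 0) = ∑ g, ∑ g', if g ≠ g' then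
        (∑ p ∈ P, forkPart ω x r p.1 p.2 g) * (∑ p ∈ P, forkPart ω x r p.1 p.2 g') else 0 := by
      rw [Finset.sum_congr rfl fun p _ => Finset.sum_comm, Finset.sum_comm]
      refine Finset.sum_congr rfl fun g _ => ?_
      rw [Finset.sum_congr rfl fun p _ => Finset.sum_comm, Finset.sum_comm]
      refine Finset.sum_congr rfl fun g' _ => ?_
      split_ifs
      · rw [Finset.sum_mul_sum]
      · simp
    rw [h1, Finset.mul_sum]
    refine Finset.sum_le_sum fun g _ => ?_
    rw [Finset.mul_sum]
    refine Finset.sum_le_sum fun g' _ => ?_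
    have h0 : ∀ g, 0 ≤ forkWalk ω x h r g := fun g =>
      (forkTerm_nonneg _ _ _ _ _).trans (forkTerm_le_forkWalk _ _ _ _ _)
    have h3 := mul_le_mul (forkWalk_le h2 hK ω x h r g) (forkWalk_le h2 hK ω x h r g') (h0 g')
      ((h0 g).trans (forkWalk_le h2 hK ω x h r g))
    split_ifs
    · refine h3.trans_eq (by rw [hP]; ring)
    · simp
  refine (avg_mono hpt).trans ?_
  rw [avg_const_mul, avg_sum, mul_pow, mul_assoc]
  gcongr
  simp only [avg_sum (d := d) P]
  have hcard : (P.card : ℝ) = r * (h + 1) := by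
    rw [hP, Finset.card_product, Finset.card_range, Finset.card_range]; push_cast; ring
  calc _ ≤ ∑ p ∈ P, ∑ p' ∈ P, 6 * collRate d 3 N ^ 4 := by
        refine Finset.sum_le_sum fun p hp' => Finset.sum_le_sum fun p' hp'' => ?_
        rw [hP, Finset.mem_product, Finset.mem_range, Finset.mem_range] at hp' hp''
        exact avg_sum_forkPart_le h2 hN hp x hp'.1 hp''.1 (by omega)
    _ = _ := by
        rw [Finset.sum_const, Finset.sum_const, nsmul_eq_mul, nsmul_eq_mul, hcard]; ring

end Forks

end BiDegree

namespace BiDegree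

/-! ### The second moment of the contribution of the selected walks -/

section SecondMoment

variable {n : ℕ} {d : BiDegree n}

/-- The bound for the expected contribution of the selected walks of length less than `j` which end
in the recorded levels, if the last level has at most `c` vertices. -/
def levelPotential (d : BiDegree n) (h N c j : ℕ) (𝒯 : ℕ → Finset (Fin n)) : ℝ :=
  ∑ i ∈ Finset.range j, (if i < h then levelDeg d 𝒯 i * (1 / 2) ^ i
    else c * d.maxInDeg * (1 / 2) ^ h) / (d.numEdges - N)

lemma levelPotential_nonneg {h N c : ℕ} (hN : N < d.numEdges) (j : ℕ)
    (𝒯 : ℕ → Finset (Fin n)) : 0 ≤ levelPotential d h N c j 𝒯 := by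
  have hmN : (0 : ℝ) < d.numEdges - N := sub_pos.2 (by exact_mod_cast hN)
  refine Finset.sum_nonneg fun i _ => div_nonneg ?_ hmN.le
  split_ifs
  · exact mul_nonneg (levelDeg_nonneg _ _) (by positivity)
  · positivity

lemma levelDeg_mul_add_levelPotential_le {h N c : ℕ} (hN : N < d.numEdges) (j : ℕ)
    {𝒯 : ℕ → Finset (Fin n)} (hc : h ≤ j → (𝒯 h).card ≤ c) :
    levelDeg d 𝒯 (min j h) * (1 / 2) ^ min j h / (d.numEdges - N) + levelPotential d h N c j 𝒯 ≤
      levelPotential d h N c (j + 1) 𝒯 := by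
  have hmN : (0 : ℝ) < d.numEdges - N := sub_pos.2 (by exact_mod_cast hN)
  rw [levelPotential, levelPotential, Finset.sum_range_succ, add_comm]
  gcongr
  split_ifs with hj
  · rw [min_eq_left hj.le]
  · push Not at hj
    rw [min_eq_right hj]
    gcongr
    exact (levelDeg_le _ _).trans (by gcongr; exact hc hj)

lemma levelPotential_addLevel {h N c j i : ℕ} (hji : j ≤ i) (𝒯 : ℕ → Finset (Fin n)) (v : Fin n) :
    levelPotential d h N c j (addLevel 𝒯 (min i h) v) = levelPotential d h N c j 𝒯 := by
  refine Finset.sum_congr rfl fun k hk => ?_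
  have := Finset.mem_range.1 hk
  congr 1
  split_ifs with hkh
  · rw [levelDeg, addLevel_of_ne _ (by omega), levelDeg]
  · rfl

/-- Only the summand of level `i < h` changes; the terms from `h` on are already bounded through
`c`. The increase is kept proportional to the actual in-degree of `v`, so that the second moment
involves `∑ (d⁻)²` and not `(Δ⁻)²`. -/
lemma levelPotential_addLevel_le {h N c J i : ℕ} (hN : N < d.numEdges) {𝒯 : ℕ → Finset (Fin n)}
    {v : Fin n} (hv : v ∉ 𝒯 (min i h)) :
    levelPotential d h N c J (addLevel 𝒯 (min i h) v) ≤
      levelPotential d h N c J 𝒯 + d.inDeg v * (1 / 2) ^ i / (d.numEdges - N) := by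
  have hmN : (0 : ℝ) < d.numEdges - N := sub_pos.2 (by exact_mod_cast hN)
  have h0 : 0 ≤ (d.inDeg v : ℝ) * (1 / 2) ^ i / (d.numEdges - N) := by positivity
  calc _ ≤ ∑ k ∈ Finset.range J, ((if k < h then levelDeg d 𝒯 k * (1 / 2) ^ k
        else c * d.maxInDeg * (1 / 2) ^ h) / (d.numEdges - N) +
        if k = i then (d.inDeg v : ℝ) * (1 / 2) ^ i / (d.numEdges - N) else 0) := by
        refine Finset.sum_le_sum fun k _ => ?_
        by_cases hk : k < h
        · rw [if_pos hk, if_pos hk]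
          by_cases hki : k = i
          · subst hki
            rw [if_pos rfl, ← add_div, ← add_mul]
            rw [min_eq_left hk.le] at hv ⊢
            rw [levelDeg, addLevel_self, Finset.sum_insert hv, levelDeg, add_comm]
          · rw [if_neg hki, add_zero, levelDeg, addLevel_of_ne _ (by omega), levelDeg]
        · rw [if_neg hk, if_neg hk]
          have : 0 ≤ if k = i then (d.inDeg v : ℝ) * (1 / 2) ^ i / (d.numEdges - N) else 0 := by
            split_ifs <;> first | exact h0 | exact le_rfl
          linarith
    _ ≤ _ := by
        rw [Finset.sum_add_distrib, Finset.sum_ite_eq', levelPotential]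
        gcongr
        split_ifs <;> first | exact h0 | exact le_rfl

open Classical in
lemma cavg_coreStart_le (h2 : ∀ v, 2 ≤ d.outDeg v) (x : Fin n) {h r N c : ℕ}
    (hN : N < d.numEdges) (S : Finset d.Tail) (ω₀ : d.Matching) (𝒯 : ℕ → Finset (Fin n))
    (hrec : Recorded x h S 𝒯) (hS : S.card + r ≤ N) (hc : (𝒯 h).card + r ≤ c) :
    cavg S ω₀ (fun ω => if Levels ω x h 𝒯 then coreStart ω x h r else 0) ≤
      levelPotential d h N c (r + 1) 𝒯 := by
  have key := cavg_core_le_potential h2 x h (Q := fun _ => 1) (fun _ => zero_le_one) hN le_rfl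
    (fun j 𝒯 => (𝒯 h).card + j ≤ c) (fun _ => 1) (fun j 𝒯 => levelPotential d h N c j 𝒯)
    (fun _ _ => 0) (fun _ => zero_le_one) (fun j 𝒯 => levelPotential_nonneg hN j 𝒯)
    (fun _ _ => le_rfl)
    (fun S ω₀ 𝒯 _ _ _ => (cavg_mono (G := fun _ => 1) fun ω _ => by
      split_ifs <;> norm_num).trans_eq (cavg_one _ _))
    (fun j 𝒯 hG => by omega)
    (fun j 𝒯 v hG => by
      by_cases hj : h = min (j + 1) h
      · have := Finset.card_insert_le v (𝒯 h)
        rw [← hj, addLevel_self]; omega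
      · rw [addLevel_of_ne _ hj]; omega)
    (fun j 𝒯 v hG _ => by
      simp only [mul_zero, Finset.sum_const_zero, zero_div, add_zero, mul_one]
      rw [← levelPotential_addLevel le_rfl 𝒯 v]
      refine levelDeg_mul_add_levelPotential_le hN j fun hj => ?_
      have := Finset.card_insert_le v (𝒯 h)
      rw [min_eq_right (by omega), addLevel_self]; omega) r S ω₀ 𝒯 hrec hS hc
  have := cavg_coreStart_mul_le hN (by positivity) (levelPotential_nonneg hN r 𝒯)
    (fun _ => le_rfl) key
  simp only [mul_one, mul_zero, Finset.sum_const_zero, zero_div, add_zero] at this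
  exact this.trans (levelDeg_mul_add_levelPotential_le hN r fun _ => by omega)


lemma sum_range_le_of_le {f : ℕ → ℝ} {a b : ℝ} (h0 : f 0 ≤ a)
    (h : ∀ i, i ≠ 0 → f i ≤ b) (r : ℕ) : ∑ i ∈ Finset.range (r + 1), f i ≤ a + r * b := by
  rw [Finset.sum_range_succ']
  have := Finset.sum_le_card_nsmul (Finset.range r) (fun i => f (i + 1)) b fun i _ => h _ (by omega)
  rw [Finset.card_range, nsmul_eq_mul] at this
  linarith

/-- The second moment of the contribution of the selected walks. -/
theorem avg_coreStart_sq_le (h2 : ∀ v, 2 ≤ d.outDeg v) (x : Fin n) {h r : ℕ} (hh : 1 ≤ h)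
    (hN : 2 * r < d.numEdges) :
    avg (fun ω : d.Matching => coreStart ω x h r ^ 2) ≤
      d.maxInDeg / (d.numEdges - (2 * r : ℕ)) * (1 + (r + 1) ^ 2 * (1 / 2) ^ h) *
        (d.maxInDeg / (d.numEdges - (2 * r : ℕ)) * (1 + 2 * ((r + 1) ^ 2 * (1 / 2) ^ h)) +
          2 * (∑ v, (d.inDeg v : ℝ) ^ 2) / (d.numEdges - (2 * r : ℕ)) ^ 2) := by
  classical
  set N := 2 * r with hNdef
  set M : ℝ := d.numEdges - N with hM
  have hmN : 0 < M := sub_pos.2 (by exact_mod_cast hN)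
  -- The price for the first walk to hit the record with `i` steps left. Its own vertices sit at
  -- strictly larger levels until it has come within `h` of `x`, so below `h` only `x` can be hit.
  set cost : ℕ → ℝ := fun i => (if i = 0 then (d.inDeg x : ℝ) else if i < h then 0 else
    r * d.maxInDeg * (1 / 2) ^ h) / M with hcost
  have hcost0 : ∀ i, 0 ≤ cost i := fun i => by simp only [hcost]; positivity
  set A : ℕ → ℝ := fun j => ∑ i ∈ Finset.range j, cost i with hA
  have hA0 : ∀ j, 0 ≤ A j := fun j => Finset.sum_nonneg fun i _ => hcost0 i
  set σ : ℝ := ∑ v, (d.inDeg v : ℝ) ^ 2 with hσ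
  -- Bounds the expected growth of `β` caused by the vertices still to come: a vertex `u` is reached
  -- with probability at most `d⁻_u / M` and adds at most `d⁻_u 2^(-i) / M`, which sums to `2^(-i) σ
  -- / M²`.
  set B : ℕ → ℝ := fun j => ∑ i ∈ Finset.range j, (1 / 2) ^ i * σ / M ^ 2 with hB
  have hB0 : ∀ j, 0 ≤ B j := fun j => Finset.sum_nonneg fun i _ => by positivity
  set β : (ℕ → Finset (Fin n)) → ℝ := fun 𝒯 => levelPotential d h N N (r + 1) 𝒯 with hβ
  have hβ0 : ∀ 𝒯, 0 ≤ β 𝒯 := fun 𝒯 => levelPotential_nonneg hN _ 𝒯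
  -- The growth of `β` due to the current vertex itself, weighted by the price `A j` of finishing
  -- the first walk.
  set lam : ℕ → Fin n → ℝ := fun j v => A j * (d.inDeg v * (1 / 2) ^ j / M) with hlam
  have hlam0 : ∀ j v, 0 ≤ lam j v := fun j v => mul_nonneg (hA0 j) (by positivity)
  have hlamsum : ∀ j, (∑ u, (d.inDeg u : ℝ) * lam j u) / M = A j * ((1 / 2) ^ j * σ / M ^ 2) := by
    intro j
    simp only [hlam, hσ]
    rw [Finset.mul_sum, Finset.sum_div, Finset.sum_div, Finset.mul_sum]
    refine Finset.sum_congr rfl fun u _ => ?_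
    field_simp
  set Good : ℕ → (ℕ → Finset (Fin n)) → Prop := fun j 𝒯 => (𝒯 h).card + j ≤ r ∧ 𝒯 0 = {x} ∧
    ∀ i, 1 ≤ i → i ≤ j → i < h → 𝒯 i = ∅ with hGood
  have hlevel : ∀ j 𝒯, 𝒯 0 = {x} → (∀ i, 1 ≤ i → i ≤ j → i < h → 𝒯 i = ∅) → (𝒯 h).card ≤ r →
      levelDeg d 𝒯 (min j h) * (1 / 2) ^ min j h / M ≤ cost j := by
    intro j 𝒯 h0 h1 hr
    simp only [hcost]
    gcongr
    split_ifs with hj hjh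
    · subst hj
      simp [levelDeg, h0]
    · rw [min_eq_left hjh.le, levelDeg, h1 j (by omega) le_rfl hjh]
      simp
    · push Not at hjh
      rw [min_eq_right hjh]
      gcongr
      exact (levelDeg_le _ _).trans (by gcongr)
  have hend : ∀ j 𝒯 δ, 0 ≤ δ → levelDeg d 𝒯 (min j h) * (1 / 2) ^ min j h / M ≤ cost j →
      ∀ 𝒯₀, β 𝒯 ≤ β 𝒯₀ + δ → levelDeg d 𝒯 (min j h) * ((1 / 2) ^ min j h * β 𝒯) / M +
        (∑ u, (d.inDeg u : ℝ) * lam j u) / M + A j * (β 𝒯 + B j) ≤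
        A (j + 1) * (β 𝒯₀ + B (j + 1)) + A (j + 1) * δ := by
    intro j 𝒯 δ hδ hlev 𝒯₀ hβle
    have hA1 : A (j + 1) = A j + cost j := Finset.sum_range_succ _ _
    have hB1 : B (j + 1) = B j + (1 / 2) ^ j * σ / M ^ 2 := Finset.sum_range_succ _ _
    have h1 : levelDeg d 𝒯 (min j h) * ((1 / 2) ^ min j h * β 𝒯) / M ≤ cost j * β 𝒯 := by
      calc _ = levelDeg d 𝒯 (min j h) * (1 / 2) ^ min j h / M * β 𝒯 := by ring
        _ ≤ _ := mul_le_mul_of_nonneg_right hlev (hβ0 _)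
    rw [hlamsum]
    calc _ ≤ cost j * β 𝒯 + A j * ((1 / 2) ^ j * σ / M ^ 2) + A j * (β 𝒯 + B j) := by gcongr
      _ = A (j + 1) * β 𝒯 + A j * B (j + 1) := by rw [hA1, hB1]; ring
      _ ≤ A (j + 1) * (β 𝒯₀ + δ) + A (j + 1) * B (j + 1) := by
          have := hA0 (j + 1)
          have := hB0 (j + 1)
          gcongr
          rw [hA1]; linarith [hcost0 j]
      _ = _ := by ring
  have key := cavg_core_le_potential h2 x h (Q := fun ω => coreStart ω x h r)
    (fun ω => coreStart_nonneg _ _ _ _) hN (N' := r) (by omega) Good β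
    (fun j 𝒯 => A j * (β 𝒯 + B j)) lam hβ0
    (fun j 𝒯 => mul_nonneg (hA0 j) (add_nonneg (hβ0 _) (hB0 _))) hlam0
    (fun S ω₀ 𝒯 hrec hS hG => cavg_coreStart_le h2 x hN S ω₀ 𝒯 hrec (by omega)
      (by have := hG.1; omega))
    (fun j 𝒯 hG => ⟨by have := hG.1; omega, hG.2.1, fun i h1 h3 h4 => hG.2.2 i h1 (by omega) h4⟩)
    (fun j 𝒯 v hG => by
      refine ⟨?_, ?_, fun i h1 h3 h4 => ?_⟩
      · by_cases hj : h = min (j + 1) h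
        · have := Finset.card_insert_le v (𝒯 h)
          have := hG.1
          rw [← hj, addLevel_self]; omega
        · have := hG.1
          rw [addLevel_of_ne _ hj]; omega
      · rw [addLevel_of_ne _ (by omega)]; exact hG.2.1
      · rw [addLevel_of_ne _ (by omega)]; exact hG.2.2 i h1 (by omega) h4)
    (fun j 𝒯 v hG hv => by
      refine hend j _ (d.inDeg v * (1 / 2) ^ (j + 1) / M) (by positivity) ?_ 𝒯
        (levelPotential_addLevel_le hN (hv _ (min_le_right _ _)))
      refine hlevel j _ ?_ (fun i h1 h3 h4 => ?_) ?_
      · rw [addLevel_of_ne _ (by omega)]; exact hG.2.1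
      · rw [addLevel_of_ne _ (by omega)]; exact hG.2.2 i h1 (by omega) h4
      · have := Finset.card_insert_le v (𝒯 h)
        have := hG.1
        by_cases hj : h = min (j + 1) h
        · rw [← hj, addLevel_self]; omega
        · rw [addLevel_of_ne _ hj]; omega) r
  set 𝒯₀ : ℕ → Finset (Fin n) := fun i => if i = 0 then {x} else ∅ with h𝒯₀
  have hemp : ∀ i, 1 ≤ i → 𝒯₀ i = ∅ := fun i hi => if_neg (by omega)
  have h𝒯h : 𝒯₀ h = ∅ := hemp h hh
  have h𝒯0 : 𝒯₀ 0 = {x} := by simp [h𝒯₀]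
  have key2 := cavg_coreStart_mul_le hN (mul_nonneg (by positivity) (hβ0 _))
    (mul_nonneg (hA0 r) (add_nonneg (hβ0 _) (hB0 _))) (hlam0 r)
    (key ∅ (Classical.arbitrary _) 𝒯₀ ⟨by simp, by simp [h𝒯₀]⟩ (by simp)
      ⟨by simp [h𝒯h], h𝒯0, fun i h1 _ _ => hemp i h1⟩)
  rw [cavg_empty] at key2
  have hfin := key2.trans (hend r 𝒯₀ 0 le_rfl (hlevel r 𝒯₀ h𝒯0 (fun i h1 _ _ => hemp i h1)
    (by simp [h𝒯h])) 𝒯₀ (by simp))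
  rw [mul_zero, add_zero] at hfin
  set D : ℝ := d.maxInDeg / M with hD
  have hD0 : 0 ≤ D := by positivity
  have hxD : (d.inDeg x : ℝ) / M ≤ D := by
    rw [hD]
    gcongr
    exact inDeg_le_maxInDeg x
  have hAle : A (r + 1) ≤ D * (1 + (r + 1) ^ 2 * (1 / 2) ^ h) := by
    refine (sum_range_le_of_le (a := D) (b := r * D * (1 / 2) ^ h)
      (by simpa [hcost] using hxD) (fun i hi => ?_) r).trans ?_
    · simp only [hcost, if_neg hi]
      split_ifs
      · rw [zero_div]; positivity
      · exact le_of_eq (by rw [hD]; ring)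
    · have : 0 ≤ D * (1 / 2) ^ h * (2 * r + 1) := by positivity
      linarith
  have hβle : β 𝒯₀ ≤ D * (1 + 2 * ((r + 1) ^ 2 * (1 / 2) ^ h)) := by
    refine (sum_range_le_of_le (a := D) (b := N * D * (1 / 2) ^ h)
      ?_ (fun i hi => ?_) r).trans ?_
    · rw [if_pos (by omega)]
      simpa [levelDeg, h𝒯0] using hxD
    · split_ifs
      · rw [levelDeg, hemp i (by omega)]
        simp only [Finset.sum_empty, zero_mul, zero_div]
        positivity
      · exact le_of_eq (by rw [hD]; ring)
    · have : 0 ≤ D * (1 / 2) ^ h * (4 * r + 2) := by positivity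
      rw [hNdef]
      push_cast
      linarith
  have hBle : B (r + 1) ≤ 2 * σ / M ^ 2 := by
    simp only [hB]
    rw [← Finset.sum_div, ← Finset.sum_mul]
    have := sum_geometric_two_le (r + 1)
    gcongr
  calc _ = avg (fun ω : d.Matching => if Levels ω x h 𝒯₀ then
        coreStart ω x h r * coreStart ω x h r else 0) := by
        congr 1
        ext ω
        rw [if_pos, sq]
        intro i _ v hv
        by_cases hi : i = 0
        · subst hi
          rw [h𝒯0] at hv
          exact ⟨fun j hj => by omega, fun _ => by simpa [Reach] using hv⟩
        · rw [hemp i (by omega)] at hv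
          simp at hv
    _ ≤ _ := hfin
    _ ≤ _ := by
        have := hB0 (r + 1)
        have := hβ0 𝒯₀
        have := hA0 (r + 1)
        gcongr

end SecondMoment

end BiDegree

namespace BiDegree

/-! ### The first moment of the contribution of the selected walks -/

section FirstMoment

variable {n : ℕ} {d : BiDegree n}

/-- A walk through a fork uses edges with large excess. -/
lemma excess_of_fork {ω : d.Matching} {x v : Fin n} {l : List (Choice d)} {c : Choice d}
    {l₂ q : List (Choice d)} (h : ForkEvent ω x v l c l₂ q) :
    (({x, v} : Finset (Fin n)) ∪ (forkTails ω v l c l₂ q).image fun f => (ω f).1).card +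
      ({x, v} : Finset (Fin n)).card ≤
      ({x, v} : Finset (Fin n)).card + (forkTails ω v l c l₂ q).card := by
  classical
  set E := forkTails ω v l c l₂ q with hE
  obtain ⟨h1, h3⟩ := h.closed (E := E) le_rfl
  have hg : tailAt ω v l c ∈ E := by simp [hE, forkTails]
  have hsub : ({x, v} : Finset (Fin n)) ∪ E.image (fun f => (ω f).1) ⊆
      insert x (E.image Sigma.fst) := by
    intro u hu
    simp only [Finset.mem_union, Finset.mem_insert, Finset.mem_singleton, Finset.mem_image] at hu ⊢
    rcases hu with (rfl | rfl) | ⟨f, hf, rfl⟩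
    exacts [Or.inl rfl, h1, h3 f hf]
  -- Either the fork sits at `x`, which is then a source, or the fork vertex carries two used tails
  -- and one of them pays for `x`.
  have hcard : (insert x (E.image Sigma.fst)).card ≤ E.card := by
    cases q with
    | nil =>
      have hx : x ∈ E.image Sigma.fst :=
        Finset.mem_image.2 ⟨_, hg, h.2.2.1⟩
      rw [Finset.insert_eq_of_mem hx]
      exact Finset.card_image_le
    | cons c' q' =>
      have hg' : (⟨(tailAt ω v l c).1, c' (tailAt ω v l c).1⟩ : d.Tail) ∈ E := by
        simp [hE, forkTails, walkTails]
      have hne := (h.2.2.2 c' q' rfl).2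
      have himage : E.image Sigma.fst ⊆ (E.erase (tailAt ω v l c)).image Sigma.fst := by
        intro u hu
        obtain ⟨f, hf, rfl⟩ := Finset.mem_image.1 hu
        by_cases hfg : f = tailAt ω v l c
        · refine Finset.mem_image.2 ⟨_, Finset.mem_erase.2 ⟨fun he => hne ?_, hg'⟩, by rw [hfg]⟩
          exact eq_of_heq (Sigma.mk.inj he).2
        · exact Finset.mem_image_of_mem _ (Finset.mem_erase.2 ⟨hfg, hf⟩)
      have h4 := Finset.card_le_card himage
      have h5 : ((E.erase (tailAt ω v l c)).image Sigma.fst).card ≤ _ := Finset.card_image_le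
      have h6 := Finset.card_insert_le x (E.image Sigma.fst)
      have h7 := Finset.card_erase_add_one hg
      omega
  have := Finset.card_le_card hsub
  omega

lemma prob_fork_le {N : ℕ} (hN : N < d.numEdges) (x v : Fin n) (l : List (Choice d))
    (c : Choice d) (l₂ q : List (Choice d)) (hl : l.length + l₂.length + q.length + 1 ≤ N) :
    prob (fun ω => ForkEvent ω x v l c l₂ q) ≤
      collRate d 3 N * (collRate d 3 N + if v = x then 1 else 0) := by
  have hmN : (0 : ℝ) < d.numEdges - N := sub_pos.2 (by exact_mod_cast hN)
  let T : Explore d := .fork v l c l₂ q .done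
  have hT : T.Within N := by
    refine Explore.Within.mono (Explore.within_fork (N := 0) v l c l₂ q
      (by simp [Explore.Within])) (by omega)
  have hTt : ∀ ω, T.tails ω = forkTails ω v l c l₂ q := by
    intro ω
    simp only [T, Explore.tails_fork, Explore.tails, Finset.union_empty]
  have key := Explore.prob_excess_le T hT hN {x, v} ({x, v} : Finset (Fin n)).card
  simp only [hTt] at key
  refine (prob_mono fun ω hω => excess_of_fork hω).trans (key.trans ?_)
  set p := collRate d 3 N with hpdef
  have hp0 : 0 ≤ p := by unfold p collRate; positivity
  have h1 : (N * ((({x, v} : Finset (Fin n)).card + N : ℕ) * d.maxInDeg /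
      (d.numEdges - N) : ℝ)) ≤ p := by
    have : ({x, v} : Finset (Fin n)).card ≤ 3 := Finset.card_le_two.trans (by norm_num)
    unfold p collRate
    gcongr
  refine (pow_le_pow_left₀ (by positivity) h1 _).trans ?_
  by_cases hv : v = x
  · subst hv
    simp only [Finset.pair_eq_singleton, Finset.card_singleton, pow_one, if_true]
    nlinarith
  · rw [Finset.card_pair (Ne.symm hv), if_neg hv, add_zero, sq]

/-- The expected contribution of the forks. -/
lemma avg_sum_forkTerm_le (h2 : ∀ v, 2 ≤ d.outDeg v) {K : ℕ} (hK : ∀ v, d.outDeg v ≤ K)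
    {N r h : ℕ} (hN : N < d.numEdges) (hN0 : 0 < N) (x : Fin n) (hl : r + h ≤ N) :
    avg (fun ω : d.Matching => ∑ g, forkTerm ω x h r g) ≤
      (K : ℝ) ^ h * (r * (h + 1)) * (2 * collRate d 3 N ^ 2) := by
  classical
  set p := collRate d 3 N with hpdef
  have hmN : (0 : ℝ) < d.numEdges - N := sub_pos.2 (by exact_mod_cast hN)
  have hm : (0 : ℝ) < d.numEdges := by
    have : (0 : ℝ) ≤ N := Nat.cast_nonneg _
    linarith
  have hp0 : 0 ≤ p := by unfold p collRate; positivity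
  have hxm : (d.inDeg x : ℝ) / d.numEdges ≤ p := by
    refine le_trans ?_ (maxInDeg_div_le_collRate hN0 hN)
    gcongr
    exact inDeg_le_maxInDeg x
  set P := Finset.range r ×ˢ Finset.range (h + 1) with hP
  have hpt : ∀ ω : d.Matching, ∑ g, forkTerm ω x h r g ≤
      (K : ℝ) ^ h * ∑ p ∈ P, ∑ g, forkPart ω x r p.1 p.2 g := by
    intro ω
    rw [Finset.sum_comm, Finset.mul_sum]
    exact Finset.sum_le_sum fun g _ =>
      (forkTerm_le_forkWalk _ _ _ _ _).trans (forkWalk_le h2 hK ω x h r g)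
  refine (avg_mono hpt).trans ?_
  rw [avg_const_mul, avg_sum, mul_assoc]
  gcongr
  have hcard : (P.card : ℝ) = r * (h + 1) := by
    rw [hP, Finset.card_product, Finset.card_range, Finset.card_range]; push_cast; ring
  rw [← hcard, ← nsmul_eq_mul]
  refine Finset.sum_le_card_nsmul _ _ _ fun ⟨j, i⟩ hji => ?_
  rw [hP, Finset.mem_product, Finset.mem_range, Finset.mem_range] at hji
  have h1 : ∀ ω : d.Matching, ∑ g, forkPart ω x r j i g = (1 / (d.numEdges : ℝ)) *
      ∑ v, (d.inDeg v : ℝ) * avgQ (r - 1 - j) j i fun l c l₂ q =>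
        if ForkEvent ω x v l c l₂ q then 1 else 0 := by
    intro ω
    have h3 := sum_tail_mul_eq_avgQ h2 ω x (r - 1 - j) j i fun _ => 1
    simp only [mul_one, one_mul] at h3
    simp only [forkPart]
    rw [h3, one_div_mul_eq_div]
  simp only [h1]
  rw [avg_const_mul, avg_sum]
  simp only [avg_const_mul, avg_avgQ]
  calc _ ≤ (1 / (d.numEdges : ℝ)) * ∑ v, (d.inDeg v : ℝ) * (p * (p + if v = x then 1 else 0)) := by
        refine mul_le_mul_of_nonneg_left (Finset.sum_le_sum fun v _ =>
          mul_le_mul_of_nonneg_left (avgQ_le h2 fun l c l₂ q h1 h3 h4 => ?_) (Nat.cast_nonneg _))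
          (by positivity)
        refine le_trans (le_of_eq ?_) (prob_fork_le hN x v l c l₂ q (by omega))
        unfold prob
        congr 1
    _ = p * (p + d.inDeg x / d.numEdges) := by
        have : ∀ v, (d.inDeg v : ℝ) * (p * (p + if v = x then 1 else 0)) =
          p * p * d.inDeg v + p * if v = x then (d.inDeg v : ℝ) else 0 := by
          intro v; split_ifs <;> ring
        simp only [this, Finset.sum_add_distrib, ← Finset.mul_sum]
        rw [sum_inDeg]
        simp
        field_simp
    _ ≤ _ := by nlinarith

open Classical in
/-- The walk is likely to explore new vertices until its last step. -/
lemma le_cavg_walkPos (x : Fin n) {N w : ℕ} (hN : N < d.numEdges) {a : ℝ}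
    (ha : a = w * d.maxInDeg / (d.numEdges - N)) (ha1 : a ≤ 1) (l : List (Choice d)) :
    ∀ (S : Finset d.Tail) (ω₀ : d.Matching) (W : Finset (Fin n)) (v : Fin n) (c : Choice d),
      (∀ f ∈ S, f.1 ∈ W) → (∀ f ∈ S, (ω₀ f).1 ≠ x) → x ∈ W → v ∉ W → S.card + l.length ≤ N →
      W.card + l.length ≤ w → (1 - a) ^ l.length * (d.inDeg x / d.numEdges) ≤
        cavg S ω₀ (fun ω => if walkPos ω v (c :: l) = x then 1 else 0) := by
  induction l with
  | nil =>
    intro S ω₀ W v c hSW hSx hx hv hS hW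
    have hf : (⟨v, c v⟩ : d.Tail) ∉ S := fun hf => hv (hSW _ hf)
    have hlt : (S.card : ℝ) < d.numEdges := by exact_mod_cast card_lt_numEdges hf
    rw [cavg_reveal hf, List.length_nil, pow_zero, one_mul]
    have h1 : ∀ e ∈ (S.image ω₀)ᶜ, cavg (insert ⟨v, c v⟩ S) (redirect ω₀ ⟨v, c v⟩ e)
        (fun ω => if walkPos ω v [c] = x then (1 : ℝ) else 0) = if e.1 = x then 1 else 0 := by
      intro e _
      rw [cavg_congr (G := fun _ => if e.1 = x then (1 : ℝ) else 0) fun ω hω => by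
        have : ω ⟨v, c v⟩ = e := by rw [hω _ (Finset.mem_insert_self _ _), redirect_self]
        simp only [walkPos, this], cavg_const]
    have h3 : ∑ e ∈ (S.image ω₀)ᶜ, (if e.1 = x then (1 : ℝ) else 0) = d.inDeg x := by
      rw [Finset.sum_subset (Finset.subset_univ _), sum_head fun u => if u = x then (1 : ℝ) else 0]
      · simp
      · intro e _ he
        rw [Finset.mem_compl, not_not, Finset.mem_image] at he
        obtain ⟨f, hf, rfl⟩ := he
        exact if_neg (hSx f hf)
    rw [Finset.sum_congr rfl h1, h3]
    gcongr
    linarith [(Nat.cast_nonneg S.card : (0 : ℝ) ≤ S.card)]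
  | cons c' l ih =>
    intro S ω₀ W v c hSW hSx hx hv hS hW
    rw [List.length_cons] at hS hW ⊢
    have hf : (⟨v, c v⟩ : d.Tail) ∉ S := fun hf => hv (hSW _ hf)
    have hlt : (S.card : ℝ) < d.numEdges := by exact_mod_cast card_lt_numEdges hf
    have hmS : (0 : ℝ) < d.numEdges - S.card := sub_pos.2 hlt
    have hmN : (0 : ℝ) < d.numEdges - N := sub_pos.2 (by exact_mod_cast hN)
    have hSN : (S.card : ℝ) ≤ N := by exact_mod_cast (by omega : S.card ≤ N)
    set B := (1 - a) ^ l.length * (d.inDeg x / d.numEdges : ℝ) with hB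
    have hB0 : 0 ≤ B := mul_nonneg (pow_nonneg (by linarith) _) (by positivity)
    have hWc := Finset.card_insert_of_notMem hv
    rw [cavg_reveal hf, le_div_iff₀ hmS]
    have h1 : ∀ e ∈ (S.image ω₀)ᶜ, (1 - if e.1 ∈ insert v W then (1 : ℝ) else 0) * B ≤
        cavg (insert ⟨v, c v⟩ S) (redirect ω₀ ⟨v, c v⟩ e)
          (fun ω => if walkPos ω v (c :: c' :: l) = x then (1 : ℝ) else 0) := by
      intro e he
      by_cases heW : e.1 ∈ insert v W
      · rw [if_pos heW, sub_self, zero_mul]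
        exact cavg_nonneg fun ω => by split_ifs <;> norm_num
      · rw [if_neg heW, sub_zero, one_mul]
        rw [cavg_congr (G := fun ω => if walkPos ω e.1 (c' :: l) = x then (1 : ℝ) else 0)
          fun ω hω => by
            have : ω ⟨v, c v⟩ = e :=
              (hω ⟨v, c v⟩ (Finset.mem_insert_self _ _)).trans (redirect_self _ _ _)
            rw [walkPos, this]]
        have hcS : (insert (⟨v, c v⟩ : d.Tail) S).card + l.length ≤ N := by
          rw [Finset.card_insert_of_notMem hf]; omega
        have hcW : (insert v W).card + l.length ≤ w := by omega
        refine ih (insert (⟨v, c v⟩ : d.Tail) S) (redirect ω₀ ⟨v, c v⟩ e) (insert v W) e.1 c' ?_ ?_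
          (Finset.mem_insert_of_mem hx) heW hcS hcW
        · intro f hf
          rcases Finset.mem_insert.1 hf with rfl | hf
          · exact Finset.mem_insert_self _ _
          · exact Finset.mem_insert_of_mem (hSW f hf)
        · intro f hf'
          rcases Finset.mem_insert.1 hf' with rfl | hf'
          · rw [redirect_self]
            rintro rfl
            exact heW (Finset.mem_insert_of_mem hx)
          · rw [redirect_of_mem hf (Finset.mem_compl.1 he) hf']
            exact hSx f hf'
    refine le_trans ?_ (Finset.sum_le_sum h1)
    rw [← Finset.sum_mul, Finset.sum_sub_distrib, Finset.sum_const, nsmul_eq_mul, mul_one,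
      card_image_compl]
    have h3 : ∑ e ∈ (S.image ω₀)ᶜ, (if e.1 ∈ insert v W then (1 : ℝ) else 0) ≤
        w * d.maxInDeg := by
      refine (Finset.sum_le_sum_of_subset_of_nonneg (Finset.subset_univ _) fun e _ _ => by
        split_ifs <;> norm_num).trans ((sum_head_mem_le _).trans ?_)
      gcongr
      omega
    have h4 : (w : ℝ) * d.maxInDeg = a * (d.numEdges - N) := by
      rw [ha]; field_simp
    have h5 : a * (d.numEdges - N) ≤ a * (d.numEdges - S.card) := by
      have : 0 ≤ a := by rw [ha]; positivity
      gcongr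
    rw [show (1 - a) ^ (l.length + 1) * (d.inDeg x / d.numEdges : ℝ) * (d.numEdges - S.card) =
      (1 - a) * (d.numEdges - S.card) * B by rw [hB, pow_succ]; ring]
    have := mul_le_mul_of_nonneg_right (by linarith : (1 - a) * (d.numEdges - S.card : ℝ) ≤
      d.numEdges - S.card - ∑ e ∈ (S.image ω₀)ᶜ, (if e.1 ∈ insert v W then (1 : ℝ) else 0)) hB0
    linarith

/-- The expectation of the law of the walk at `x`. -/
lemma le_avg_startP (h2 : ∀ v, 2 ≤ d.outDeg v) {N r : ℕ} (hN : N < d.numEdges) (hN0 : 0 < N)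
    (hp : collRate d 3 N ≤ 1) (x : Fin n) (hr : r < N) :
    (1 - collRate d 3 N) ^ 2 * (d.inDeg x / d.numEdges) ≤
      avg (fun ω : d.Matching => startP ω (r + 1) x) := by
  classical
  set p := collRate d 3 N with hpdef
  have hmN : (0 : ℝ) < d.numEdges - N := sub_pos.2 (by exact_mod_cast hN)
  have hm : (0 : ℝ) < d.numEdges := by
    have : (0 : ℝ) ≤ N := Nat.cast_nonneg _
    linarith
  have hxm : (d.inDeg x : ℝ) / d.numEdges ≤ p := by
    refine le_trans ?_ (maxInDeg_div_le_collRate hN0 hN)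
    gcongr
    exact inDeg_le_maxInDeg x
  set a : ℝ := (3 + N : ℕ) * d.maxInDeg / (d.numEdges - N) with ha
  have ha0 : 0 ≤ a := by positivity
  have hpa : p = N * a := rfl
  have hN1 : (1 : ℝ) ≤ N := by exact_mod_cast hN0
  have ha1 : a ≤ 1 := by nlinarith
  -- Bernoulli's inequality with `r ≤ N` and `p = N a`.
  have hra : 1 - p ≤ (1 - a) ^ r := by
    have h1 := one_add_mul_le_pow (by linarith : (-2 : ℝ) ≤ -a) r
    have h3 : (r : ℝ) ≤ N := by exact_mod_cast hr.le
    have h4 : (r : ℝ) * a ≤ N * a := by gcongr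
    rw [← sub_eq_add_neg] at h1
    linarith
  have hwalk : ∀ v, v ≠ x → (1 - p) * (d.inDeg x / d.numEdges) ≤
      avg (fun ω : d.Matching => walkP ω (r + 1) v x) := by
    intro v hv
    have h1 : (fun ω : d.Matching => walkP ω (r + 1) v x) = fun ω => avgW (r + 1) fun l =>
        if walkPos ω v l = x then (1 : ℝ) else 0 := by
      ext ω
      rw [walkP, ← avgW_walkPos h2]
    rw [h1, avg_avgW, ← avgW_const h2 (r + 1) ((1 - p) * (d.inDeg x / d.numEdges : ℝ))]
    refine avgW_mono fun l hl => ?_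
    obtain _ | ⟨c, l⟩ := l
    · simp at hl
    have hl' : l.length = r := by simpa using hl
    rw [avg_eq_cavg (Classical.arbitrary _)]
    refine le_trans ?_ (le_cavg_walkPos x hN ha ha1 l ∅ _ {x} v c (by simp) (by simp) (by simp)
      (by simpa using hv) (by simp; omega) (by simp; omega))
    rw [hl']
    gcongr
  have hsum : avg (fun ω : d.Matching => startP ω (r + 1) x) =
      (∑ v, (d.inDeg v : ℝ) * avg (fun ω : d.Matching => walkP ω (r + 1) v x)) / d.numEdges := by
    simp only [startP, div_eq_inv_mul]
    rw [avg_const_mul, avg_sum]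
    simp only [avg_const_mul]
  rw [hsum, le_div_iff₀ hm]
  set b := (1 - p) * (d.inDeg x / d.numEdges : ℝ) with hb
  have hb0 : 0 ≤ b := mul_nonneg (by linarith) (by positivity)
  -- The second factor `1 - p` accounts for discarding the starting vertex `x` itself.
  calc _ = (1 - p) * b * d.numEdges := by rw [hb]; ring
    _ ≤ (1 - d.inDeg x / d.numEdges) * b * d.numEdges := by gcongr
    _ = (d.numEdges - d.inDeg x) * b := by field_simp
    _ = ∑ v, (d.inDeg v : ℝ) * if v = x then 0 else b := by
        have : ∀ v, (d.inDeg v : ℝ) * (if v = x then 0 else b) =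
            d.inDeg v * b - if v = x then d.inDeg v * b else 0 := by
          intro v; split_ifs <;> ring
        simp only [this, Finset.sum_sub_distrib, ← Finset.sum_mul]
        rw [sum_inDeg]
        simp
        ring
    _ ≤ _ := by
        refine Finset.sum_le_sum fun v _ => mul_le_mul_of_nonneg_left ?_ (Nat.cast_nonneg _)
        split_ifs with hv
        · exact avg_nonneg fun ω => walkP_nonneg _ _ _ _
        · exact hwalk v hv

end FirstMoment

end BiDegree

namespace BiDegree

/-! ### Bounds on the failure probabilities -/

section FiniteBounds

variable {n : ℕ} {d : BiDegree n}

lemma collRate_mono {y y' N : ℕ} (hN : N < d.numEdges) (h : y ≤ y') :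
    collRate d y N ≤ collRate d y' N := by
  have hmN : (0 : ℝ) < d.numEdges - N := sub_pos.2 (by exact_mod_cast hN)
  unfold collRate
  gcongr

lemma collRate_nonneg {y N : ℕ} (hN : N < d.numEdges) : 0 ≤ collRate d y N := by
  have hmN : (0 : ℝ) < d.numEdges - N := sub_pos.2 (by exact_mod_cast hN)
  unfold collRate
  positivity

lemma exists_inDeg_eq_maxInDeg (hm : 0 < d.numEdges) : ∃ x, d.inDeg x = d.maxInDeg := by
  have hne : Nonempty (Fin n) := by
    by_contra h
    rw [not_nonempty_iff] at h
    simp [numEdges] at hm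
  obtain ⟨x, -, hx⟩ := Finset.exists_mem_eq_sup Finset.univ Finset.univ_nonempty d.inDeg
  exact ⟨x, hx.symm⟩

lemma maxInDeg_pos (hm : 0 < d.numEdges) : 0 < d.maxInDeg := by
  by_contra! h
  have : d.numEdges = 0 := by
    rw [numEdges, d.sum_eq]
    exact Finset.sum_eq_zero fun v _ => by have := inDeg_le_maxInDeg (d := d) v; omega
  omega

/-- The square distance between the laws after `t + 1` steps and a common law. -/
def mixDist (ω : d.Matching) (t : ℕ) : ℝ :=
  ∑ v, ∑ x, (walkP ω (t + 1) v x - startP ω t x) ^ 2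

lemma prob_mixDist_le (h2 : ∀ v, 2 ≤ d.outDeg v) {t N : ℕ} (hN : 2 * t + 2 ≤ N)
    (hNm : N < d.numEdges) : prob (fun ω : d.Matching => 1 / 4 ≤ mixDist ω t) ≤
      4 * (n * ((1 + 12 * (t + 1)) * (1 / 2) ^ (t + 1) + 12 * collRate d 4 N ^ 2)) := by
  refine (prob_markov (fun ω => Finset.sum_nonneg fun v _ => Finset.sum_nonneg fun x _ =>
    sq_nonneg _) (by norm_num)).trans ?_
  have := avg_sum_sq_walkP_sub_le h2 hN hNm
  linarith

/-- With high probability the stationary distribution is unique and bounded from above. -/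
theorem prob_not_le_upper (h2 : ∀ v, 2 ≤ d.outDeg v) {K : ℕ} (hK : ∀ v, d.outDeg v ≤ K)
    {t j h k N : ℕ} (hN : N < d.numEdges) (htN : 2 * t + 2 ≤ N)
    (hhN : 2 * (j * (t + 1) + h) ≤ N) (hkN : k * (j * (t + 1)) ≤ N)
    (hT : (((j * (t + 1) : ℕ) : ℝ) + 1) ^ 2 * (1 / 2) ^ h ≤ 1) (hp : collRate d 4 N ≤ 1) :
    prob (fun ω : d.Matching => ¬ PiMaxSatisfies ω fun piMax => piMax ≤
      2 * (24 * (k + 1) * (d.maxInDeg / (d.numEdges - N)) + d.maxInDeg / d.numEdges) +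
        2 * (1 / 2) ^ j) ≤
      4 * (n * ((1 + 12 * (t + 1)) * (1 / 2) ^ (t + 1) + 12 * collRate d 4 N ^ 2)) +
      ((j * (t + 1) : ℕ) + 1) * (n * ((1 / 8) ^ k +
        ((K : ℝ) ^ h * ((j * (t + 1) : ℕ) * (h + 1))) ^ 2 * (6 * collRate d 4 N ^ 4) /
          (d.maxInDeg / d.numEdges) ^ 2)) := by
  set T := j * (t + 1) with hTdef
  have hmN : (0 : ℝ) < d.numEdges - N := sub_pos.2 (by exact_mod_cast hN)
  have hm : 0 < d.numEdges := by omega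
  have hmR : (0 : ℝ) < d.numEdges := by exact_mod_cast hm
  have hΔ : (0 : ℝ) < d.maxInDeg := by exact_mod_cast maxInDeg_pos hm
  set A : ℝ := 3 * (k + 1) * (d.maxInDeg / (d.numEdges - N)) with hA
  have hA0 : 0 < A := by positivity
  set b : ℝ := d.maxInDeg / d.numEdges with hb
  have hb0 : 0 < b := by positivity
  have hp3 := collRate_mono hN (by norm_num : 3 ≤ 4)
  have hn : 0 < n := (exists_inDeg_eq_maxInDeg hm).choose.pos
  have hne : Nonempty (Fin n) := ⟨⟨0, hn⟩⟩
  -- The factor `8` makes this at most `n^(-3)` once `k ≥ log₂ n`, which survives the union over `x`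
  -- and `r`.
  have hcore : ∀ r ≤ T, ∀ x, prob (fun ω : d.Matching => 8 * A ≤ coreStart ω x h r) ≤
      (1 / 8) ^ k := by
    intro r hr x
    have hkr : k * r ≤ N := (Nat.mul_le_mul_left k hr).trans hkN
    have hkrR : ((k * r : ℕ) : ℝ) ≤ N := by exact_mod_cast hkr
    calc _ ≤ prob (fun ω : d.Matching => (8 * A) ^ k ≤ coreStart ω x h r ^ k) :=
          prob_mono fun ω hω => pow_le_pow_left₀ (by positivity) hω k
      _ ≤ avg (fun ω : d.Matching => coreStart ω x h r ^ k) / (8 * A) ^ k :=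
          prob_markov (fun ω => pow_nonneg (coreStart_nonneg _ _ _ _) _) (by positivity)
      _ ≤ A ^ k / (8 * A) ^ k := by
          gcongr
          refine (avg_coreStart_pow_le h2 x (by omega) ?_).trans ?_
          · refine le_trans ?_ hT
            gcongr
          · have : (0 : ℝ) < d.numEdges - (k * r : ℕ) := by linarith
            rw [hA]
            gcongr
      _ = (1 / 8) ^ k := by rw [← div_pow]; congr 1; field_simp
  have hpairs : ∀ r ≤ T, ∀ x, prob (fun ω : d.Matching => b ^ 2 ≤ forkPairs ω x h r) ≤
      ((K : ℝ) ^ h * (T * (h + 1))) ^ 2 * (6 * collRate d 4 N ^ 4) / b ^ 2 := by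
    intro r hr x
    refine (prob_markov (fun ω => ?_) (by positivity)).trans ?_
    · refine Finset.sum_nonneg fun g _ => Finset.sum_nonneg fun g' _ => ?_
      have h0 : ∀ g, 0 ≤ forkWalk ω x h r g := fun g =>
        (forkTerm_nonneg _ _ _ _ _).trans (forkTerm_le_forkWalk _ _ _ _ _)
      split_ifs
      · exact mul_nonneg (h0 g) (h0 g')
      · exact le_rfl
    · have h0 : 0 ≤ collRate d 3 N := collRate_nonneg hN
      gcongr
      refine (avg_forkPairs_le h2 hK hN (hp3.trans hp) x (by omega)).trans ?_
      gcongr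
  have hsub : ∀ ω : d.Matching, ¬ PiMaxSatisfies ω (fun piMax => piMax ≤
      2 * (24 * (k + 1) * (d.maxInDeg / (d.numEdges - N)) + b) + 2 * (1 / 2) ^ j) →
      1 / 4 ≤ mixDist ω t ∨ ∃ r ∈ Finset.range (T + 1), ∃ x ∈ (Finset.univ : Finset (Fin n)),
        8 * A ≤ coreStart ω x h r ∨ b ^ 2 ≤ forkPairs ω x h r := by
    intro ω hω
    by_contra! hc
    obtain ⟨hmix, hc⟩ := hc
    obtain ⟨π, hπ, huniq, hclose⟩ := exists_unique_isStationary_of_close h2 hn hmix.le j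
    have hT' : (T : ℝ) * (1 / 2) ^ h ≤ 1 := by
      refine le_trans ?_ hT
      gcongr
      nlinarith [(Nat.cast_nonneg T : (0 : ℝ) ≤ T)]
    have hst := startP_le_of_core_of_forkPairs h2 ω hT' (by positivity : 0 ≤ 8 * A) hb0.le
      (fun r hr x => (hc r (Finset.mem_range.2 (by omega)) x (Finset.mem_univ _)).1.le)
      (fun r hr x => (hc r (Finset.mem_range.2 (by omega)) x (Finset.mem_univ _)).2.le) T le_rfl
    refine hω ⟨π, hπ, huniq, ciSup_le fun x => ?_⟩
    have h1 := (abs_le.1 (hclose x)).1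
    have h3 := hst x
    rw [← hTdef] at h1
    have : 2 * (8 * A + b) = 2 * (24 * (k + 1) * (d.maxInDeg / (d.numEdges - N)) + b) := by
      rw [hA]; ring
    linarith
  refine (prob_mono hsub).trans ((prob_or_le _ _).trans (add_le_add (prob_mixDist_le h2 htN hN)
    ((prob_exists_le _ _).trans ?_)))
  refine (Finset.sum_le_card_nsmul _ _ (n * ((1 / 8) ^ k + ((K : ℝ) ^ h * (T * (h + 1))) ^ 2 *
    (6 * collRate d 4 N ^ 4) / b ^ 2)) fun r hr => ?_).trans_eq (by
      rw [Finset.card_range, nsmul_eq_mul]; push_cast; rfl)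
  have hr' : r ≤ T := by have := Finset.mem_range.1 hr; omega
  refine (prob_exists_le _ _).trans ((Finset.sum_le_card_nsmul _ _ _ fun x _ =>
    (prob_or_le _ _).trans (add_le_add (hcore r hr' x) (hpairs r hr' x))).trans_eq (by
      rw [Finset.card_univ, Fintype.card_fin, nsmul_eq_mul]))

/-- With high probability the stationary distribution is unique and large at a vertex of maximal
in-degree. -/
theorem prob_not_le_lower (h2 : ∀ v, 2 ≤ d.outDeg v) {K : ℕ} (hK : ∀ v, d.outDeg v ≤ K)
    {t j h N : ℕ} (hN : N < d.numEdges) (htN : 2 * t + 2 ≤ N) (hh : 1 ≤ h) (hj : 1 ≤ j)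
    (hhN : 2 * (j * (t + 1) + h) ≤ N) (hp : collRate d 4 N ≤ 1) {ε : ℝ} (hε : 0 < ε) :
    prob (fun ω : d.Matching => ¬ PiMaxSatisfies ω fun piMax =>
      (1 - ε) * (d.maxInDeg / d.numEdges) - 2 * (1 / 2) ^ j ≤ piMax) ≤
      4 * (n * ((1 + 12 * (t + 1)) * (1 / 2) ^ (t + 1) + 12 * collRate d 4 N ^ 2)) +
      ((d.numEdges / (d.numEdges - N)) ^ 2 *
        (1 + ((j * (t + 1) : ℕ) + 1) ^ 2 * (1 / 2) ^ h) *
        (1 + 2 * (((j * (t + 1) : ℕ) + 1) ^ 2 * (1 / 2) ^ h) +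
          2 * (∑ v, (d.inDeg v : ℝ) ^ 2) / ((d.numEdges - N) * d.maxInDeg)) - 1 +
        2 * (2 * collRate d 4 N + (K : ℝ) ^ h * ((j * (t + 1) : ℕ) * (h + 1)) *
          (2 * collRate d 4 N ^ 2) / (d.maxInDeg / d.numEdges))) / ε ^ 2 := by
  set T := j * (t + 1) with hTdef
  have hmN : (0 : ℝ) < d.numEdges - N := sub_pos.2 (by exact_mod_cast hN)
  have hm : 0 < d.numEdges := by omega
  have hmR : (0 : ℝ) < d.numEdges := by exact_mod_cast hm
  have hΔ : (0 : ℝ) < d.maxInDeg := by exact_mod_cast maxInDeg_pos hm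
  obtain ⟨x, hx⟩ := exists_inDeg_eq_maxInDeg hm
  set b : ℝ := d.maxInDeg / d.numEdges with hb
  have hb0 : 0 < b := by positivity
  set p := collRate d 4 N with hpdef
  have hp3 : collRate d 3 N ≤ p := collRate_mono hN (by norm_num : 3 ≤ 4)
  have hp30 : 0 ≤ collRate d 3 N := collRate_nonneg hN
  set S : ℝ := ((T : ℝ) + 1) ^ 2 * (1 / 2) ^ h with hS
  set σ : ℝ := ∑ v, (d.inDeg v : ℝ) ^ 2 with hσ
  set M : ℝ := d.numEdges - N with hM
  set F : ℝ := (K : ℝ) ^ h * (T * (h + 1)) * (2 * p ^ 2) with hF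
  set Z : d.Matching → ℝ := fun ω => coreStart ω x h T with hZ
  have hT1 : 1 ≤ T := Nat.mul_pos hj (by omega)
  -- The core is the full law minus the forks, and for one vertex the expected fork contribution is
  -- already small.
  have hfirst : (1 - 2 * p) * b - F ≤ avg Z := by
    have h1 := le_avg_startP h2 hN (by omega) (hp3.trans hp) x (r := T - 1) (by omega)
    rw [Nat.sub_add_cancel hT1, hx] at h1
    have h3 := avg_sum_forkTerm_le h2 hK hN (by omega) x (r := T) (h := h) (by omega)
    have h4 : avg (fun ω : d.Matching => startP ω T x) =
        avg Z + avg (fun ω : d.Matching => ∑ g, forkTerm ω x h T g) := by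
      rw [← avg_add]
      congr 1
      ext ω
      exact startP_eq_core_add ω x h T
    have h5 : (K : ℝ) ^ h * (T * (h + 1)) * (2 * collRate d 3 N ^ 2) ≤ F := by
      rw [hF]; gcongr
    have h6 : (1 - 2 * p) * b ≤ (1 - collRate d 3 N) ^ 2 * b := by
      gcongr
      nlinarith [sq_nonneg (collRate d 3 N)]
    linarith
  have hsecond : avg (fun ω => Z ω ^ 2) ≤
      b ^ 2 * ((d.numEdges / M) ^ 2 * (1 + S) * (1 + 2 * S + 2 * σ / (M * d.maxInDeg))) := by
    have h2T : ((2 * T : ℕ) : ℝ) ≤ N := by exact_mod_cast (by omega : 2 * T ≤ N)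
    have h1 := avg_coreStart_sq_le h2 x hh (r := T) (by omega)
    refine h1.trans ?_
    have h3 : M ≤ d.numEdges - (2 * T : ℕ) := by rw [hM]; linarith
    have h4 : (0 : ℝ) < d.numEdges - (2 * T : ℕ) := by linarith
    have hσ0 : 0 ≤ σ := Finset.sum_nonneg fun v _ => sq_nonneg _
    have hS0 : 0 ≤ S := by positivity
    calc _ ≤ d.maxInDeg / M * (1 + S) * (d.maxInDeg / M * (1 + 2 * S) + 2 * σ / M ^ 2) := by
          gcongr
      _ = _ := by rw [hb]; field_simp
  -- Chebyshev's inequality around `b` instead of the mean, so only a lower bound on the mean and an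
  -- upper bound on the second moment are needed.
  have hcheb : prob (fun ω => Z ω ≤ (1 - ε) * b) ≤
      ((d.numEdges / M) ^ 2 * (1 + S) * (1 + 2 * S + 2 * σ / (M * d.maxInDeg)) - 1 +
        2 * (2 * p + F / b)) / ε ^ 2 := by
    calc _ ≤ prob (fun ω => (ε * b) ^ 2 ≤ (Z ω - b) ^ 2) := by
          refine prob_mono fun ω hω => ?_
          rw [← neg_sq (Z ω - b)]
          exact pow_le_pow_left₀ (by positivity) (by linarith) 2
      _ ≤ avg (fun ω => (Z ω - b) ^ 2) / (ε * b) ^ 2 :=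
          prob_markov (fun ω => sq_nonneg _) (by positivity)
      _ ≤ (b ^ 2 * ((d.numEdges / M) ^ 2 * (1 + S) * (1 + 2 * S + 2 * σ / (M * d.maxInDeg)) - 1 +
        2 * (2 * p + F / b))) / (ε * b) ^ 2 := by
          gcongr
          have h1 : avg (fun ω => (Z ω - b) ^ 2) =
              avg (fun ω => Z ω ^ 2) + ((-2 * b) * avg Z + b ^ 2) := by
            have h0 := avg_const (d := d) (b ^ 2)
            rw [← avg_const_mul, ← h0, ← avg_add, ← avg_add]
            congr 1
            ext ω
            ring
          have h3 := mul_le_mul_of_nonneg_left hfirst hb0.le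
          have h4 : b * F = b ^ 2 * (F / b) := by field_simp
          rw [h1]
          nlinarith
      _ = _ := by field_simp
  have hn : 0 < n := x.pos
  have hsub : ∀ ω : d.Matching, ¬ PiMaxSatisfies ω (fun piMax =>
      (1 - ε) * b - 2 * (1 / 2) ^ j ≤ piMax) → 1 / 4 ≤ mixDist ω t ∨ Z ω ≤ (1 - ε) * b := by
    intro ω hω
    by_contra! hc
    obtain ⟨hmix, hc⟩ := hc
    obtain ⟨π, hπ, huniq, hclose⟩ := exists_unique_isStationary_of_close h2 hn hmix.le j
    refine hω ⟨π, hπ, huniq, le_trans ?_ (le_ciSup (Set.finite_range π).bddAbove x)⟩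
    have h1 := (abs_le.1 (hclose x)).2
    rw [← hTdef] at h1
    have h3 : Z ω ≤ startP ω T x := by
      rw [startP_eq_core_add ω x h T]
      exact le_add_of_nonneg_right (Finset.sum_nonneg fun g _ => forkTerm_nonneg _ _ _ _ _)
    linarith
  exact (prob_mono hsub).trans ((prob_or_le _ _).trans
    (add_le_add (prob_mixDist_le h2 htN hN) hcheb))

end FiniteBounds

end BiDegree

namespace BiDegree

/-! ### Elementary facts about the degrees and the uniform measure -/

section Elementary

variable {n : ℕ} {d : BiDegree n}

lemma two_mul_le_numEdges (h2 : ∀ v, 2 ≤ d.outDeg v) : 2 * n ≤ d.numEdges := by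
  have := Finset.card_nsmul_le_sum Finset.univ d.outDeg 2 fun v _ => h2 v
  rwa [Finset.card_univ, Fintype.card_fin, smul_eq_mul, mul_comm] at this

lemma numEdges_le_mul {K : ℕ} (hK : ∀ v, d.outDeg v ≤ K) : d.numEdges ≤ n * K := by
  have := Finset.sum_le_card_nsmul Finset.univ d.outDeg K fun v _ => hK v
  rwa [Finset.card_univ, Fintype.card_fin, smul_eq_mul] at this

lemma numEdges_le_mul_maxInDeg : d.numEdges ≤ n * d.maxInDeg := by
  have := Finset.sum_le_card_nsmul Finset.univ d.inDeg d.maxInDeg fun v _ => inDeg_le_maxInDeg v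
  rw [Finset.card_univ, Fintype.card_fin, smul_eq_mul] at this
  rwa [numEdges, d.sum_eq]

lemma sum_inDeg_sq_le {η C : ℝ} (hη : 0 < η)
    (h : ∑ v, (d.inDeg v : ℝ) ^ (2 + η) ≤ C * n) :
    ∑ v, (d.inDeg v : ℝ) ^ 2 ≤ C * n := by
  refine (Finset.sum_le_sum fun v _ => ?_).trans h
  rcases Nat.eq_zero_or_pos (d.inDeg v) with h0 | h0
  · rw [h0, Nat.cast_zero, Real.zero_rpow (by linarith)]
    norm_num
  · rw [← Real.rpow_natCast]
    exact Real.rpow_le_rpow_of_exponent_le (by exact_mod_cast h0) (by push_cast; linarith)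

lemma maxInDeg_rpow_le {η C : ℝ} (hm : 0 < d.numEdges)
    (h : ∑ v, (d.inDeg v : ℝ) ^ (2 + η) ≤ C * n) : (d.maxInDeg : ℝ) ^ (2 + η) ≤ C * n := by
  obtain ⟨x, hx⟩ := exists_inDeg_eq_maxInDeg hm
  rw [← hx]
  refine le_trans ?_ h
  exact Finset.single_le_sum (f := fun v => (d.inDeg v : ℝ) ^ (2 + η))
    (fun v _ => by positivity) (Finset.mem_univ x)

open Classical in
lemma dcm_apply (P : d.Matching → Prop) : d.dcm {ω | P ω} = ENNReal.ofReal (prob P) := by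
  have hc : (0 : ℝ) < Fintype.card d.Matching := by exact_mod_cast Fintype.card_pos
  rw [dcm, PMF.toMeasure_uniformOfFintype_apply _ (by trivial), prob, avg,
    ENNReal.ofReal_div_of_pos hc, ENNReal.ofReal_natCast]
  congr 1
  rw [Finset.sum_boole, ENNReal.ofReal_natCast, Fintype.card_subtype]
  rfl

instance : IsProbabilityMeasure d.dcm := by unfold dcm; infer_instance

end Elementary

lemma whp_of_tendsto (d : (n : ℕ) → BiDegree n) (P : (n : ℕ) → (d n).Matching → Prop)
    (h : Tendsto (fun n => prob fun ω => ¬ P n ω) atTop (𝓝 0)) :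
    Whp d fun n => {ω | P n ω} := by
  have h1 : ∀ n, (d n).dcm {ω | P n ω} = 1 - ENNReal.ofReal (prob fun ω => ¬ P n ω) := by
    intro n
    rw [← dcm_apply, ← prob_compl_eq_one_sub (by trivial)]
    congr 1
    ext ω
    simp
  have h3 := ENNReal.Tendsto.sub (tendsto_const_nhds (x := (1 : ENNReal)) (f := atTop (α := ℕ)))
    (ENNReal.tendsto_ofReal h) (Or.inl ENNReal.one_ne_top)
  simp only [ENNReal.ofReal_zero, tsub_zero] at h3
  simpa only [Whp, h1] using h3

end BiDegree

namespace BiDegree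

/-! ### The choice of the parameters -/

/-- The binary logarithm of the number of vertices, rounded up. -/
def logSize (n : ℕ) : ℕ := Nat.clog 2 n

/-- The walk makes `walkLen n - 1` steps. -/
def walkLen (n : ℕ) : ℕ := 2 * logSize n * (2 * logSize n + 1) + 1

/-- The depth of the neighbourhoods of a vertex that are explored. -/
def depth (n : ℕ) : ℕ := Nat.clog 2 (walkLen n ^ 3)

/-- A bound on the number of explored edges. -/
def queryBound (n : ℕ) : ℕ := 8 * walkLen n ^ 3

lemma one_le_walkLen (n : ℕ) : 1 ≤ walkLen n := by unfold walkLen; omega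

lemma one_le_logSize {n : ℕ} (hn : 2 ≤ n) : 1 ≤ logSize n :=
  Nat.clog_pos one_lt_two hn

lemma le_two_pow_logSize (n : ℕ) : n ≤ 2 ^ logSize n := Nat.le_pow_clog one_lt_two n

lemma two_pow_clog_le {n : ℕ} (hn : 1 ≤ n) : 2 ^ Nat.clog 2 n ≤ 2 * n := by
  rcases hn.eq_or_lt with rfl | hn
  · simp
  · have h1 := Nat.pow_pred_clog_lt_self one_lt_two hn
    have h3 := Nat.clog_pos one_lt_two hn
    obtain ⟨k, hk⟩ := Nat.exists_eq_succ_of_ne_zero h3.ne'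
    rw [hk, Nat.pred_succ] at h1
    rw [hk, Nat.succ_eq_add_one, pow_succ]
    omega

lemma logSize_lt_walkLen (n : ℕ) : 2 * logSize n + 1 ≤ walkLen n := by
  unfold walkLen
  rcases Nat.eq_zero_or_pos (logSize n) with h | h <;> nlinarith

lemma walkLen_le {n : ℕ} (hn : 2 ≤ n) : walkLen n ≤ 7 * logSize n ^ 2 := by
  have := one_le_logSize hn
  unfold walkLen
  nlinarith

lemma le_two_pow_depth (n : ℕ) : walkLen n ^ 3 ≤ 2 ^ depth n := Nat.le_pow_clog one_lt_two _

lemma two_pow_depth_le (n : ℕ) : 2 ^ depth n ≤ 2 * walkLen n ^ 3 :=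
  two_pow_clog_le (Nat.one_le_pow _ _ (one_le_walkLen n))

lemma depth_le (n : ℕ) : depth n ≤ walkLen n ^ 3 :=
  Nat.clog_le_of_le_pow (Nat.lt_two_pow_self).le

lemma one_le_depth {n : ℕ} (hn : 2 ≤ n) : 1 ≤ depth n := by
  refine Nat.clog_pos one_lt_two ?_
  have h1 := one_le_logSize hn
  have h3 := logSize_lt_walkLen n
  calc 1 < walkLen n := by omega
    _ ≤ walkLen n ^ 3 := Nat.le_self_pow (by norm_num) _

lemma sq_walkLen_mul_le (n : ℕ) : (walkLen n : ℝ) ^ 2 * (1 / 2) ^ depth n ≤ 1 / walkLen n := by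
  have h1 : (walkLen n : ℝ) ^ 3 ≤ 2 ^ depth n := by exact_mod_cast le_two_pow_depth n
  have h3 : (0 : ℝ) < walkLen n := by exact_mod_cast one_le_walkLen n
  rw [one_div_pow, le_div_iff₀ h3, mul_one_div, div_mul_eq_mul_div, div_le_one (by positivity)]
  linarith

lemma tendsto_logSize : Tendsto logSize atTop atTop := by
  refine tendsto_atTop.2 fun b => ?_
  filter_upwards [eventually_gt_atTop (2 ^ b)] with n hn
  exact ((Nat.lt_clog_iff_pow_lt one_lt_two).2 hn).le

lemma tendsto_walkLen : Tendsto walkLen atTop atTop :=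
  tendsto_atTop_mono (fun n => by have := logSize_lt_walkLen n; omega) tendsto_logSize

/-- Powers of the parameters are negligible compared to powers of `n`. -/
lemma tendsto_walkLen_pow_mul (q : ℕ) {γ c : ℝ} (hγ : 0 < γ) {f : ℕ → ℝ} (h0 : ∀ n, 0 ≤ f n)
    (hf : ∀ᶠ n in atTop, f n ≤ c * (n : ℝ) ^ (-γ)) :
    Tendsto (fun n => (walkLen n : ℝ) ^ q * f n) atTop (𝓝 0) := by
  have hr : (2 : ℝ) ^ (-γ) < 1 := Real.rpow_lt_one_of_one_lt_of_neg one_lt_two (by linarith)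
  have h1 : Tendsto (fun n => 7 ^ q * |c| * 2 ^ γ *
      ((logSize n : ℝ) ^ (2 * q) * ((2 : ℝ) ^ (-γ)) ^ logSize n)) atTop (𝓝 0) := by
    have := (tendsto_pow_const_mul_const_pow_of_lt_one (2 * q) (by positivity) hr).comp
      tendsto_logSize
    simpa using this.const_mul (7 ^ q * |c| * (2 : ℝ) ^ γ)
  refine squeeze_zero' (Eventually.of_forall fun n => mul_nonneg (by positivity) (h0 n)) ?_ h1
  filter_upwards [hf, eventually_ge_atTop 2] with n hfn hn
  have hw : (walkLen n : ℝ) ≤ 7 * (logSize n : ℝ) ^ 2 := by exact_mod_cast walkLen_le hn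
  have hn0 : (0 : ℝ) < n := by exact_mod_cast (by omega : 0 < n)
  have hk : (2 : ℝ) ^ logSize n ≤ 2 * n := by
    exact_mod_cast two_pow_clog_le (by omega : 1 ≤ n)
  have h3 : (n : ℝ) ^ (-γ) ≤ 2 ^ γ * ((2 : ℝ) ^ (-γ)) ^ logSize n := by
    have h4 : (2 * n : ℝ) ^ (-γ) ≤ ((2 : ℝ) ^ logSize n) ^ (-γ) :=
      Real.rpow_le_rpow_of_nonpos (by positivity) hk (by linarith)
    rw [Real.mul_rpow (by norm_num) hn0.le, Real.rpow_neg zero_le_two] at h4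
    rw [← Real.rpow_natCast, ← Real.rpow_mul zero_le_two, mul_comm (-γ), Real.rpow_mul zero_le_two,
      Real.rpow_natCast, ← div_le_iff₀' (by positivity), div_eq_inv_mul]
    exact h4
  calc (walkLen n : ℝ) ^ q * f n ≤ (7 * (logSize n : ℝ) ^ 2) ^ q *
        (|c| * (2 ^ γ * ((2 : ℝ) ^ (-γ)) ^ logSize n)) := by
        refine mul_le_mul (pow_le_pow_left₀ (by positivity) hw q) ?_ (h0 n) (by positivity)
        refine hfn.trans (mul_le_mul (le_abs_self c) h3 (by positivity) (abs_nonneg c))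
    _ = _ := by rw [mul_pow, ← pow_mul]; ring

/-! ### Numerical bounds on the error terms for the chosen parameters -/

section Bounds

variable {n : ℕ} {d : BiDegree n}

lemma le_numEdges_sub (h2 : ∀ v, 2 ≤ d.outDeg v) (hN : queryBound n ≤ n) :
    (n : ℝ) ≤ d.numEdges - queryBound n := by
  have h1 : (2 : ℝ) * n ≤ d.numEdges := by exact_mod_cast two_mul_le_numEdges h2
  have h3 : (queryBound n : ℝ) ≤ n := by exact_mod_cast hN
  linarith

lemma collRate_queryBound_le (h2 : ∀ v, 2 ≤ d.outDeg v) (hn : 2 ≤ n) (hN : queryBound n ≤ n) :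
    collRate d 4 (queryBound n) ≤ 128 * (walkLen n : ℝ) ^ 6 * (d.maxInDeg / n) := by
  have hn0 : (0 : ℝ) < n := by exact_mod_cast (by omega : 0 < n)
  have h1 := le_numEdges_sub h2 hN
  have h3 : ((4 + queryBound n : ℕ) : ℝ) ≤ 2 * (8 * (walkLen n : ℝ) ^ 3) := by
    have h4 : 1 ≤ walkLen n ^ 3 := Nat.one_le_pow _ _ (one_le_walkLen n)
    have : 4 + queryBound n ≤ 2 * (8 * walkLen n ^ 3) := by rw [queryBound]; omega
    exact_mod_cast this
  have h5 : (queryBound n : ℝ) = 8 * (walkLen n : ℝ) ^ 3 := by rw [queryBound]; push_cast; ring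
  calc collRate d 4 (queryBound n) ≤ (8 * (walkLen n : ℝ) ^ 3) *
        (2 * (8 * (walkLen n : ℝ) ^ 3) * d.maxInDeg / n) := by
        unfold collRate
        rw [← h5] at h3 ⊢
        gcongr
    _ = _ := by ring

lemma half_pow_logSize_le {n : ℕ} (hn : 2 ≤ n) : ((1 : ℝ) / 2) ^ logSize n ≤ 1 / n := by
  have hn0 : (0 : ℝ) < n := by exact_mod_cast (by omega : 0 < n)
  rw [one_div_pow]
  refine one_div_le_one_div_of_le hn0 ?_
  exact_mod_cast le_two_pow_logSize n

lemma half_pow_two_mul_logSize_le {n : ℕ} (hn : 2 ≤ n) :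
    ((1 : ℝ) / 2) ^ (2 * logSize n) ≤ 1 / (n : ℝ) ^ 2 := by
  rw [mul_comm, pow_mul, ← one_div_pow]
  exact pow_le_pow_left₀ (by positivity) (half_pow_logSize_le hn) 2

lemma mixError_le (h2 : ∀ v, 2 ≤ d.outDeg v) (hn : 2 ≤ n) (hN : queryBound n ≤ n) :
    4 * (n * ((1 + 12 * ((2 * logSize n : ℕ) + 1)) * (1 / 2 : ℝ) ^ (2 * logSize n + 1) +
      12 * collRate d 4 (queryBound n) ^ 2)) ≤
      (26 + 48 * 128 ^ 2) * ((walkLen n : ℝ) ^ 12 * ((d.maxInDeg : ℝ) ^ 2 / n)) := by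
  have hn0 : (0 : ℝ) < n := by exact_mod_cast (by omega : 0 < n)
  have hm : 0 < d.numEdges := by have := two_mul_le_numEdges h2; omega
  have hΔ : (1 : ℝ) ≤ d.maxInDeg := by exact_mod_cast maxInDeg_pos hm
  have hw : (1 : ℝ) ≤ walkLen n := by exact_mod_cast one_le_walkLen n
  have hk : (2 * logSize n : ℕ) + (1 : ℝ) ≤ walkLen n := by exact_mod_cast logSize_lt_walkLen n
  have hp := collRate_queryBound_le h2 hn hN
  have hp0 : 0 ≤ collRate d 4 (queryBound n) := collRate_nonneg (by
    have := two_mul_le_numEdges h2; omega)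
  have h1 : (1 + 12 * ((2 * logSize n : ℕ) + 1)) * (1 / 2 : ℝ) ^ (2 * logSize n + 1) ≤
      13 / 2 * ((walkLen n : ℝ) ^ 12 * ((d.maxInDeg : ℝ) ^ 2 / n ^ 2)) := by
    rw [pow_succ]
    have hw12 : (walkLen n : ℝ) ≤ (walkLen n : ℝ) ^ 12 := le_self_pow₀ hw (by norm_num)
    have hΔ2 : (1 : ℝ) ≤ (d.maxInDeg : ℝ) ^ 2 := one_le_pow₀ hΔ
    calc _ ≤ (13 * (walkLen n : ℝ) ^ 12) * ((1 / (n : ℝ) ^ 2) * (1 / 2)) := by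
          gcongr
          · linarith
          · exact half_pow_two_mul_logSize_le hn
      _ ≤ (13 * (walkLen n : ℝ) ^ 12) * (((d.maxInDeg : ℝ) ^ 2 / (n : ℝ) ^ 2) * (1 / 2)) := by
          gcongr
      _ = _ := by ring
  calc _ ≤ 4 * (n * (13 / 2 * ((walkLen n : ℝ) ^ 12 * ((d.maxInDeg : ℝ) ^ 2 / n ^ 2)) +
        12 * (128 * (walkLen n : ℝ) ^ 6 * (d.maxInDeg / n)) ^ 2)) := by gcongr
    _ = _ := by field_simp; ring

/-- Since `2 ^ depth n` is polynomial in `walkLen n` and `K ≤ 2 ^ K`, the factor `K ^ depth n` is at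
most the `K`-th power of that polynomial; bounded out-degrees are essential here. -/
lemma pow_depth_mul_le {K : ℕ} (n : ℕ) :
    (K : ℝ) ^ depth n * ((2 * logSize n * (2 * logSize n + 1) : ℕ) * (depth n + 1)) ≤
      2 ^ (K + 1) * (walkLen n : ℝ) ^ (3 * K + 4) := by
  have h1 : (K : ℝ) ≤ 2 ^ K := by exact_mod_cast (Nat.lt_two_pow_self (n := K)).le
  have h3 : (2 : ℝ) ^ depth n ≤ 2 * (walkLen n : ℝ) ^ 3 := by exact_mod_cast two_pow_depth_le n
  have h4 : ((2 * logSize n * (2 * logSize n + 1) : ℕ) : ℝ) ≤ walkLen n := by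
    exact_mod_cast Nat.le_succ _
  have h5 : (depth n : ℝ) + 1 ≤ 2 * (walkLen n : ℝ) ^ 3 := by
    have := depth_le n
    have h6 : 1 ≤ walkLen n ^ 3 := Nat.one_le_pow _ _ (one_le_walkLen n)
    exact_mod_cast (by omega : depth n + 1 ≤ 2 * walkLen n ^ 3)
  calc _ ≤ ((2 : ℝ) ^ K) ^ depth n * (walkLen n * (2 * (walkLen n : ℝ) ^ 3)) := by gcongr
    _ = ((2 : ℝ) ^ depth n) ^ K * (walkLen n * (2 * (walkLen n : ℝ) ^ 3)) := by
        rw [← pow_mul, ← pow_mul, mul_comm K]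
    _ ≤ (2 * (walkLen n : ℝ) ^ 3) ^ K * (walkLen n * (2 * (walkLen n : ℝ) ^ 3)) := by gcongr
    _ = _ := by rw [mul_pow, ← pow_mul]; ring

lemma coreError_le (h2 : ∀ v, 2 ≤ d.outDeg v) {K : ℕ} (hK : ∀ v, d.outDeg v ≤ K) (hn : 2 ≤ n)
    (hN : queryBound n ≤ n) :
    (((2 * logSize n * (2 * logSize n + 1) : ℕ) : ℝ) + 1) * (n * ((1 / 8) ^ logSize n +
      ((K : ℝ) ^ depth n * ((2 * logSize n * (2 * logSize n + 1) : ℕ) * (depth n + 1))) ^ 2 *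
        (6 * collRate d 4 (queryBound n) ^ 4) / (d.maxInDeg / d.numEdges) ^ 2)) ≤
      (1 + (2 ^ (K + 1)) ^ 2 * 6 * 128 ^ 4 * K ^ 2) *
        ((walkLen n : ℝ) ^ (6 * K + 33) * ((d.maxInDeg : ℝ) ^ 2 / n)) := by
  have hn0 : (0 : ℝ) < n := by exact_mod_cast (by omega : 0 < n)
  have hn1 : (1 : ℝ) ≤ n := by exact_mod_cast (by omega : 1 ≤ n)
  have hm : 0 < d.numEdges := by have := two_mul_le_numEdges h2; omega
  have hmR : (0 : ℝ) < d.numEdges := by exact_mod_cast hm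
  have hΔ : (1 : ℝ) ≤ d.maxInDeg := by exact_mod_cast maxInDeg_pos hm
  have hw : (1 : ℝ) ≤ walkLen n := by exact_mod_cast one_le_walkLen n
  have hp := collRate_queryBound_le h2 hn hN
  have hp0 : 0 ≤ collRate d 4 (queryBound n) := collRate_nonneg (by
    have := two_mul_le_numEdges h2; omega)
  have hmK : (d.numEdges : ℝ) ≤ n * K := by exact_mod_cast numEdges_le_mul hK
  have h1 : (((2 * logSize n * (2 * logSize n + 1) : ℕ) : ℝ) + 1) = walkLen n := by
    rw [walkLen]; push_cast; ring
  have h3 : ((1 : ℝ) / 8) ^ logSize n ≤ (d.maxInDeg : ℝ) ^ 2 / n ^ 2 := by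
    have h4 : ((1 : ℝ) / 8) ^ logSize n = (((1 : ℝ) / 2) ^ logSize n) ^ 3 := by
      rw [← pow_mul, mul_comm, pow_mul]; norm_num
    rw [h4]
    calc _ ≤ (1 / (n : ℝ)) ^ 3 := pow_le_pow_left₀ (by positivity) (half_pow_logSize_le hn) 3
      _ = 1 / (n : ℝ) ^ 2 * (1 / n) := by ring
      _ ≤ 1 / (n : ℝ) ^ 2 * 1 := by
          gcongr
          rw [div_le_one hn0]
          exact hn1
      _ = 1 / (n : ℝ) ^ 2 := mul_one _
      _ ≤ _ := by gcongr; exact one_le_pow₀ hΔ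
  rw [h1]
  calc _ ≤ (walkLen n : ℝ) * (n * ((d.maxInDeg : ℝ) ^ 2 / n ^ 2 +
        (2 ^ (K + 1) * (walkLen n : ℝ) ^ (3 * K + 4)) ^ 2 *
          (6 * (128 * (walkLen n : ℝ) ^ 6 * (d.maxInDeg / n)) ^ 4) /
            (d.maxInDeg / (n * K)) ^ 2)) := by
        have h6 : (0 : ℝ) < n * K := hmR.trans_le hmK
        have := pow_depth_mul_le (K := K) n
        gcongr
    _ = (walkLen n : ℝ) ^ 1 * ((d.maxInDeg : ℝ) ^ 2 / n) +
        (2 ^ (K + 1)) ^ 2 * 6 * 128 ^ 4 * K ^ 2 *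
        ((walkLen n : ℝ) ^ (6 * K + 33) * ((d.maxInDeg : ℝ) ^ 2 / n)) := by
        have h6 : (walkLen n : ℝ) ^ (6 * K + 33) =
          walkLen n * ((walkLen n : ℝ) ^ (3 * K + 4)) ^ 2 * ((walkLen n : ℝ) ^ 6) ^ 4 := by ring
        have hK0 : (K : ℝ) ≠ 0 := by
          rintro h
          rw [h, mul_zero] at hmK
          linarith
        rw [h6]
        field_simp
    _ ≤ (walkLen n : ℝ) ^ (6 * K + 33) * ((d.maxInDeg : ℝ) ^ 2 / n) + _ := by
        gcongr
        omega
    _ = _ := by ring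

end Bounds

end BiDegree

namespace BiDegree

/-! ### Asymptotics -/

lemma PiMaxSatisfies.mono {n : ℕ} {d : BiDegree n} {ω : d.Matching} {p q : ℝ → Prop}
    (h : PiMaxSatisfies ω p) (hpq : ∀ y, p y → q y) : PiMaxSatisfies ω q := by
  obtain ⟨π, hπ, huniq, hp⟩ := h
  exact ⟨π, hπ, huniq, hpq _ hp⟩

lemma eventually_queryBound_le : ∀ᶠ n in atTop, queryBound n ≤ n := by
  have h1 := tendsto_walkLen_pow_mul 3 (γ := 1) (c := 1) one_pos (f := fun n => ((n : ℝ))⁻¹)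
    (fun n => by positivity) (Eventually.of_forall fun n => by rw [Real.rpow_neg_one, one_mul])
  filter_upwards [h1.eventually (gt_mem_nhds (by norm_num : (0 : ℝ) < 1 / 8)),
    eventually_gt_atTop 0] with n hn hn0
  have hn0 : (0 : ℝ) < n := by exact_mod_cast hn0
  rw [← div_eq_mul_inv, div_lt_iff₀ hn0] at hn
  have : 8 * (walkLen n : ℝ) ^ 3 ≤ n := by linarith
  rw [queryBound]
  exact_mod_cast this

section Asymptotics

variable {d : (n : ℕ) → BiDegree n}

/-- From `(Δ⁻)^(2+η) ≤ C n` one gets `(Δ⁻)² / n ≤ C^(2/(2+η)) n^(-η/(2+η))`, and a negative power of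
`n` beats all powers of `walkLen n`. -/
lemma tendsto_walkLen_pow_mul_sq {η C : ℝ} (hη : 0 < η) (hC : 0 < C)
    (h2 : ∀ n v, 2 ≤ (d n).outDeg v)
    (hmom : ∀ n, ∑ v, ((d n).inDeg v : ℝ) ^ (2 + η) ≤ C * n) (q : ℕ) :
    Tendsto (fun n => (walkLen n : ℝ) ^ q * (((d n).maxInDeg : ℝ) ^ 2 / n)) atTop (𝓝 0) := by
  have hη2 : 0 < 2 + η := by linarith
  refine tendsto_walkLen_pow_mul q (γ := η / (2 + η)) (c := C ^ (2 / (2 + η))) (by positivity)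
    (fun n => by positivity) ?_
  filter_upwards [eventually_gt_atTop 0] with n hn
  have hn0 : (0 : ℝ) < n := by exact_mod_cast hn
  have hm : 0 < (d n).numEdges := by have := two_mul_le_numEdges (h2 n); omega
  have h1 := Real.rpow_le_rpow (by positivity) (maxInDeg_rpow_le hm (hmom n))
    (by positivity : 0 ≤ 2 / (2 + η))
  rw [← Real.rpow_mul (by positivity), mul_div_cancel₀ _ hη2.ne', Real.mul_rpow hC.le hn0.le,
    Real.rpow_two] at h1
  calc _ ≤ C ^ (2 / (2 + η)) * (n : ℝ) ^ (2 / (2 + η)) / n := by gcongr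
    _ = C ^ (2 / (2 + η)) * ((n : ℝ) ^ (2 / (2 + η)) * (n : ℝ) ^ (-1 : ℝ)) := by
        rw [Real.rpow_neg_one]; ring
    _ = _ := by
        rw [← Real.rpow_add hn0]
        congr 2
        field_simp
        ring

lemma logSize_le_log {n : ℕ} (hn : 2 ≤ n) : (logSize n : ℝ) + 1 ≤ 5 * Real.log n := by
  have h1 := two_pow_clog_le (by omega : 1 ≤ n)
  have h3 : ((2 : ℝ)) ^ logSize n ≤ 2 * n := by exact_mod_cast h1
  have hn0 : (0 : ℝ) < n := by exact_mod_cast (by omega : 0 < n)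
  have h4 := Real.log_le_log (by positivity) h3
  rw [Real.log_pow, Real.log_mul (by norm_num) hn0.ne'] at h4
  have h5 : Real.log 2 ≤ Real.log n := Real.log_le_log (by norm_num) (by exact_mod_cast hn)
  have h6 := Real.log_two_gt_d9
  have h7 : (0 : ℝ) ≤ logSize n := Nat.cast_nonneg _
  nlinarith

/-- The upper bound on the stationary distribution. -/
theorem whp_upper (hd : DegreeCondition d) :
    Whp d (fun n => {ω | PiMaxSatisfies ω (fun piMax =>
      piMax ≤ 500 * Real.log n * (((d n).maxInDeg : ℝ) / (d n).numEdges))}) := by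
  obtain ⟨η, C, K, hη, hC, -, H⟩ := hd
  have h2 := fun n => (H n).1
  have hK := fun n => (H n).2.1
  have hlim := tendsto_walkLen_pow_mul_sq hη hC h2 fun n => (H n).2.2
  have herr := ((hlim 12).const_mul (26 + 48 * 128 ^ 2)).add
    ((hlim (6 * K + 33)).const_mul (1 + (2 ^ (K + 1)) ^ 2 * 6 * 128 ^ 4 * (K : ℝ) ^ 2))
  simp only [mul_zero, add_zero] at herr
  refine whp_of_tendsto d _ (squeeze_zero' (Eventually.of_forall fun n => prob_nonneg _) ?_ herr)
  filter_upwards [eventually_ge_atTop 2, eventually_queryBound_le,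
    (hlim 6).eventually (gt_mem_nhds (by norm_num : (0 : ℝ) < 1 / 128))] with n hn hN hsmall
  have hn0 : (0 : ℝ) < n := by exact_mod_cast (by omega : 0 < n)
  have hm2 := two_mul_le_numEdges (h2 n)
  have hNm : queryBound n < (d n).numEdges := by omega
  have hm : 0 < (d n).numEdges := by omega
  have hmR : (0 : ℝ) < (d n).numEdges := by exact_mod_cast hm
  have hΔ : (1 : ℝ) ≤ (d n).maxInDeg := by exact_mod_cast maxInDeg_pos hm
  have hp : collRate (d n) 4 (queryBound n) ≤ 1 := by
    refine (collRate_queryBound_le (h2 n) hn hN).trans ?_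
    have : (walkLen n : ℝ) ^ 6 * ((d n).maxInDeg / n) ≤
        (walkLen n : ℝ) ^ 6 * (((d n).maxInDeg : ℝ) ^ 2 / n) := by
      gcongr
      exact le_self_pow₀ hΔ (by norm_num)
    linarith
  have hw : 2 * logSize n * (2 * logSize n + 1) + 1 = walkLen n := rfl
  have hw1 := logSize_lt_walkLen n
  have hw3 : walkLen n ≤ walkLen n ^ 3 := Nat.le_self_pow (by norm_num) _
  have hwR : (((2 * logSize n * (2 * logSize n + 1) : ℕ) : ℝ) + 1) = walkLen n := by
    rw [← hw]; push_cast; ring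
  have hw1R : (1 : ℝ) ≤ walkLen n := by exact_mod_cast one_le_walkLen n
  -- With `t = 2 log₂ n` the mixing error is summable over vertices, and with `j = 2 log₂ n` the
  -- distance to `π` is at most `2 / n²`, below the order of `Δ⁻/m ≥ 1/n`; both hold up to rounding
  -- the logarithm upwards.
  have key := prob_not_le_upper (h2 n) (hK n) (t := 2 * logSize n) (j := 2 * logSize n)
    (h := depth n) (k := logSize n) hNm (by rw [queryBound]; omega)
    (by have := depth_le n; rw [queryBound]; omega) (by
      calc logSize n * (2 * logSize n * (2 * logSize n + 1)) ≤ walkLen n * walkLen n :=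
            Nat.mul_le_mul (by omega) (by omega)
        _ ≤ 8 * walkLen n ^ 3 := by nlinarith [one_le_walkLen n]) (by
      rw [hwR]
      refine (sq_walkLen_mul_le n).trans ?_
      rw [div_le_one (by linarith)]
      exact hw1R) hp
  refine ((prob_mono fun ω hω hω' => hω ?_).trans key).trans
    (add_le_add (mixError_le (h2 n) hn hN) (coreError_le (h2 n) (hK n) hn hN))
  refine hω'.mono fun y hy => hy.trans ?_
  set b : ℝ := (d n).maxInDeg / (d n).numEdges with hb
  have hb0 : 0 ≤ b := by positivity
  have hsub : ((d n).maxInDeg : ℝ) / ((d n).numEdges - queryBound n) ≤ 2 * b := by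
    have h1 : (2 : ℝ) * n ≤ (d n).numEdges := by exact_mod_cast hm2
    have h3 : (queryBound n : ℝ) ≤ n := by exact_mod_cast hN
    rw [hb, ← mul_div_assoc, div_le_div_iff₀ (by linarith) hmR]
    nlinarith
  have hhalf : ((1 : ℝ) / 2) ^ (2 * logSize n) ≤ b := by
    refine (half_pow_two_mul_logSize_le hn).trans ?_
    have h1 : ((d n).numEdges : ℝ) ≤ n * (d n).maxInDeg := by
      exact_mod_cast numEdges_le_mul_maxInDeg
    have h3 : (1 : ℝ) ≤ n := by exact_mod_cast (by omega : 1 ≤ n)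
    rw [hb, div_le_div_iff₀ (by positivity) hmR]
    nlinarith
  have hlog := logSize_le_log hn
  calc _ ≤ 2 * (24 * ((logSize n : ℝ) + 1) * (2 * b) + b) + 2 * b := by gcongr
    _ = (96 * ((logSize n : ℝ) + 1) + 4) * b := by ring
    _ ≤ _ := by
        gcongr
        have : (0 : ℝ) ≤ logSize n := Nat.cast_nonneg _
        linarith

/-- The lower bound on the stationary distribution. -/
theorem whp_lower (hd : DegreeCondition d) (hΔlim : Tendsto (fun n => (d n).maxInDeg) atTop atTop)
    {ε : ℝ} (hε : 0 < ε) :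
    Whp d (fun n => {ω | PiMaxSatisfies ω (fun piMax =>
      (1 - ε) * (((d n).maxInDeg : ℝ) / (d n).numEdges) ≤ piMax)}) := by
  obtain ⟨η, C, K, hη, hC, -, H⟩ := hd
  have h2 := fun n => (H n).1
  have hK := fun n => (H n).2.1
  have hlim := tendsto_walkLen_pow_mul_sq hη hC h2 fun n => (H n).2.2
  set s : ℕ → ℝ := fun n => ((d n).maxInDeg : ℝ) ^ 2 / n with hs
  set S : ℕ → ℝ := fun n => 1 / walkLen n with hS
  have hS0 : Tendsto S atTop (𝓝 0) := by
    have := (tendsto_natCast_atTop_atTop (R := ℝ)).comp tendsto_walkLen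
    exact tendsto_const_nhds.div_atTop this
  have hD0 : Tendsto (fun n => 2 * C / ((d n).maxInDeg : ℝ)) atTop (𝓝 0) := by
    have := (tendsto_natCast_atTop_atTop (R := ℝ)).comp hΔlim
    exact tendsto_const_nhds.div_atTop this
  set E : ℕ → ℝ := fun n => (26 + 48 * 128 ^ 2) * ((walkLen n : ℝ) ^ 12 * s n) +
    ((1 + 8 * ((walkLen n : ℝ) ^ 3 * s n)) ^ 2 * (1 + S n) *
      (1 + 2 * S n + 2 * C / (d n).maxInDeg) - 1 +
      2 * (2 * (128 * ((walkLen n : ℝ) ^ 6 * s n)) + 2 ^ (K + 1) * 2 * 128 ^ 2 * K *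
        ((walkLen n : ℝ) ^ (3 * K + 16) * s n))) / (ε / 2) ^ 2 with hE
  have hE0 : Tendsto E atTop (𝓝 0) := by
    have h1 := (((((((hlim 3).const_mul 8).const_add 1).pow 2).mul (hS0.const_add 1)).mul
      (((hS0.const_mul 2).const_add 1).add hD0)).sub_const 1).add
      (((((hlim 6).const_mul 128).const_mul 2).add
        ((hlim (3 * K + 16)).const_mul (2 ^ (K + 1) * 2 * 128 ^ 2 * (K : ℝ)))).const_mul 2)
    have h3 := ((hlim 12).const_mul (26 + 48 * 128 ^ 2)).add (h1.div_const ((ε / 2) ^ 2))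
    simpa using h3
  refine whp_of_tendsto d _ (squeeze_zero' (Eventually.of_forall fun n => prob_nonneg _) ?_ hE0)
  filter_upwards [eventually_ge_atTop 2, eventually_queryBound_le,
    (hlim 6).eventually (gt_mem_nhds (by norm_num : (0 : ℝ) < 1 / 128)),
    (tendsto_natCast_atTop_atTop (R := ℝ)).eventually_ge_atTop (4 / ε)] with n hn hN hsmall hnε
  have hn0 : (0 : ℝ) < n := by exact_mod_cast (by omega : 0 < n)
  have hm2 := two_mul_le_numEdges (h2 n)
  have hNm : queryBound n < (d n).numEdges := by omega
  have hmN := le_numEdges_sub (h2 n) hN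
  have hm : 0 < (d n).numEdges := by omega
  have hmR : (0 : ℝ) < (d n).numEdges := by exact_mod_cast hm
  have hΔ : (1 : ℝ) ≤ (d n).maxInDeg := by exact_mod_cast maxInDeg_pos hm
  have hΔs : ((d n).maxInDeg : ℝ) / n ≤ s n := by
    simp only [hs]
    gcongr
    exact le_self_pow₀ hΔ (by norm_num)
  have hpb := collRate_queryBound_le (h2 n) hn hN
  have hp0 : 0 ≤ collRate (d n) 4 (queryBound n) := collRate_nonneg hNm
  have hps : collRate (d n) 4 (queryBound n) ≤ 128 * ((walkLen n : ℝ) ^ 6 * s n) := by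
    refine hpb.trans ?_
    rw [mul_assoc]
    gcongr
  have hp : collRate (d n) 4 (queryBound n) ≤ 1 := by linarith
  have hw : 2 * logSize n * (2 * logSize n + 1) + 1 = walkLen n := rfl
  have hw1 := logSize_lt_walkLen n
  have hw3 : walkLen n ≤ walkLen n ^ 3 := Nat.le_self_pow (by norm_num) _
  have hwR : (((2 * logSize n * (2 * logSize n + 1) : ℕ) : ℝ) + 1) = walkLen n := by
    rw [← hw]; push_cast; ring
  have hk := one_le_logSize hn
  -- Only `ε / 2` is spent here; the other half absorbs the distance between `startP` and `π`, for
  -- `n ≥ 4 / ε`.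
  have key := prob_not_le_lower (h2 n) (hK n) (t := 2 * logSize n) (j := 2 * logSize n)
    (h := depth n) hNm (by rw [queryBound]; omega) (one_le_depth hn) (by omega)
    (by have := depth_le n; rw [queryBound]; omega) hp (half_pos hε)
  rw [hwR] at key
  have hkey : prob (fun ω : (d n).Matching => ¬ PiMaxSatisfies ω fun piMax =>
      (1 - ε / 2) * ((d n).maxInDeg / (d n).numEdges) - 2 * (1 / 2) ^ (2 * logSize n) ≤ piMax) ≤
      E n := by
    refine key.trans (add_le_add (mixError_le (h2 n) hn hN) ?_)
    have hmN' : (0 : ℝ) < (d n).numEdges - queryBound n := by linarith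
    have hratio : ((d n).numEdges : ℝ) / ((d n).numEdges - queryBound n) ≤
        1 + 8 * ((walkLen n : ℝ) ^ 3 * s n) := by
      have h1 : ((d n).numEdges : ℝ) / ((d n).numEdges - queryBound n) =
          1 + queryBound n / ((d n).numEdges - queryBound n) := by field_simp; ring
      have h3 : (1 : ℝ) / n ≤ s n := le_trans (by gcongr) hΔs
      rw [h1]
      gcongr
      calc (queryBound n : ℝ) / ((d n).numEdges - queryBound n) ≤ queryBound n / n := by gcongr
        _ = 8 * ((walkLen n : ℝ) ^ 3 * (1 / n)) := by rw [queryBound]; push_cast; ring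
        _ ≤ _ := by gcongr
    have hSn := sq_walkLen_mul_le n
    have hσ := sum_inDeg_sq_le hη (H n).2.2
    have hσ0 : 0 ≤ ∑ v, ((d n).inDeg v : ℝ) ^ 2 := Finset.sum_nonneg fun v _ => sq_nonneg _
    have hvar : 2 * (∑ v, ((d n).inDeg v : ℝ) ^ 2) /
        (((d n).numEdges - queryBound n) * (d n).maxInDeg) ≤ 2 * C / (d n).maxInDeg := by
      calc _ ≤ 2 * (C * n) / (n * (d n).maxInDeg : ℝ) := by gcongr
        _ = _ := by field_simp
    have hF : (K : ℝ) ^ depth n * ((2 * logSize n * (2 * logSize n + 1) : ℕ) * (depth n + 1)) *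
        (2 * collRate (d n) 4 (queryBound n) ^ 2) / ((d n).maxInDeg / (d n).numEdges) ≤
        2 ^ (K + 1) * 2 * 128 ^ 2 * K * ((walkLen n : ℝ) ^ (3 * K + 16) * s n) := by
      have hmK : ((d n).numEdges : ℝ) ≤ n * K := by exact_mod_cast numEdges_le_mul (hK n)
      have h6 : (0 : ℝ) < n * K := hmR.trans_le hmK
      have hK0 : (K : ℝ) ≠ 0 := by
        rintro h
        rw [h, mul_zero] at h6
        exact lt_irrefl _ h6
      have := pow_depth_mul_le (K := K) n
      calc _ ≤ (2 ^ (K + 1) * (walkLen n : ℝ) ^ (3 * K + 4)) *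
            (2 * (128 * (walkLen n : ℝ) ^ 6 * ((d n).maxInDeg / n)) ^ 2) /
              ((d n).maxInDeg / (n * K)) := by gcongr
        _ = 2 ^ (K + 1) * 2 * 128 ^ 2 * K *
            ((walkLen n : ℝ) ^ (3 * K + 16) * ((d n).maxInDeg / n)) := by
            have h7 : (walkLen n : ℝ) ^ (3 * K + 16) =
              (walkLen n : ℝ) ^ (3 * K + 4) * ((walkLen n : ℝ) ^ 6) ^ 2 := by ring
            rw [h7]
            field_simp
        _ ≤ _ := by gcongr
    have hS0' : (0 : ℝ) ≤ (walkLen n : ℝ) ^ 2 * (1 / 2) ^ depth n := by positivity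
    have hs0 : 0 ≤ s n := by simp only [hs]; positivity
    have hSn0 : 0 ≤ S n := by simp only [hS]; positivity
    gcongr
  refine (prob_mono fun ω hω hω' => hω ?_).trans hkey
  refine hω'.mono fun y hy => le_trans ?_ hy
  set b : ℝ := (d n).maxInDeg / (d n).numEdges with hb
  have hhalf : 2 * ((1 : ℝ) / 2) ^ (2 * logSize n) ≤ ε / 2 * b := by
    have h1 : ((d n).numEdges : ℝ) ≤ n * (d n).maxInDeg := by
      exact_mod_cast numEdges_le_mul_maxInDeg
    have h3 : 1 / (n : ℝ) ≤ b := by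
      rw [hb, div_le_div_iff₀ hn0 hmR]
      linarith
    have h4 : 4 ≤ ε * n := by rwa [div_le_iff₀' hε] at hnε
    calc _ ≤ 2 * (1 / (n : ℝ) ^ 2) := by gcongr; exact half_pow_two_mul_logSize_le hn
      _ = 1 / 2 * 4 * (1 / (n : ℝ) ^ 2) := by ring
      _ ≤ 1 / 2 * (ε * n) * (1 / (n : ℝ) ^ 2) := by gcongr
      _ = ε / 2 * (1 / n) := by field_simp
      _ ≤ _ := by gcongr
  linarith

end Asymptotics

end BiDegree

end

theorem mainTheorem1 :
    (∃ C : ℝ, 0 < C ∧ ∀ d : (n : ℕ) → BiDegree n, DegreeCondition d →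
      Whp d (fun n => {ω | BiDegree.PiMaxSatisfies ω (fun piMax =>
        piMax ≤ C * Real.log (n : ℝ) * (((d n).maxInDeg : ℝ) / ((d n).numEdges : ℝ)))})) ∧
    (∀ d : (n : ℕ) → BiDegree n, DegreeCondition d →
      Tendsto (fun n => (d n).maxInDeg) atTop atTop →
      ∀ ε : ℝ, 0 < ε →
      Whp d (fun n => {ω | BiDegree.PiMaxSatisfies ω (fun piMax =>
        (1 - ε) * (((d n).maxInDeg : ℝ) / ((d n).numEdges : ℝ)) ≤ piMax)})) := by
  -- The constant comes from `96 (k + 1) + 4 ≤ 100 (k + 1)` and `k + 1 ≤ 5 log n`, where `k =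
  -- logSize n`.
  exact ⟨⟨500, by norm_num, fun d hd => BiDegree.whp_upper hd⟩,
    fun d hd hΔ ε hε => BiDegree.whp_lower hd hΔ hε⟩
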